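/- **Theorem (Birkhoff normal form for the beam Hamiltonian).** *Spaces.* For $j\in\mathbb Z$ put $\langle j\rangle=\max\{1,|j|\}$, $\lfloor j\rfloor=\max\{2,|j|\}$ and, for $1<q\le 2$, $\lambda(j)=(\ln(2+\langle j\rangle))^{q}$. For $s\ge 0$, $p>0$ let $w(s,p)=(\lfloor j\rfloor^{p}e^{s\lambda(j)})_{j\in\mathbb Z}$ and $w(p)=w(0,p)$. For a weight $w$ let $h_w$ be the space of $u\in\ell^2(\mathbb Z,\mathbb C)$ with $|u|_w^2=\sum_j w_j^2|u_j|^2<\infty$, with symplectic form $\mathrm i\sum_j du_j\wedge d\bar u_j$, and let $B_r(h_w)$ be its closed ball of radius $r$ centred at $0$. A map on such a ball is called symplectic if it is real analytic at every point of the ball and its differential there preserves the symplectic form. *Hamiltonians.* Consider formal series $H=\sum H_{\alpha,\beta}u^\alpha\bar u^\beta$ over finitely supported $\alpha,\beta\in\mathbb N^{\mathbb Z}$ with $|\alpha|+|\beta|\ge 2$, with $H_{\alpha,\beta}=\overline{H_{\beta,\alpha}}$, and with $H_{\alpha,\beta}\ne0$ only if $\sum_j j(\alpha_j-\beta_j)=0$.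 Let $\mathcal H_r(h_w)$ be the space of those for which $\underline H=\sum|H_{\alpha,\beta}|u^\alpha\bar u^\beta$ converges absolutely at every point of $B_r(h_w)$ and $|H|_{r,w}:=r^{-1}\sup_{|u|_w\le r}|X_{\underline H}(u)|_w<\infty$, where $X_{\underline H}^{(j)}=-\mathrm i\,\partial_{\bar u_j}\underline H$. We say that $H$ has scaling degree $\ge d$ (resp. $\le d$) if $H_{\alpha,\beta}\neq 0$ only for $|\alpha|+|\beta|\ge d+2$ (resp. $\le d+2$). A pair $(\alpha,\beta)$ with $\sum_j j(\alpha_j-\beta_j)=0$ is *resonant* if $\alpha_j+\alpha_{-j}=\beta_j+\beta_{-j}$ for all $j$, and $H$ is resonant if $H_{\alpha,\beta}\ne0$ only for resonant $(\alpha,\beta)$. *Frequencies.* Let $\omega_j=\sqrt{j^4+m}$ with $m\in[1,2]$, and $D_\omega(u)=\sum_j\omega_j|u_j|^2$. For $0<\gamma<1$, $\omega\in\mathtt D_\gamma$ means that $$|\omega\cdot\ell|\ \ge\ \gamma^{d(\ell)}\prod_{n\in\mathbb Z}\frac1{(1+\ell_n^2\langle n\rangle^2)^{\tau}},\qquad \tau=d(\ell)(d(\ell)+2),\quad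 d(\ell)=\#\{n:\ell_n\ne0\},$$ for every $\ell=\alpha-\beta$ with $\alpha,\beta$ finitely supported, $\sum_j j(\alpha_j-\beta_j)=0$ and $(\alpha,\beta)$ not resonant. *Statement.* There is an absolute constant $C>0$ such that the following holds. Let $1<q\le2$, $m\in[1,2]$, $0<\gamma<1$, $\omega\in\mathtt D_\gamma$, $p>0$, $\bar r>0$, and let $K\ge1$ be an integer. Consider one of the two cases - (sub-exponential) $s_0>0$, $w_0=w(s_0,p)$, $w_f=w(\tfrac32s_0,p)$, $J=\gamma^{-4K}\exp\exp\Big(\big(\tfrac{CK^2}{\min\{s_0,1\}}\big)^{\frac1{q-1}}\Big)$; - (Sobolev) $w_0=w(p)$, $w_f=w(p+\zeta)$ with $\zeta=36^2\sum_{i=1}^Ki^2$, and $J=\gamma^{-4K}\exp(2^{12}CK^3)$. Let $H=D_\omega+R_0$, where $R_0\in\mathcal H_{\bar r}(h_{w_0})$ has scaling degree $\ge1$ and $\rho:=|R_0|_{\bar r,w_0}\le1$. Let $$0<r_0\le r_0^\star:=\min\Big\{\bar r,\ \Big(\frac{4^{K+3}\rho}{\bar r}\,J\,32eK\Big)^{-1}\Big\}$$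 (with $r_0^\star=\bar r$ if $\rho=0$). Then there is a symplectic map $\Phi:B_{r_0/2}(h_{w_f})\to B_{r_0}(h_{w_f})$ with $$\sup_{u\in B_{r_0/2}(h_{w_f})}|\Phi(u)-u|_{w_f}\le C_1r_0^2\le\frac{r_0}8,\qquad C_1=\frac{\rho}{\bar r}J,$$ and there are $\mathfrak Z,\mathfrak R\in\mathcal H_{r_0/2}(h_{w_f})$, with $\mathfrak Z$ resonant of scaling degree $\le K$ and $\mathfrak R$ of scaling degree $\ge K+1$, such that $H\circ\Phi=D_\omega+\mathfrak Z+\mathfrak R$ on $B_{r_0/2}(h_{w_f})$ and $$|\mathfrak Z|_{r_0/2,w_f}\le C_2r_0^2,\quad |\mathfrak R|_{r_0/2,w_f}\le C_3r_0^{K+1},\qquad C_2=\frac{16eK\rho\,4^{K+1}}{\bar r^2}J,\quad C_3=\frac{\rho\,(16eK4^{K+2})^K}{\bar r^{K+1}}J^K.$$ -/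

import Mathlib

open scoped ENNReal ComplexConjugate

noncomputable section

namespace BeamBNF

/-! Weights and sequence spaces -/

/-- `⟨j⟩ = max {1, |j|}`. -/
def bracketOne (j : ℤ) : ℝ := max 1 |(j : ℝ)|

/-- `⌊j⌋ = max {2, |j|}`. -/
def bracketTwo (j : ℤ) : ℝ := max 2 |(j : ℝ)|

/-- `λ(j) = (ln (2 + ⟨j⟩)) ^ q`. -/
def lam (q : ℝ) (j : ℤ) : ℝ := Real.log (2 + bracketOne j) ^ q

/-- A positive sequence indexed by `ℤ`. -/
structure Weight where
  toFun : ℤ → ℝ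
  pos : ∀ j, 0 < toFun j

/-- The weight `w(s, p)_j = ⌊j⌋ ^ p * exp (s λ(j))`; the Sobolev weight `w(p)` is the case `s = 0`
(in which `q` plays no role). -/
def weight (q s p : ℝ) : Weight where
  toFun j := bracketTwo j ^ p * Real.exp (s * lam q j)
  pos _ := mul_pos
    (Real.rpow_pos_of_pos (lt_of_lt_of_le two_pos (le_max_left _ _)) _) (Real.exp_pos _)

/-- The sequences `u ∈ ℓ²(ℂ)` such that `∑ j, w_j ^ 2 * |u_j| ^ 2 < ∞`. -/
def weightedSubmodule (w : Weight) : Submodule ℂ (ℤ → ℂ) where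
  carrier := {u | Memℓp u 2 ∧ Memℓp (fun j => (w.toFun j : ℂ) * u j) 2}
  add_mem' := by
    rintro u v ⟨hu, hu'⟩ ⟨hv, hv'⟩
    refine ⟨hu.add hv, ?_⟩
    have h := hu'.add hv'
    have e : (fun j => (w.toFun j : ℂ) * (u + v) j)
        = (fun j => (w.toFun j : ℂ) * u j) + fun j => (w.toFun j : ℂ) * v j := by
      funext j
      simp [mul_add]
    rw [e]
    exact h
  zero_mem' := by
    refine ⟨zero_memℓp, ?_⟩
    have e : (fun j => (w.toFun j : ℂ) * (0 : ℤ → ℂ) j) = 0 := by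
      funext j
      simp
    rw [e]
    exact zero_memℓp
  smul_mem' := by
    rintro c u ⟨hu, hu'⟩
    refine ⟨hu.const_smul c, ?_⟩
    have h := hu'.const_smul c
    have e : (fun j => (w.toFun j : ℂ) * (c • u) j)
        = c • fun j => (w.toFun j : ℂ) * u j := by
      funext j
      simp only [Pi.smul_apply, smul_eq_mul]
      ring
    rw [e]
    exact h

/-- The weighted sequence space `h_w`; its norm, introduced below, is
`|u|_w = (∑ j, w_j ^ 2 * |u_j| ^ 2) ^ (1 / 2)`. -/
def HSpace (w : Weight) : Type := weightedSubmodule w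

instance (w : Weight) : AddCommGroup (HSpace w) :=
  inferInstanceAs (AddCommGroup (weightedSubmodule w))

instance (w : Weight) : Module ℂ (HSpace w) :=
  inferInstanceAs (Module ℂ (weightedSubmodule w))

/-- The sequence underlying an element of `h_w`. -/
def HSpace.coords {w : Weight} (u : HSpace w) : ℤ → ℂ := Subtype.val u

instance (w : Weight) : CoeFun (HSpace w) (fun _ => ℤ → ℂ) := ⟨HSpace.coords⟩

/-- The map `u ↦ (w_j u_j)_j` from `h_w` to `ℓ²`. -/
def HSpace.toL2 (w : Weight) : HSpace w →ₗ[ℂ] lp (fun _ : ℤ => ℂ) 2 where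
  toFun u := ⟨fun j => (w.toFun j : ℂ) * u j, u.2.2⟩
  map_add' u v := by
    ext j
    exact mul_add _ _ _
  map_smul' c u := by
    ext j
    exact mul_left_comm _ _ _

theorem HSpace.toL2_injective (w : Weight) : Function.Injective (HSpace.toL2 w) := by
  intro u v h
  apply Subtype.ext
  funext j
  have hj : (w.toFun j : ℂ) * u j = (w.toFun j : ℂ) * v j :=
    congrFun (congrArg Subtype.val h) j
  exact mul_left_cancel₀ (Complex.ofReal_ne_zero.mpr (w.pos j).ne') hj

instance (w : Weight) : NormedAddCommGroup (HSpace w) :=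
  NormedAddCommGroup.induced (HSpace w) (lp (fun _ : ℤ => ℂ) 2) (HSpace.toL2 w)
    (HSpace.toL2_injective w)

instance (w : Weight) : NormedSpace ℂ (HSpace w) :=
  NormedSpace.induced ℂ (HSpace w) (lp (fun _ : ℤ => ℂ) 2) (HSpace.toL2 w)

/-- The symplectic form `Ω = i ∑ j, du_j ∧ dū_j` on `h_w`. -/
def symplecticForm {w : Weight} (ξ η : HSpace w) : ℂ :=
  Complex.I * ∑' j : ℤ, (ξ j * conj (η j) - conj (ξ j) * η j)

/-- `Φ` is a symplectic map on `s`: it is real analytic at every point of `s` and its differential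
there preserves `Ω`. -/
def IsSymplecticOn {w : Weight} (Φ : HSpace w → HSpace w) (s : Set (HSpace w)) : Prop :=
  AnalyticOnNhd ℝ Φ s ∧
    ∀ u ∈ s, ∀ ξ η : HSpace w,
      symplecticForm (fderiv ℝ Φ u ξ) (fderiv ℝ Φ u η) = symplecticForm ξ η

/-! Hamiltonians, given by their Taylor coefficients -/

/-- Elements of `ℕ^ℤ` of finite length. -/
abbrev MultiIndex : Type := ℤ →₀ ℕ

/-- A family of coefficients `H_{α,β}`, standing for the power series
`∑ H_{α,β} u^α ū^β`. -/
abbrev Ham : Type := MultiIndex × MultiIndex → ℂ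

/-- `|α| + |β|`. -/
def totalDegree (a : MultiIndex × MultiIndex) : ℕ :=
  (a.1.sum fun _ n => n) + (a.2.sum fun _ n => n)

/-- `π(α - β) = ∑ j, j (α_j - β_j)`. -/
def momentum (a : MultiIndex × MultiIndex) : ℤ :=
  (a.1.sum fun j n => j * (n : ℤ)) - (a.2.sum fun j n => j * (n : ℤ))

/-- `u^α ū^β`. -/
def mono (u : ℤ → ℂ) (a : MultiIndex × MultiIndex) : ℂ :=
  (a.1.prod fun j n => u j ^ n) * (a.2.prod fun j n => conj (u j) ^ n)

/-- The value `H(u) = ∑ H_{α,β} u^α ū^β`. -/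
def Ham.eval (H : Ham) (u : ℤ → ℂ) : ℂ := ∑' a, H a * mono u a

/-- The space `A_r(h_w)`: real, momentum preserving power series, starting at degree two, whose
majorant converges absolutely at every point of the closed ball of radius `r`. -/
structure IsAdmissible (r : ℝ) (w : Weight) (H : Ham) : Prop where
  two_le : ∀ a, H a ≠ 0 → 2 ≤ totalDegree a
  reality : ∀ α β : MultiIndex, H (α, β) = conj (H (β, α))
  momentum_eq : ∀ a, H a ≠ 0 → momentum a = 0
  summable : ∀ u : HSpace w, ‖u‖ ≤ r → Summable fun a => ‖H a‖ * ‖mono u a‖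

/-- The `j`-th component, at `(|u_i|)_i` and up to the factor `-i`, of the Hamiltonian vector field
`-i ∂_{ū_j}` of the majorant `∑ |H_{α,β}| u^α ū^β`, that is
`∑ |H_{α,β}| β_j |u|^(α + β - e_j)`, a sum of nonnegative terms with values in `[0, ∞]`. -/
def majorantField (H : Ham) (u : ℤ → ℂ) (j : ℤ) : ℝ≥0∞ :=
  ∑' a : MultiIndex × MultiIndex, ENNReal.ofReal
    (‖H a‖ * (a.2 j : ℝ) * (a.1 + (a.2 - Finsupp.single j 1)).prod fun i n => ‖u i‖ ^ n)

/-- The norm `|H|_{r,w} = r⁻¹ sup_{|u|_w ≤ r} |X(u)|_w`, where `X` is the Hamiltonian vector field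
of the majorant of `H`, with value `∞` if `X` diverges or is unbounded. The coefficients of the
majorant being nonnegative, each component of `X` is at most its value at `(|u_i|)_i`, a point of
the same ball, so only such points need be considered. -/
def hamNorm (r : ℝ) (w : Weight) (H : Ham) : ℝ≥0∞ :=
  (⨆ (u : HSpace w) (_ : ‖u‖ ≤ r),
    (∑' j : ℤ, (ENNReal.ofReal (w.toFun j) * majorantField H u j) ^ 2) ^ (1 / 2 : ℝ))
    / ENNReal.ofReal r

/-- The space `H_r(h_w)` of regular Hamiltonians. -/
def IsRegular (r : ℝ) (w : Weight) (H : Ham) : Prop :=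
  IsAdmissible r w H ∧ hamNorm r w H < ⊤

/-- `H` has scaling degree at least `d`: all its monomials have degree at least `d + 2`. -/
def ScalingDegreeGE (d : ℕ) (H : Ham) : Prop := ∀ a, H a ≠ 0 → d + 2 ≤ totalDegree a

/-- `H` has scaling degree at most `d`: all its monomials have degree at most `d + 2`. -/
def ScalingDegreeLE (d : ℕ) (H : Ham) : Prop := ∀ a, H a ≠ 0 → totalDegree a ≤ d + 2

/-- Resonant pairs of exponents: those of zero momentum for which `ω · (α - β)` vanishes
identically for even `ω`, that is `ℓ_j + ℓ_{-j} = 0` for all `j`, with `ℓ = α - β`. -/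
def IsResonantIndex (a : MultiIndex × MultiIndex) : Prop :=
  momentum a = 0 ∧ ∀ j : ℤ, a.1 j + a.1 (-j) = a.2 j + a.2 (-j)

/-- `H` is supported on resonant monomials. -/
def IsResonant (H : Ham) : Prop := ∀ a, H a ≠ 0 → IsResonantIndex a

/-! Frequencies -/

/-- The frequencies `ω_j = (j ^ 4 + m) ^ (1 / 2)`. -/
def beamFrequency (m : ℝ) (j : ℤ) : ℝ := Real.sqrt (|(j : ℝ)| ^ 4 + m)

/-- `D_ω(u) = ∑ j, ω_j |u_j| ^ 2`. -/
def quadraticHam (ω : ℤ → ℝ) (u : ℤ → ℂ) : ℝ := ∑' j : ℤ, ω j * ‖u j‖ ^ 2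

/-- The vectors `ℓ = α - β` with `(α, β)` of zero momentum and not resonant. -/
def nonresonantVectors : Set (ℤ →₀ ℤ) :=
  {ℓ | ∃ a : MultiIndex × MultiIndex, momentum a = 0 ∧ ¬ IsResonantIndex a ∧
    ∀ j, ℓ j = (a.1 j : ℤ) - (a.2 j : ℤ)}

/-- The Diophantine set `D_γ`: with `d` the number of nonzero components of `ℓ` and
`τ = d (d + 2)`, one has `|ω · ℓ| ≥ γ ^ d ∏ n, (1 + ℓ_n ^ 2 ⟨n⟩ ^ 2) ^ (-τ)` for all nonresonant
`ℓ`. The factors with `ℓ_n = 0` are equal to one. -/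
def diophantine (γ : ℝ) : Set (ℤ → ℝ) :=
  {ω | ∀ ℓ ∈ nonresonantVectors,
    γ ^ ℓ.support.card *
        ∏ n ∈ ℓ.support,
          ((1 + (ℓ n : ℝ) ^ 2 * bracketOne n ^ 2) ^ (ℓ.support.card * (ℓ.support.card + 2)))⁻¹
      ≤ |ℓ.sum fun n k => ω n * (k : ℝ)|}

/-! The two functional settings and the constants -/

/-- The sub-exponential setting, with its parameter `s₀ > 0`, and the Sobolev setting. -/
inductive Setting : Type
  | subexponential (s₀ : ℝ) (hs₀ : 0 < s₀)
  | sobolev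

/-- The initial weight `w_0`. -/
def Setting.initialWeight (q p : ℝ) : Setting → Weight
  | .subexponential s₀ _ => weight q s₀ p
  | .sobolev => weight q 0 p

/-- The final weight `w_f`: `w(3 s₀ / 2, p)`, respectively `w(p + ζ)` with
`ζ = 36 ^ 2 ∑_{i = 1}^K i ^ 2`. -/
def Setting.finalWeight (q p : ℝ) (K : ℕ) : Setting → Weight
  | .subexponential s₀ _ => weight q (3 / 2 * s₀) p
  | .sobolev => weight q 0 (p + 36 ^ 2 * ∑ i ∈ Finset.Icc 1 K, (i : ℝ) ^ 2)

/-- The constant `J_K`; in the sub-exponential setting the loss of decay available to the small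
divisors is of the size of `s₀`, but only up to one. -/
def Setting.J (C q γ : ℝ) (K : ℕ) : Setting → ℝ
  | .subexponential s₀ _ =>
      (γ ^ (4 * K))⁻¹ * Real.exp (Real.exp (((K : ℝ) ^ 2 * C / min s₀ 1) ^ (1 / (q - 1))))
  | .sobolev => (γ ^ (4 * K))⁻¹ * Real.exp (C * 2 ^ 12 * (K : ℝ) ^ 3)

/-- The threshold `r_0^⋆ = min {r̄, (4^(K+3) (ρ / r̄) J 32 e K)⁻¹}`, where `ρ` is the norm of the
perturbation; the second entry is infinite if `ρ = 0`. -/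
def rStar (rbar ρ J : ℝ) (K : ℕ) : ℝ :=
  if ρ = 0 then rbar
  else min rbar (4 ^ (K + 3) * ρ / rbar * J * (32 * Real.exp 1 * K))⁻¹

/-- `C_1 = (ρ / r̄) J`. -/
def constOne (rbar ρ J : ℝ) : ℝ := ρ / rbar * J

/-- `C_2 = 16 e K ρ 4^(K+1) / r̄^2 * J`. -/
def constTwo (rbar ρ J : ℝ) (K : ℕ) : ℝ :=
  16 * Real.exp 1 * K * ρ * 4 ^ (K + 1) / rbar ^ 2 * J

/-- `C_3 = ρ (16 e K 4^(K+2))^K / r̄^(K+1) * J^K`. -/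
def constThree (rbar ρ J : ℝ) (K : ℕ) : ℝ :=
  ρ * (16 * Real.exp 1 * K * 4 ^ (K + 2)) ^ K / rbar ^ (K + 1) * J ^ K

end BeamBNF

end

/-! The normal form is built in `K` steps. After `i` steps the Hamiltonian is `D_ω + Z + R`, with
`Z` resonant and `R` of scaling degree at least `i + 1`. Let `N` be the nonresonant part of degree
`i + 3` of `R`, and let `S` have the coefficients of `N` divided by `-i ω · (α - β)`, so that `{D_ω,
S} = -N`. Composition with the time-one flow of `S` is a Lie series. Its first-order term cancels
`N`, the resonant part of degree `i + 3` passes to `Z`, and all that remains has scaling degree at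
least `i + 2` (`exists_normal_form_step`, `NormalFormAt.step`, `normalFormAt_of_smallness`).

The difficulty is the small divisor, since the Diophantine bound involves every index of the
monomial. Because `ω_j` differs from `j ^ 2` by a bounded amount, a divisor below one leaves two
possibilities for the index `j` of the component of the vector field and the largest other index
`k`: they cancel in the divisor, or both are bounded polynomially by the rest
(`IndexSplit.cancel_or_bounded`). Hence the divisor costs at most a power of the product of `⌊i⌋`
over the remaining indices (`IndexSplit.exp_le_abs_monoFreq`). This loss is paid by raising the
weight. Passing from `w` to `w'` multiplies the contribution of a monomial to the component `j` by
the ratio `w' / w` at `j`, divided by the product of the ratios at the other indices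
(`fieldSup_change_weight`). By momentum conservation `|j|` is at most the sum of the other moduli,
so the quotient is at most one, and it is small when the remaining indices are large. For the
sub-exponential weights this is a strict subadditivity of `λ` with constant `9/10`
(`rpow_log_add_le`) combined with Young's inequality; for the Sobolev weights it is `⌊j⌋ ≤ D ⌊k⌋`,
with `D` the degree. Thus step `i` leads from `W i` to `W (i + 1)` along a chain from the initial
weight to the final one.

Norms are measured on majorants with values in `[0, ∞]`. There the Cauchy estimate is elementary
(`mpow_add_dmpow_le`); it bounds the Poisson bracket (`fieldSup_bracket_le`) and so the Lie series.
The flow of a homogeneous Hamiltonian is obtained by inverting an analytic perturbation of the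
identity in a space of curves (`exists_flow`), and it is symplectic because second derivatives are
symmetric (`symplecticForm_fderiv`). The quadratic part `D_ω` is differentiated along the flow term
by term, which is possible because the final weight dominates the frequencies.

Finally, `exists_normal_form` runs the iteration on a ball whose radius does not depend on `r₀` and
then restricts to radius `r₀ / 2`. The scaling degrees supply the powers of `r₀`; resonant monomials
have even degree, which yields `r₀ ^ 2` for `Z`. -/

noncomputable section

namespace BeamBNF

/-! ### Analytic inverses of perturbations of the identity and flows of polynomial vector fields -/

section Flow

variable {V : Type*} [NormedAddCommGroup V]

/-- The curve `t ↦ γ (t)` extended to the real line by its values at the end points. -/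
def curveExt (γ : C(unitInterval, V)) (t : ℝ) : V := γ (Set.projIcc 0 1 zero_le_one t)

theorem continuous_curveExt (γ : C(unitInterval, V)) : Continuous (curveExt γ) :=
  γ.continuous.comp continuous_projIcc

theorem norm_curveExt_le (γ : C(unitInterval, V)) (t : ℝ) : ‖curveExt γ t‖ ≤ ‖γ‖ :=
  γ.norm_coe_le_norm _

/-- The point `G y` is the fixed point of `x ↦ y + P x`, which contracts the ball of radius `R` into
itself when `‖y‖ ≤ R / 2`. -/
theorem exists_inverse_id_sub [CompleteSpace V] {P : V → V} {R : ℝ} (hR : 0 < R)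
    (hL : LipschitzOnWith (1 / 2) P (Metric.closedBall 0 R)) (h0 : P 0 = 0) :
    ∃ G : V → V, ∀ y, ‖y‖ ≤ R / 2 → ‖G y‖ ≤ 2 * ‖y‖ ∧ G y - P (G y) = y := by
  have key : ∀ y : V, ‖y‖ ≤ R / 2 → ∃ x : V, ‖x‖ ≤ 2 * ‖y‖ ∧ x - P x = y := by
    intro y hy
    have hsf : Set.MapsTo (fun x => y + P x) (Metric.closedBall 0 R) (Metric.closedBall 0 R) := by
      intro x hx
      have h1 := hL.dist_le_mul x hx 0 (by simpa using hR.le)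
      rw [h0] at h1
      simp only [mem_closedBall_zero_iff, dist_zero_right] at hx h1 ⊢
      push_cast at h1
      linarith [norm_add_le y (P x)]
    have hc : ContractingWith (1 / 2) (hsf.restrict _ _ _) := by
      refine ⟨by rw [← NNReal.coe_lt_coe]; norm_num, ?_⟩
      intro a b
      have := hL a.2 b.2
      simpa [Subtype.edist_eq, Set.MapsTo.restrict, Subtype.map] using this
    obtain ⟨x, hx, hfix, -⟩ := ContractingWith.exists_fixedPoint' (s := Metric.closedBall (0 : V) R)
      Metric.isClosed_closedBall.isComplete hsf hc (x := 0) (by simpa using hR.le) (edist_ne_top _ _)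
    have hfix' : y + P x = x := hfix
    have h1 := hL.dist_le_mul x hx 0 (by simpa using hR.le)
    rw [h0] at h1
    simp only [dist_zero_right] at h1
    push_cast at h1
    refine ⟨x, ?_, ?_⟩
    · have := norm_add_le y (P x)
      rw [hfix'] at this
      linarith
    · rw [sub_eq_iff_eq_add]
      exact hfix'.symm
  classical
  refine ⟨fun y => if h : ‖y‖ ≤ R / 2 then (key y h).choose else 0, fun y hy => ?_⟩
  simp only [hy, dif_pos]
  exact (key y hy).choose_spec

variable [NormedSpace ℝ V]

/-- Smoothness of order `⊤` is analyticity. The derivative of `P` has norm at most `1/2`, so `id -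
P` has an invertible derivative, and the inverse function theorem gives an analytic local inverse.
The contraction makes `id - P` injective on the ball, which forces `G` to coincide with that inverse
near `y`. -/
theorem analyticAt_of_id_sub_eq [CompleteSpace V] {P : V → V} (hP : ContDiff ℝ ⊤ P) {R : ℝ}
    (hL : LipschitzOnWith (1 / 2) P (Metric.closedBall 0 R)) {G : V → V}
    (hG : ∀ y, ‖y‖ ≤ R / 2 → ‖G y‖ ≤ 2 * ‖y‖ ∧ G y - P (G y) = y) {y : V} (hy : ‖y‖ < R / 2) :
    AnalyticAt ℝ G y := by
  set x := G y with hx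
  obtain ⟨h1, h2⟩ := hG y hy.le
  have hxR : ‖x‖ < R := by linarith
  have hdP : HasFDerivAt P (fderiv ℝ P x) x :=
    (hP.contDiffAt.differentiableAt (by simp)).hasFDerivAt
  have hnorm : ‖fderiv ℝ P x‖ ≤ ((1 / 2 : NNReal) : ℝ) :=
    hdP.le_of_lipschitzOn (Metric.closedBall_mem_nhds_of_mem (by simpa using hxR)) hL
  have hlt : ‖fderiv ℝ P x‖ < 1 := lt_of_le_of_lt hnorm (by norm_num)
  set e : V ≃L[ℝ] V := ContinuousLinearEquiv.unitsEquiv ℝ V (Units.oneSub _ hlt) with he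
  have hfd : HasFDerivAt (fun z => z - P z) (e : V →L[ℝ] V) x := by
    have : (e : V →L[ℝ] V) = ContinuousLinearMap.id ℝ V - fderiv ℝ P x := by
      ext z
      rfl
    rw [this]
    exact (hasFDerivAt_id x).sub hdP
  have hcd : ContDiffAt ℝ ⊤ (fun z => z - P z) x := (contDiff_id.sub hP).contDiffAt
  set f := hcd.toOpenPartialHomeomorph _ hfd (by simp) with hf
  have hfc : ∀ z, f z = z - P z := fun z => rfl
  have hxs : x ∈ f.source := hcd.mem_toOpenPartialHomeomorph_source hfd (by simp)
  have hyx : f x = y := by rw [hfc]; exact h2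
  have hyt : y ∈ f.target := hyx ▸ f.map_source hxs
  have hsx : f.symm y = x := by rw [← hyx]; exact f.left_inv hxs
  have hsymm : ContDiffAt ℝ ⊤ f.symm y := by
    refine f.contDiffAt_symm (f₀' := e) hyt ?_ ?_
    · rw [hsx]; exact hfd
    · rw [hsx]; exact hcd
  have heq : G =ᶠ[nhds y] f.symm := by
    have c1 : ∀ᶠ z in nhds y, z ∈ f.target := f.open_target.mem_nhds hyt
    have c2 : ∀ᶠ z in nhds y, ‖f.symm z‖ < R := by
      have := (f.continuousAt_symm hyt).norm
      exact this.eventually_lt continuousAt_const (by rw [hsx]; exact hxR)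
    have c3 : ∀ᶠ z in nhds y, ‖z‖ < R / 2 :=
      continuousAt_id.norm.eventually_lt continuousAt_const hy
    filter_upwards [c1, c2, c3] with z hz1 hz2 hz3
    obtain ⟨g1, g2⟩ := hG z hz3.le
    have e1 : f.symm z - P (f.symm z) = z := by
      have := f.right_inv hz1
      rwa [hfc] at this
    have hd := hL.dist_le_mul (G z) (by simp only [mem_closedBall_zero_iff]; linarith) (f.symm z)
      (by simpa using hz2.le)
    rw [dist_eq_norm, dist_eq_norm] at hd
    have : P (G z) - P (f.symm z) = G z - f.symm z := by
      rw [sub_eq_iff_eq_add] at g2 e1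
      have : z = G z - P (G z) := by rw [eq_sub_iff_add_eq]; exact g2.symm
      have h' : z = f.symm z - P (f.symm z) := by rw [eq_sub_iff_add_eq]; exact e1.symm
      have := this.symm.trans h'
      rw [sub_eq_sub_iff_sub_eq_sub] at this
      exact this.symm
    rw [this] at hd
    push_cast at hd
    have h0 : ‖G z - f.symm z‖ = 0 := le_antisymm (by linarith) (norm_nonneg _)
    exact sub_eq_zero.mp (norm_eq_zero.mp h0)
  exact (hsymm.congr_of_eventuallyEq heq).analyticAt

/-- The primitive `γ ↦ (t ↦ ∫₀ᵗ γ)` as a linear operator on curves. -/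
def primitiveCLM (V : Type*) [NormedAddCommGroup V] [NormedSpace ℝ V] [CompleteSpace V] :
    C(unitInterval, V) →L[ℝ] C(unitInterval, V) :=
  LinearMap.mkContinuous
    { toFun := fun γ => ⟨fun t => ∫ s in (0 : ℝ)..t, curveExt γ s,
        (intervalIntegral.continuous_primitive
          (fun a b => (continuous_curveExt γ).intervalIntegrable a b) 0).comp
          continuous_subtype_val⟩
      map_add' := fun γ δ => by
        ext t
        exact intervalIntegral.integral_add ((continuous_curveExt γ).intervalIntegrable _ _)
          ((continuous_curveExt δ).intervalIntegrable _ _)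
      map_smul' := fun c γ => by
        ext t
        exact intervalIntegral.integral_smul c (curveExt γ) }
    1 (by
      intro γ
      rw [one_mul, ContinuousMap.norm_le _ (norm_nonneg _)]
      intro t
      have h := intervalIntegral.norm_integral_le_of_norm_le_const (f := curveExt γ) (C := ‖γ‖)
        (a := 0) (b := t) (fun s _ => norm_curveExt_le γ s)
      have ht : |(t : ℝ) - 0| ≤ 1 := by
        rw [sub_zero, abs_of_nonneg t.2.1]; exact t.2.2
      exact h.trans (mul_le_of_le_one_right (norm_nonneg _) ht))

theorem norm_primitiveCLM_le [CompleteSpace V] (γ : C(unitInterval, V)) : ‖primitiveCLM V γ‖ ≤ ‖γ‖ := by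
  have := (primitiveCLM V).le_of_opNorm_le
    (LinearMap.mkContinuous_norm_le _ zero_le_one _ : ‖primitiveCLM V‖ ≤ 1) γ
  rwa [one_mul] at this

/-- A continuous multilinear map acting pointwise on curves. -/
def superposition {n : ℕ} (M : ContinuousMultilinearMap ℝ (fun _ : Fin n => V) V) :
    ContinuousMultilinearMap ℝ (fun _ : Fin n => C(unitInterval, V)) C(unitInterval, V) :=
  MultilinearMap.mkContinuous
    { toFun := fun γ => ⟨fun t => M fun l => γ l t, M.cont.comp
        (continuous_pi fun l => (γ l).continuous)⟩
      map_update_add' := fun γ l x y => by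
        ext t
        have h : ∀ z : C(unitInterval, V), (fun k => (Function.update γ l z) k t)
            = Function.update (fun k => γ k t) l (z t) := by
          intro z
          funext k
          by_cases hk : k = l
          · subst hk; simp
          · simp [hk]
        simp only [ContinuousMap.coe_mk, ContinuousMap.add_apply]
        rw [h, h, h, ContinuousMap.add_apply]
        convert! M.map_update_add (fun k => γ k t) l (x t) (y t)
      map_update_smul' := fun γ l c x => by
        ext t
        have h : ∀ z : C(unitInterval, V), (fun k => (Function.update γ l z) k t)
            = Function.update (fun k => γ k t) l (z t) := by
          intro z
          funext k
          by_cases hk : k = l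
          · subst hk; simp
          · simp [hk]
        simp only [ContinuousMap.coe_mk, ContinuousMap.smul_apply]
        rw [h, h, ContinuousMap.smul_apply]
        convert! M.map_update_smul (fun k => γ k t) l c (x t) }
    ‖M‖ (by
      intro γ
      rw [ContinuousMap.norm_le _ (by positivity)]
      intro t
      exact (M.le_opNorm _).trans (mul_le_mul_of_nonneg_left
        (Finset.prod_le_prod (fun _ _ => norm_nonneg _) fun l _ => (γ l).norm_coe_le_norm t)
        (norm_nonneg _)))

theorem norm_superposition_le {n : ℕ} (M : ContinuousMultilinearMap ℝ (fun _ : Fin n => V) V) :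
    ‖superposition M‖ ≤ ‖M‖ := MultilinearMap.mkContinuous_norm_le _ (norm_nonneg _) _

/-- Time-one flow of the homogeneous polynomial vector field `u ↦ M (u, …, u)`. -/
theorem exists_flow [CompleteSpace V] {n : ℕ} (hn : 1 ≤ n) (M : ContinuousMultilinearMap ℝ (fun _ : Fin n => V) V)
    {R : ℝ} (hR : 0 < R) (hM : ‖M‖ * n * R ^ (n - 1) ≤ 1 / 2) :
    ∃ (Φ : V → V) (Γ : V → ℝ → V),
      (∀ u, ‖u‖ < R / 2 → AnalyticAt ℝ Φ u) ∧
      (∀ u, ‖u‖ ≤ R / 2 → Γ u 0 = u ∧ Γ u 1 = Φ u ∧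
        (∀ t ∈ Set.Icc (0 : ℝ) 1, ‖Γ u t‖ ≤ 2 * ‖u‖) ∧
        ∃ v : ℝ → V, Continuous v ∧ (∀ t, HasDerivAt (Γ u) (v t) t) ∧
          ∀ t ∈ Set.Icc (0 : ℝ) 1, v t = M fun _ => Γ u t) ∧
      (∀ u, ‖u‖ < R / 2 → ∀ ξ, ∃ η w : ℝ → V, η 0 = ξ ∧ η 1 = fderiv ℝ Φ u ξ ∧
        (∀ t, HasDerivAt η (w t) t) ∧
        ∀ t ∈ Set.Icc (0 : ℝ) 1, w t = fderiv ℝ (fun z => M fun _ => z) (Γ u t) (η t)) := by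
  have : Nonempty (Fin n) := ⟨⟨0, hn⟩⟩
  set W := C(unitInterval, V)
  set Q : W → W := fun γ => superposition M fun _ => γ with hQ
  -- The equation `u' = M (u, …, u)` on `[0, 1]` with initial value `u₀` reads `γ - P γ = c u₀` in
  -- the space of curves, where `c u₀` is the constant curve. Inverting `id - P` analytically gives
  -- existence, the bound `2 ‖u₀‖` and analytic dependence on the datum at once.
  set P : W → W := fun γ => primitiveCLM V (Q γ) with hPdef
  have hconst : ∀ k : ℕ, ContDiff ℝ ⊤ (fun (γ : W) (_ : Fin k) => γ) := fun k =>
    contDiff_pi.mpr fun _ => contDiff_id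
  have hQc : ContDiff ℝ ⊤ Q := (superposition M).contDiff.comp (hconst n)
  have hP : ContDiff ℝ ⊤ P := (primitiveCLM V).contDiff.comp hQc
  have hXc : ContDiff ℝ ⊤ (fun z : V => M fun _ => z) :=
    M.contDiff.comp (contDiff_pi.mpr fun _ => contDiff_id)
  have hL : LipschitzOnWith (1 / 2) P (Metric.closedBall 0 R) := by
    refine LipschitzOnWith.of_dist_le_mul fun γ hγ δ hδ => ?_
    simp only [mem_closedBall_zero_iff] at hγ hδ
    have e : P γ - P δ = primitiveCLM V (Q γ - Q δ) := by simp [hPdef]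
    rw [dist_eq_norm, dist_eq_norm, e]
    refine (norm_primitiveCLM_le _).trans ?_
    refine ((superposition M).norm_image_sub_le _ _).trans ?_
    have e2 : ‖(fun _ : Fin n => γ) - fun _ => δ‖ = ‖γ - δ‖ := by
      have : ((fun _ : Fin n => γ) - fun _ => δ) = fun _ => γ - δ := rfl
      rw [this, pi_norm_const]
    rw [e2, Fintype.card_fin, pi_norm_const, pi_norm_const]
    refine mul_le_mul_of_nonneg_right ?_ (norm_nonneg _)
    push_cast
    refine le_trans ?_ hM
    have := norm_superposition_le M
    have h3 : max ‖γ‖ ‖δ‖ ≤ R := max_le hγ hδ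
    gcongr
  have h0 : P 0 = 0 := by
    have : Q 0 = 0 := (superposition M).map_zero
    simp [hPdef, this]
  obtain ⟨G, hG⟩ := exists_inverse_id_sub hR hL h0
  have hGa : ∀ y : W, ‖y‖ < R / 2 → AnalyticAt ℝ G y := fun y hy =>
    analyticAt_of_id_sub_eq hP hL hG hy
  set c : V →L[ℝ] W := ContinuousLinearMap.const ℝ unitInterval with hc
  have hcn : ∀ u, ‖c u‖ ≤ ‖u‖ := by
    intro u
    rw [ContinuousMap.norm_le _ (norm_nonneg _)]
    intro t
    exact le_rfl
  set ev : unitInterval → W →L[ℝ] V := fun t => ContinuousMap.evalCLM ℝ t with hev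
  have hext : ∀ (γ : W) (t : ℝ) (ht : t ∈ Set.Icc (0 : ℝ) 1), curveExt γ t = γ ⟨t, ht⟩ := by
    intro γ t ht
    unfold curveExt
    rw [Set.projIcc_of_mem zero_le_one ht]
  have h1I : (1 : ℝ) ∈ Set.Icc (0 : ℝ) 1 := by simp
  -- The velocity is extended by constants outside `[0, 1]` and integrated, so that the trajectory
  -- has two-sided derivatives also at the end points.
  set Γ : V → ℝ → V := fun u t => u + ∫ s in (0 : ℝ)..t, curveExt (Q (G (c u))) s with hΓ
  have hΓG : ∀ u, ‖u‖ ≤ R / 2 → ∀ t (ht : t ∈ Set.Icc (0 : ℝ) 1), Γ u t = G (c u) ⟨t, ht⟩ := by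
    intro u hu t ht
    have h := (hG (c u) ((hcn u).trans hu)).2
    rw [sub_eq_iff_eq_add] at h
    rw [h]
    rfl
  have hderiv : ∀ γ : W, ∀ t, HasDerivAt (fun t => ∫ s in (0 : ℝ)..t, curveExt γ s)
      (curveExt γ t) t := fun γ t =>
    ((continuous_curveExt γ).integral_hasStrictDerivAt 0 t).hasDerivAt
  refine ⟨fun u => ev 1 (G (c u)), Γ, ?_, ?_, ?_⟩
  · intro u hu
    have h1 : AnalyticAt ℝ c u := c.analyticAt u
    have h2 := hGa (c u) ((hcn u).trans_lt hu)
    exact ((ev 1).analyticAt _).comp (h2.comp h1)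
  · intro u hu
    refine ⟨by simp [hΓ], hΓG u hu 1 h1I, ?_, curveExt (Q (G (c u))), continuous_curveExt _, ?_, ?_⟩
    · intro t ht
      rw [hΓG u hu t ht]
      refine ((G (c u)).norm_coe_le_norm _).trans ?_
      refine (hG (c u) ((hcn u).trans hu)).1.trans ?_
      linarith [hcn u]
    · intro t
      exact (hderiv _ t).const_add u
    · intro t ht
      rw [hext _ t ht, hΓG u hu t ht]
      rfl
  · intro u hu ξ
    have hdc : HasFDerivAt c c u := c.hasFDerivAt
    have hcu : ‖c u‖ < R / 2 := (hcn u).trans_lt hu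
    have hdG : HasFDerivAt G (fderiv ℝ G (c u)) (c u) :=
      (hGa (c u) hcu).differentiableAt.hasFDerivAt
    set η₀ : W := fderiv ℝ G (c u) (c ξ) with hη₀
    set γ := G (c u) with hγ
    have hdQ : HasFDerivAt Q (fderiv ℝ Q γ) γ :=
      (hQc.contDiffAt.differentiableAt (by simp)).hasFDerivAt
    -- Differentiating `G y - P (G y) = y` gives the linearized equation along the trajectory, in
    -- integral form.
    have heq : η₀ - primitiveCLM V (fderiv ℝ Q γ η₀) = c ξ := by
      have hd1 : HasFDerivAt (fun y => G y - P (G y)) (fderiv ℝ G (c u) -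
          (primitiveCLM V).comp ((fderiv ℝ Q γ).comp (fderiv ℝ G (c u)))) (c u) :=
        hdG.sub ((primitiveCLM V).hasFDerivAt.comp (c u) (hdQ.comp (c u) hdG))
      have hd2 : HasFDerivAt (fun y => G y - P (G y)) (ContinuousLinearMap.id ℝ W) (c u) := by
        refine (hasFDerivAt_id (c u)).congr_of_eventuallyEq ?_
        filter_upwards [continuousAt_id.norm.eventually_lt continuousAt_const hcu] with z hz
        exact (hG z hz.le).2
      have := congrArg (fun L : W →L[ℝ] W => L (c ξ)) (hd1.unique hd2)
      simpa using this
    have hpt : ∀ t (ht : t ∈ Set.Icc (0 : ℝ) 1), fderiv ℝ Q γ η₀ ⟨t, ht⟩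
        = fderiv ℝ (fun z => M fun _ => z) (Γ u t) (η₀ ⟨t, ht⟩) := by
      intro t ht
      have hd1 : HasFDerivAt (fun δ : W => ev ⟨t, ht⟩ (Q δ)) ((ev ⟨t, ht⟩).comp (fderiv ℝ Q γ)) γ :=
        (ev ⟨t, ht⟩).hasFDerivAt.comp γ hdQ
      have hX : HasFDerivAt (fun z => M fun _ => z) (fderiv ℝ (fun z => M fun _ => z) (Γ u t))
          (ev ⟨t, ht⟩ γ) := by
        rw [hΓG u hu.le t ht]
        exact (hXc.contDiffAt.differentiableAt (by simp)).hasFDerivAt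
      have hd2 : HasFDerivAt (fun δ : W => ev ⟨t, ht⟩ (Q δ))
          ((fderiv ℝ (fun z => M fun _ => z) (Γ u t)).comp (ev ⟨t, ht⟩)) γ :=
        hX.comp γ (ev ⟨t, ht⟩).hasFDerivAt
      exact congrArg (fun L : W →L[ℝ] V => L η₀) (hd1.unique hd2)
    set η : ℝ → V := fun t => ξ + ∫ s in (0 : ℝ)..t, curveExt (fderiv ℝ Q γ η₀) s with hη
    have hηeq : ∀ t (ht : t ∈ Set.Icc (0 : ℝ) 1), η t = η₀ ⟨t, ht⟩ := by
      intro t ht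
      rw [sub_eq_iff_eq_add] at heq
      rw [heq]
      rfl
    refine ⟨η, curveExt (fderiv ℝ Q γ η₀), by simp [hη], ?_, fun t => (hderiv _ t).const_add ξ, ?_⟩
    · rw [hηeq 1 h1I]
      have hd : HasFDerivAt (fun u => ev 1 (G (c u)))
          ((ev 1).comp ((fderiv ℝ G (c u)).comp c)) u :=
        (ev 1).hasFDerivAt.comp u (hdG.comp u hdc)
      rw [hd.fderiv]
      rfl
    · intro t ht
      rw [hext _ t ht, hpt t ht, hηeq t ht]

end Flow

/-! ### Monomials and their formal derivatives -/

section Monomials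

variable {R : Type*} [CommSemiring R]

/-- The monomial `x ^ κ`. -/
def mpow (x : ℤ → R) (κ : MultiIndex) : R := κ.prod fun j n => x j ^ n

/-- The partial derivative `∂ x ^ κ / ∂ x_j`. -/
def pd (x : ℤ → R) (κ : MultiIndex) (j : ℤ) : R := (κ j : R) * mpow x (κ - Finsupp.single j 1)

@[simp] theorem mpow_zero (x : ℤ → R) : mpow x 0 = 1 := Finsupp.prod_zero_index

theorem mpow_add (x : ℤ → R) (κ κ' : MultiIndex) : mpow x (κ + κ') = mpow x κ * mpow x κ' :=
  Finsupp.prod_add_index' (fun _ => pow_zero _) fun _ _ _ => pow_add _ _ _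

@[simp] theorem mpow_single (x : ℤ → R) (j : ℤ) (n : ℕ) :
    mpow x (Finsupp.single j n) = x j ^ n :=
  Finsupp.prod_single_index (pow_zero _)

theorem mpow_mul (x y : ℤ → R) (κ : MultiIndex) :
    mpow (fun j => x j * y j) κ = mpow x κ * mpow y κ := by
  simp only [mpow, mul_pow]
  exact Finsupp.prod_mul

theorem mpow_const (c : R) (κ : MultiIndex) : mpow (fun _ => c) κ = c ^ (κ.sum fun _ n => n) := by
  simp only [mpow, Finsupp.prod, Finsupp.sum, Finset.prod_pow_eq_pow_sum]

theorem sub_single_add_single {κ : MultiIndex} {j : ℤ} (h : κ j ≠ 0) :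
    κ - Finsupp.single j 1 + Finsupp.single j 1 = κ := by
  apply tsub_add_cancel_of_le
  rw [Finsupp.single_le_iff]
  omega

theorem add_sub_single {κ κ' : MultiIndex} {j : ℤ} (h : κ j ≠ 0) :
    κ + κ' - Finsupp.single j 1 = κ - Finsupp.single j 1 + κ' := by
  ext i
  simp only [Finsupp.coe_tsub, Finsupp.coe_add, Pi.sub_apply, Pi.add_apply, Finsupp.single_apply]
  split_ifs with hi
  · subst hi; omega
  · simp

theorem pd_of_eq_zero (x : ℤ → R) {κ : MultiIndex} {j : ℤ} (h : κ j = 0) : pd x κ j = 0 := by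
  simp [pd, h]

@[simp] theorem pd_zero (x : ℤ → R) (j : ℤ) : pd x 0 j = 0 := by simp [pd]

theorem pd_add (x : ℤ → R) (κ κ' : MultiIndex) (j : ℤ) :
    pd x (κ + κ') j = pd x κ j * mpow x κ' + mpow x κ * pd x κ' j := by
  have e1 : (κ j : R) * mpow x (κ + κ' - Finsupp.single j 1) = pd x κ j * mpow x κ' := by
    by_cases h : κ j = 0
    · simp [pd, h]
    · rw [add_sub_single h, mpow_add, pd, mul_assoc]
  have e2 : (κ' j : R) * mpow x (κ + κ' - Finsupp.single j 1) = mpow x κ * pd x κ' j := by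
    by_cases h : κ' j = 0
    · simp [pd, h]
    · rw [add_comm κ, add_sub_single h, mpow_add, pd]
      ring
  rw [← e1, ← e2, pd, Finsupp.add_apply, Nat.cast_add, add_mul]

theorem pd_single_same (x : ℤ → R) (j : ℤ) (n : ℕ) :
    pd x (Finsupp.single j n) j = n * x j ^ (n - 1) := by
  rw [pd, ← Finsupp.single_tsub, mpow_single, Finsupp.single_eq_same]

theorem pd_single_ne (x : ℤ → R) {i j : ℤ} (h : i ≠ j) (n : ℕ) :
    pd x (Finsupp.single i n) j = 0 :=
  pd_of_eq_zero _ (Finsupp.single_eq_of_ne h.symm)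

/-- Symmetry of the second derivatives of a monomial. -/
theorem mul_pd_sub_comm (x : ℤ → R) (κ : MultiIndex) (i j : ℤ) :
    (κ j : R) * pd x (κ - Finsupp.single j 1) i = κ i * pd x (κ - Finsupp.single i 1) j := by
  rcases eq_or_ne i j with rfl | h
  · rfl
  · simp only [pd, Finsupp.tsub_apply, Finsupp.single_eq_of_ne h, Finsupp.single_eq_of_ne h.symm,
      tsub_zero]
    rw [tsub_right_comm]
    ring

end Monomials

/-- The derivative of `x ^ κ` in the direction `v`. -/
def dmpow (x v : ℤ → ℝ≥0∞) (κ : MultiIndex) : ℝ≥0∞ := ∑' j, v j * pd x κ j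

theorem dmpow_add (x v : ℤ → ℝ≥0∞) (κ κ' : MultiIndex) :
    dmpow x v (κ + κ') = dmpow x v κ * mpow x κ' + mpow x κ * dmpow x v κ' := by
  simp only [dmpow, pd_add, mul_add]
  rw [ENNReal.tsum_add, ← ENNReal.tsum_mul_right, ← ENNReal.tsum_mul_left]
  congr 1 <;> exact tsum_congr fun j => by ring

theorem dmpow_smul (t : ℝ≥0∞) (x v : ℤ → ℝ≥0∞) (κ : MultiIndex) :
    dmpow x (fun j => t * v j) κ = t * dmpow x v κ := by
  simp only [dmpow, mul_assoc, ENNReal.tsum_mul_left]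

/-- The left side consists of the terms of degree zero and one in `v` of `(x + v) ^ κ`; the others
are nonnegative. This plays the role of the Cauchy formula in the estimates of derivatives. -/
theorem mpow_add_dmpow_le (x v : ℤ → ℝ≥0∞) (κ : MultiIndex) :
    mpow x κ + dmpow x v κ ≤ mpow (x + v) κ := by
  induction κ using Finsupp.induction_linear with
  | zero => simp [dmpow]
  | add κ κ' h h' =>
    rw [mpow_add, mpow_add, dmpow_add]
    refine le_trans ?_ (mul_le_mul' h h')
    rw [add_mul, mul_add, mul_add]
    rw [← add_assoc, add_assoc, add_comm (dmpow x v κ * mpow x κ'), ← add_assoc]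
    exact add_le_add_right le_self_add _
  | single i n =>
    have e : dmpow x v (Finsupp.single i n) = v i * (n * x i ^ (n - 1)) := by
      rw [dmpow, tsum_eq_single i, pd_single_same]
      intro j hj
      rw [pd_single_ne _ hj.symm, mul_zero]
    rw [e, mpow_single, mpow_single, Pi.add_apply]
    induction n with
    | zero => simp
    | succ n ih =>
      have h := ih (by rw [dmpow, tsum_eq_single i, pd_single_same]
                       intro j hj
                       rw [pd_single_ne _ hj.symm, mul_zero])
      rw [pow_succ (x i + v i)]
      refine le_trans ?_ (mul_le_mul_left h _)
      rw [add_mul, mul_add, ← pow_succ]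
      simp only [Nat.add_sub_cancel, Nat.cast_add, Nat.cast_one]
      rcases n with _ | n
      · simp
      · simp only [Nat.add_sub_cancel]
        have : v i * ((((n + 1 : ℕ) : ℝ≥0∞) + 1) * x i ^ (n + 1))
            = x i ^ (n + 1) * v i + v i * (((n + 1 : ℕ) : ℝ≥0∞) * x i ^ n) * x i := by ring
        rw [this, ← add_assoc]
        gcongr
        exact le_self_add

/-! ### Weighted norms with values in `[0, ∞]` -/

/-- The norm `(∑ w_j ^ 2 f_j ^ 2) ^ (1 / 2)` of a sequence with values in `[0, ∞]`. -/
def wnorm (w : Weight) (f : ℤ → ℝ≥0∞) : ℝ≥0∞ :=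
  (∑' j : ℤ, (ENNReal.ofReal (w.toFun j) * f j) ^ 2) ^ (1 / 2 : ℝ)

theorem wnorm_mono (w : Weight) {f g : ℤ → ℝ≥0∞} (h : ∀ j, f j ≤ g j) : wnorm w f ≤ wnorm w g := by
  unfold wnorm
  gcongr with j
  exact h j

theorem wnorm_smul (w : Weight) (t : ℝ≥0∞) (f : ℤ → ℝ≥0∞) :
    wnorm w (fun j => t * f j) = t * wnorm w f := by
  unfold wnorm
  have : ∀ j, (ENNReal.ofReal (w.toFun j) * (t * f j)) ^ 2
      = t ^ 2 * (ENNReal.ofReal (w.toFun j) * f j) ^ 2 := fun j => by ring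
  simp_rw [this]
  rw [ENNReal.tsum_mul_left, ENNReal.mul_rpow_of_nonneg _ _ (by norm_num), ← ENNReal.rpow_natCast,
    ← ENNReal.rpow_mul]
  norm_num

@[simp] theorem wnorm_zero (w : Weight) : wnorm w (fun _ => 0) = 0 := by
  simp [wnorm]

theorem wnorm_eq_lintegral (w : Weight) (f : ℤ → ℝ≥0∞) :
    wnorm w f = (∫⁻ j, (ENNReal.ofReal (w.toFun j) * f j) ^ (2 : ℝ) ∂MeasureTheory.Measure.count)
      ^ (1 / (2 : ℝ)) := by
  rw [MeasureTheory.lintegral_count, wnorm]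
  simp

theorem wnorm_add_le (w : Weight) (f g : ℤ → ℝ≥0∞) :
    wnorm w (fun j => f j + g j) ≤ wnorm w f + wnorm w g := by
  simp only [wnorm_eq_lintegral, mul_add]
  exact ENNReal.lintegral_Lp_add_le (p := 2) (measurable_of_countable _).aemeasurable
    (measurable_of_countable _).aemeasurable (by norm_num)

theorem tsum_mul_le_wnorm (w : Weight) (hw : ∀ j, 1 ≤ w.toFun j) (f g : ℤ → ℝ≥0∞) :
    ∑' j, f j * g j ≤ wnorm w f * wnorm w g := by
  have h1 : ∀ j, (1 : ℝ≥0∞) ≤ ENNReal.ofReal (w.toFun j) := fun j => by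
    rw [← ENNReal.ofReal_one]; exact ENNReal.ofReal_le_ofReal (hw j)
  have h2 : ∀ (f : ℤ → ℝ≥0∞) j, f j ≤ ENNReal.ofReal (w.toFun j) * f j := fun f j =>
    le_mul_of_one_le_left' (h1 j)
  refine le_trans (ENNReal.tsum_le_tsum fun j => mul_le_mul' (h2 f j) (h2 g j)) ?_
  rw [← MeasureTheory.lintegral_count, wnorm_eq_lintegral, wnorm_eq_lintegral]
  exact ENNReal.lintegral_mul_le_Lp_mul_Lq _ Real.HolderConjugate.two_two
    (measurable_of_countable _).aemeasurable (measurable_of_countable _).aemeasurable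

theorem le_wnorm (w : Weight) (f : ℤ → ℝ≥0∞) (j : ℤ) :
    ENNReal.ofReal (w.toFun j) * f j ≤ wnorm w f := by
  have h := ENNReal.rpow_le_rpow
    (ENNReal.le_tsum (f := fun j => (ENNReal.ofReal (w.toFun j) * f j) ^ 2) j)
    (by norm_num : (0 : ℝ) ≤ 1 / 2)
  rw [← ENNReal.rpow_natCast, ← ENNReal.rpow_mul] at h
  norm_num at h
  simpa [wnorm] using h

theorem wnorm_sum_le {ι : Type*} (w : Weight) (s : Finset ι) (f : ι → ℤ → ℝ≥0∞) :
    wnorm w (fun j => ∑ k ∈ s, f k j) ≤ ∑ k ∈ s, wnorm w (f k) := by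
  classical
  induction s using Finset.induction_on with
  | empty => simp
  | insert a s ha ih =>
    simp only [Finset.sum_insert ha]
    exact (wnorm_add_le w _ _).trans (add_le_add_right ih _)

/-- Minkowski's inequality for countably many summands: on each finite set of indices `j` the finite
inequality passes to the limit. -/
theorem wnorm_tsum_le (w : Weight) (f : ℕ → ℤ → ℝ≥0∞) :
    wnorm w (fun j => ∑' k, f k j) ≤ ∑' k, wnorm w (f k) := by
  have hsq : ∀ a b : ℝ≥0∞, a ^ (1 / 2 : ℝ) ≤ b ↔ a ≤ b ^ (2 : ℕ) := by
    intro a b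
    rw [one_div, ENNReal.rpow_inv_le_iff (by norm_num), ← ENNReal.rpow_natCast]
    norm_num
  unfold wnorm
  rw [hsq, ENNReal.tsum_eq_iSup_sum]
  refine iSup_le fun s => ?_
  have hlim : Filter.Tendsto (fun n : ℕ => ∑ j ∈ s, (ENNReal.ofReal (w.toFun j) *
      ∑ k ∈ Finset.range n, f k j) ^ 2) Filter.atTop
      (nhds (∑ j ∈ s, (ENNReal.ofReal (w.toFun j) * ∑' k, f k j) ^ 2)) := by
    refine tendsto_finsetSum _ fun j _ => ?_
    have h1 : Filter.Tendsto (fun n : ℕ => ∑ k ∈ Finset.range n, f k j) Filter.atTop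
        (nhds (∑' k, f k j)) := ENNReal.tendsto_nat_tsum _
    exact (ENNReal.continuous_pow 2).continuousAt.tendsto.comp
      (ENNReal.Tendsto.const_mul h1 (Or.inr ENNReal.ofReal_ne_top))
  refine le_of_tendsto' hlim fun n => ?_
  have h2 := wnorm_sum_le w (Finset.range n) f
  have h3 : ∑ k ∈ Finset.range n, wnorm w (f k) ≤ ∑' k, wnorm w (f k) := ENNReal.sum_le_tsum _
  have h4 := h2.trans h3
  rw [wnorm, hsq] at h4
  exact (ENNReal.sum_le_tsum s).trans h4

/-! ### Majorant vector fields -/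

/-- The exponent `α + β - e_j`. -/
def restIndex (a : MultiIndex × MultiIndex) (j : ℤ) : MultiIndex :=
  a.1 + (a.2 - Finsupp.single j 1)

/-- The majorant vector field at a point with coordinates in `[0, ∞]`. -/
def majField (H : Ham) (x : ℤ → ℝ≥0∞) (j : ℤ) : ℝ≥0∞ :=
  ∑' a, ‖H a‖ₑ * ((a.2 j : ℝ≥0∞) * mpow x (restIndex a j))

theorem mul_mpow_restIndex (x : ℤ → ℝ≥0∞) (a : MultiIndex × MultiIndex) (j : ℤ) :
    (a.2 j : ℝ≥0∞) * mpow x (restIndex a j) = mpow x a.1 * pd x a.2 j := by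
  rw [restIndex, mpow_add, pd]
  ring

theorem majField_eq (H : Ham) (u : ℤ → ℂ) (j : ℤ) :
    majField H (fun i => ‖u i‖ₑ) j = majorantField H u j := by
  refine tsum_congr fun a => ?_
  rw [ENNReal.ofReal_mul (by positivity), ENNReal.ofReal_mul (by positivity),
    ENNReal.ofReal_natCast, ofReal_norm, mul_assoc]
  congr 2
  rw [mpow, Finsupp.prod, Finsupp.prod, ENNReal.ofReal_prod_of_nonneg fun _ _ => by positivity]
  refine Finset.prod_congr rfl fun i _ => ?_
  rw [ENNReal.ofReal_pow (norm_nonneg _), ofReal_norm, restIndex]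

/-- Reality exchanges `α` and `β`, so the derivatives of the majorant in `u_j` and in `ū_j` agree at
nonnegative points. One field therefore controls the whole differential. -/
theorem majField_conj {H : Ham} (hH : ∀ α β : MultiIndex, H (α, β) = conj (H (β, α)))
    (x : ℤ → ℝ≥0∞) (j : ℤ) :
    ∑' a, ‖H a‖ₑ * (pd x a.1 j * mpow x a.2) = majField H x j := by
  rw [majField, ← (Equiv.prodComm MultiIndex MultiIndex).tsum_eq]
  refine tsum_congr fun a => ?_
  rw [mul_mpow_restIndex, mul_comm (pd x _ j)]
  congr 1
  change ‖H (a.2, a.1)‖ₑ = ‖H (a.1, a.2)‖ₑ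
  rw [hH a.2 a.1, ← ofReal_norm, ← ofReal_norm, Complex.norm_conj]

/-- The supremum of the weighted norm of the majorant vector field on the ball of radius `r`. -/
def fieldSup (r : ℝ) (w : Weight) (H : Ham) : ℝ≥0∞ :=
  ⨆ (x : ℤ → ℝ≥0∞) (_ : wnorm w x ≤ ENNReal.ofReal r), wnorm w (majField H x)

theorem le_fieldSup {r : ℝ} {w : Weight} (H : Ham) {x : ℤ → ℝ≥0∞}
    (hx : wnorm w x ≤ ENNReal.ofReal r) : wnorm w (majField H x) ≤ fieldSup r w H :=
  le_iSup₂ (f := fun (x : ℤ → ℝ≥0∞) (_ : wnorm w x ≤ ENNReal.ofReal r) => wnorm w (majField H x))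
    x hx

theorem fieldSup_mono_radius {r r' : ℝ} (h : r' ≤ r) (w : Weight) (H : Ham) :
    fieldSup r' w H ≤ fieldSup r w H :=
  iSup₂_le fun _ hx => le_fieldSup H (hx.trans (ENNReal.ofReal_le_ofReal h))

theorem fieldSup_le_of_le {r : ℝ} {w : Weight} {F G : Ham} (h : ∀ a, ‖F a‖ ≤ ‖G a‖) :
    fieldSup r w F ≤ fieldSup r w G := by
  refine iSup₂_le fun x hx => le_trans (wnorm_mono w fun j => ?_) (le_fieldSup G hx)
  exact ENNReal.tsum_le_tsum fun a => mul_le_mul_left (enorm_le_iff_norm_le.mpr (h a)) _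

theorem fieldSup_add_le (r : ℝ) (w : Weight) (F G : Ham) :
    fieldSup r w (F + G) ≤ fieldSup r w F + fieldSup r w G := by
  refine iSup₂_le fun x hx => ?_
  refine le_trans (wnorm_mono w (g := fun j => majField F x j + majField G x j) fun j => ?_)
    ((wnorm_add_le w _ _).trans (add_le_add (le_fieldSup F hx) (le_fieldSup G hx)))
  rw [majField, majField, majField, ← ENNReal.tsum_add]
  refine ENNReal.tsum_le_tsum fun a => ?_
  rw [← add_mul]
  exact mul_le_mul_left (enorm_add_le _ _) _

theorem fieldSup_const_mul (r : ℝ) (w : Weight) (c : ℂ) (F : Ham) :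
    fieldSup r w (fun a => c * F a) = ‖c‖ₑ * fieldSup r w F := by
  simp only [fieldSup, ENNReal.mul_iSup]
  refine iSup_congr fun x => iSup_congr fun _ => ?_
  rw [← wnorm_smul]
  congr 1
  funext j
  simp only [majField, enorm_mul, mul_assoc, ENNReal.tsum_mul_left]

theorem fieldSup_tsum_le (r : ℝ) (w : Weight) (F : ℕ → Ham) :
    fieldSup r w (fun a => ∑' k, F k a) ≤ ∑' k, fieldSup r w (F k) := by
  refine iSup₂_le fun x hx => ?_
  refine le_trans (wnorm_mono w (g := fun j => ∑' k, majField (F k) x j) fun j => ?_)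
    ((wnorm_tsum_le w _).trans (ENNReal.tsum_le_tsum fun k => le_fieldSup (F k) hx))
  simp only [majField]
  rw [ENNReal.tsum_comm]
  refine ENNReal.tsum_le_tsum fun a => ?_
  rw [ENNReal.tsum_mul_right]
  exact mul_le_mul_left enorm_tsum_le_tsum_enorm _

theorem restIndex_sum {a : MultiIndex × MultiIndex} {j : ℤ} (h : a.2 j ≠ 0) :
    ((restIndex a j).sum fun _ n => n) + 1 = totalDegree a := by
  have e : restIndex a j + Finsupp.single j 1 = a.1 + a.2 := by
    rw [restIndex, add_assoc, sub_single_add_single h]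
  have := congrArg (fun κ : MultiIndex => κ.sum fun _ n => n) e
  beta_reduce at this
  rw [Finsupp.sum_add_index' (fun _ => rfl) (fun _ _ _ => rfl),
    Finsupp.sum_add_index' (fun _ => rfl) (fun _ _ _ => rfl), Finsupp.sum_single_index rfl] at this
  exact this

theorem majField_smul_le {H : Ham} {d : ℕ} (hd : ScalingDegreeGE d H) {θ : ℝ≥0∞} (hθ : θ ≤ 1)
    (x : ℤ → ℝ≥0∞) (j : ℤ) :
    majField H (fun i => θ * x i) j ≤ θ ^ (d + 1) * majField H x j := by
  rw [majField, majField, ← ENNReal.tsum_mul_left]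
  refine ENNReal.tsum_le_tsum fun a => ?_
  by_cases ha : H a = 0
  · simp [ha]
  by_cases hj : a.2 j = 0
  · simp [hj]
  have h1 := restIndex_sum hj
  have h2 := hd a ha
  rw [mpow_mul, mpow_const]
  have : θ ^ ((restIndex a j).sum fun _ n => n) ≤ θ ^ (d + 1) :=
    pow_le_pow_right_of_le_one' hθ (by omega)
  calc ‖H a‖ₑ * ((a.2 j : ℝ≥0∞) * (θ ^ ((restIndex a j).sum fun _ n => n) * mpow x (restIndex a j)))
      ≤ ‖H a‖ₑ * ((a.2 j : ℝ≥0∞) * (θ ^ (d + 1) * mpow x (restIndex a j))) := by gcongr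
    _ = _ := by ring

theorem majField_smul_eq {H : Ham} {n : ℕ} (hd : ∀ a, H a ≠ 0 → totalDegree a = n + 1) (θ : ℝ≥0∞)
    (x : ℤ → ℝ≥0∞) (j : ℤ) :
    majField H (fun i => θ * x i) j = θ ^ n * majField H x j := by
  rw [majField, majField, ← ENNReal.tsum_mul_left]
  refine tsum_congr fun a => ?_
  by_cases ha : H a = 0
  · simp [ha]
  by_cases hj : a.2 j = 0
  · simp [hj]
  have h1 := restIndex_sum hj
  have h2 := hd a ha
  rw [mpow_mul, mpow_const, show ((restIndex a j).sum fun _ n => n) = n by omega]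
  ring

theorem wnorm_div_le {w : Weight} {x : ℤ → ℝ≥0∞} {r θ : ℝ} (hθ : 0 < θ)
    (hx : wnorm w x ≤ ENNReal.ofReal (θ * r)) :
    wnorm w (fun j => ENNReal.ofReal θ⁻¹ * x j) ≤ ENNReal.ofReal r := by
  rw [wnorm_smul]
  calc ENNReal.ofReal θ⁻¹ * wnorm w x ≤ ENNReal.ofReal θ⁻¹ * ENNReal.ofReal (θ * r) := by gcongr
    _ = ENNReal.ofReal r := by
      rw [← ENNReal.ofReal_mul (by positivity), inv_mul_cancel_left₀ hθ.ne']

theorem ofReal_mul_ofReal_inv_mul {θ : ℝ} (hθ : 0 < θ) (a : ℝ≥0∞) :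
    ENNReal.ofReal θ * (ENNReal.ofReal θ⁻¹ * a) = a := by
  rw [← mul_assoc, ← ENNReal.ofReal_mul hθ.le, mul_inv_cancel₀ hθ.ne', ENNReal.ofReal_one, one_mul]

/-- The field of a monomial of degree at least `d + 2` is homogeneous of degree at least `d + 1`.
This gain turns bounds on a fixed ball into the powers of `r₀` of the theorem. -/
theorem fieldSup_scale_le {H : Ham} {d : ℕ} (hd : ScalingDegreeGE d H) {θ : ℝ} (hθ0 : 0 < θ)
    (hθ : θ ≤ 1) (r : ℝ) (w : Weight) :
    fieldSup (θ * r) w H ≤ ENNReal.ofReal θ ^ (d + 1) * fieldSup r w H := by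
  refine iSup₂_le fun x hx => ?_
  have hx' := wnorm_div_le hθ0 hx
  have e : x = fun j => ENNReal.ofReal θ * (ENNReal.ofReal θ⁻¹ * x j) := by
    funext j; rw [ofReal_mul_ofReal_inv_mul hθ0]
  have h1 := le_fieldSup H hx'
  calc wnorm w (majField H x)
      ≤ wnorm w (fun j => ENNReal.ofReal θ ^ (d + 1) *
          majField H (fun j => ENNReal.ofReal θ⁻¹ * x j) j) := by
        refine wnorm_mono w fun j => ?_
        conv_lhs => rw [e]
        exact majField_smul_le hd (by rw [← ENNReal.ofReal_one]; exact ENNReal.ofReal_le_ofReal hθ) _ _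
    _ ≤ _ := by rw [wnorm_smul]; gcongr

/-- Change of weight. -/
theorem fieldSup_change_weight {w w' : Weight} {F G : Ham} {C : ℝ} (hC : 0 ≤ C)
    (h : ∀ a j, a.2 j ≠ 0 → ‖F a‖ * (w'.toFun j / w.toFun j)
      ≤ C * ‖G a‖ * mpow (fun i => w'.toFun i / w.toFun i) (restIndex a j)) (r : ℝ) :
    fieldSup r w' F ≤ ENNReal.ofReal C * fieldSup r w G := by
  refine iSup₂_le fun x hx => ?_
  set ρ : ℤ → ℝ := fun i => w'.toFun i / w.toFun i with hρ
  have hρ0 : ∀ i, 0 < ρ i := fun i => div_pos (w'.pos i) (w.pos i)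
  -- Multiplication by `ρ = w' / w` carries the norm of `w'` to that of `w`. Under it the term of
  -- `a` in the component `j` acquires the factor `ρ_j` divided by the product of the `ρ_i` over the
  -- remaining indices; a loss in the coefficients can be absorbed there.
  set y : ℤ → ℝ≥0∞ := fun i => ENNReal.ofReal (ρ i) * x i with hy
  have hw' : ∀ i, ENNReal.ofReal (w'.toFun i)
      = ENNReal.ofReal (w.toFun i) * ENNReal.ofReal (ρ i) := fun i => by
    rw [← ENNReal.ofReal_mul (w.pos i).le, hρ, mul_div_cancel₀ _ (w.pos i).ne']
  have hxy : wnorm w y = wnorm w' x := by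
    simp only [wnorm, hw', hy, mul_assoc]
  have hpow : ∀ κ, mpow (fun i => ENNReal.ofReal (ρ i)) κ = ENNReal.ofReal (mpow ρ κ) := by
    intro κ
    rw [mpow, mpow, Finsupp.prod, Finsupp.prod,
      ENNReal.ofReal_prod_of_nonneg fun i _ => pow_nonneg (hρ0 i).le _]
    exact Finset.prod_congr rfl fun i _ => (ENNReal.ofReal_pow (hρ0 i).le _).symm
  have key : ∀ j, ENNReal.ofReal (ρ j) * majField F x j ≤ ENNReal.ofReal C * majField G y j := by
    intro j
    rw [majField, majField, ← ENNReal.tsum_mul_left, ← ENNReal.tsum_mul_left]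
    refine ENNReal.tsum_le_tsum fun a => ?_
    by_cases hj : a.2 j = 0
    · simp [hj]
    rw [hy, mpow_mul, hpow]
    have h1 := ENNReal.ofReal_le_ofReal (h a j hj)
    have h0 : 0 ≤ mpow ρ (restIndex a j) :=
      Finset.prod_nonneg fun i _ => pow_nonneg (hρ0 i).le _
    rw [ENNReal.ofReal_mul (norm_nonneg _), ENNReal.ofReal_mul (by positivity),
      ENNReal.ofReal_mul hC, ofReal_norm, ofReal_norm] at h1
    calc ENNReal.ofReal (ρ j) * (‖F a‖ₑ * ((a.2 j : ℝ≥0∞) * mpow x (restIndex a j)))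
        = (‖F a‖ₑ * ENNReal.ofReal (ρ j)) * ((a.2 j : ℝ≥0∞) * mpow x (restIndex a j)) := by ring
      _ ≤ (ENNReal.ofReal C * ‖G a‖ₑ * ENNReal.ofReal (mpow ρ (restIndex a j)))
          * ((a.2 j : ℝ≥0∞) * mpow x (restIndex a j)) := by gcongr
      _ = _ := by ring
  have h2 : wnorm w' (majField F x) ≤ wnorm w (fun j => ENNReal.ofReal C * majField G y j) := by
    refine le_trans (le_of_eq ?_) (wnorm_mono w key)
    simp only [wnorm, hw', mul_assoc]
  refine h2.trans ?_
  rw [wnorm_smul]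
  gcongr
  exact le_fieldSup G (by rw [hxy]; exact hx)

/-! ### Cauchy estimates and Poisson brackets -/

/-- The derivative of the majorant vector field in the direction `v`. -/
def majDeriv (H : Ham) (x v : ℤ → ℝ≥0∞) (j : ℤ) : ℝ≥0∞ :=
  ∑' a, ‖H a‖ₑ * ((a.2 j : ℝ≥0∞) * dmpow x v (restIndex a j))

theorem mul_majDeriv_le (H : Ham) (x v : ℤ → ℝ≥0∞) (t : ℝ≥0∞) (j : ℤ) :
    t * majDeriv H x v j ≤ majField H (fun i => x i + t * v i) j := by
  rw [majDeriv, majField, ← ENNReal.tsum_mul_left]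
  refine ENNReal.tsum_le_tsum fun a => ?_
  have h := le_add_self.trans (mpow_add_dmpow_le x (fun i => t * v i) (restIndex a j))
  rw [dmpow_smul] at h
  calc t * (‖H a‖ₑ * ((a.2 j : ℝ≥0∞) * dmpow x v (restIndex a j)))
      = ‖H a‖ₑ * ((a.2 j : ℝ≥0∞) * (t * dmpow x v (restIndex a j))) := by ring
    _ ≤ _ := by gcongr; exact h

/-- For `t = (r - r') / |v|_w` the point `x + t v` still lies in the ball of radius `r`, so
`mul_majDeriv_le` applies. The case of zero norm is separate because `t` would be infinite. -/
theorem wnorm_majDeriv_le {w : Weight} {r r' : ℝ} (h0 : 0 ≤ r') (hr : r' < r) (H : Ham)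
    {x v : ℤ → ℝ≥0∞} (hx : wnorm w x ≤ ENNReal.ofReal r') (hv : wnorm w v ≠ ⊤) :
    ENNReal.ofReal (r - r') * wnorm w (majDeriv H x v) ≤ wnorm w v * fieldSup r w H := by
  by_cases hv0 : wnorm w v = 0
  · have hv' : ∀ j, v j = 0 := by
      intro j
      have := le_wnorm w v j
      rw [hv0, nonpos_iff_eq_zero, mul_eq_zero, ENNReal.ofReal_eq_zero] at this
      exact this.resolve_left (not_le.mpr (w.pos j))
    have : majDeriv H x v = fun _ => 0 := by
      funext j
      simp [majDeriv, dmpow, hv']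
    rw [this, wnorm_zero]
    simp
  set t := ENNReal.ofReal (r - r') / wnorm w v with ht
  have h1 : wnorm w (fun i => x i + t * v i) ≤ ENNReal.ofReal r := by
    refine (wnorm_add_le w _ _).trans ?_
    rw [wnorm_smul, ht, ENNReal.div_mul_cancel hv0 hv]
    refine (add_le_add_left hx _).trans ?_
    rw [← ENNReal.ofReal_add h0 (by linarith)]
    simp
  have h2 : t * wnorm w (majDeriv H x v) ≤ fieldSup r w H := by
    rw [← wnorm_smul]
    exact (wnorm_mono w (mul_majDeriv_le H x v t)).trans (le_fieldSup H h1)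
  calc ENNReal.ofReal (r - r') * wnorm w (majDeriv H x v)
      = wnorm w v * (t * wnorm w (majDeriv H x v)) := by
        rw [← mul_assoc, ht, ENNReal.mul_div_cancel hv0 hv]
    _ ≤ _ := by gcongr

/-- The exponent of the monomials in `{u^a, u^b}` that arise from the pair `(u_j, ū_j)`. -/
def bracketIndex (p : (MultiIndex × MultiIndex) × (MultiIndex × MultiIndex) × ℤ) :
    MultiIndex × MultiIndex :=
  (p.1.1 + p.2.1.1 - Finsupp.single p.2.2 1, p.1.2 + p.2.1.2 - Finsupp.single p.2.2 1)

/-- The corresponding coefficients. -/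
def bracketCoeff (F S : Ham) (p : (MultiIndex × MultiIndex) × (MultiIndex × MultiIndex) × ℤ) : ℂ :=
  -Complex.I * (F p.1 * S p.2.1) *
    ((p.1.1 p.2.2 : ℂ) * p.2.1.2 p.2.2 - (p.1.2 p.2.2 : ℂ) * p.2.1.1 p.2.2)

/-- The Poisson bracket: the derivative of `F` along the Hamiltonian vector field of `S`. -/
def bracket (F S : Ham) : Ham := fun c => ∑' p, if bracketIndex p = c then bracketCoeff F S p else 0

/-- Each triple `p` contributes to exactly one monomial, so the sum over `c` collapses;
cancellations between triples are discarded. -/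
theorem tsum_enorm_bracket_mul_le (F S : Ham) (φ : MultiIndex × MultiIndex → ℝ≥0∞) :
    ∑' c, ‖bracket F S c‖ₑ * φ c ≤ ∑' p, ‖bracketCoeff F S p‖ₑ * φ (bracketIndex p) := by
  calc ∑' c, ‖bracket F S c‖ₑ * φ c
      ≤ ∑' c, ∑' p, (if bracketIndex p = c then ‖bracketCoeff F S p‖ₑ * φ (bracketIndex p) else 0) := by
        refine ENNReal.tsum_le_tsum fun c => ?_
        refine (mul_le_mul_left (enorm_tsum_le_tsum_enorm) _).trans (le_of_eq ?_)
        rw [← ENNReal.tsum_mul_right]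
        refine tsum_congr fun p => ?_
        split_ifs with h
        · rw [h]
        · simp
    _ = _ := by
        rw [ENNReal.tsum_comm]
        exact tsum_congr fun p => by simp

theorem enorm_bracketCoeff_le (F S : Ham)
    (p : (MultiIndex × MultiIndex) × (MultiIndex × MultiIndex) × ℤ) :
    ‖bracketCoeff F S p‖ₑ ≤ ‖F p.1‖ₑ * ‖S p.2.1‖ₑ *
      ((p.1.1 p.2.2 : ℝ≥0∞) * p.2.1.2 p.2.2 + (p.1.2 p.2.2 : ℝ≥0∞) * p.2.1.1 p.2.2) := by
  have hn : ∀ n : ℕ, ‖(n : ℂ)‖ₑ = n := fun n => by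
    rw [← ofReal_norm, Complex.norm_natCast, ENNReal.ofReal_natCast]
  rw [bracketCoeff, enorm_mul, enorm_mul, enorm_mul, enorm_neg]
  have : ‖Complex.I‖ₑ = 1 := by rw [← ofReal_norm]; simp
  rw [this, one_mul]
  gcongr
  refine enorm_sub_le.trans ?_
  rw [enorm_mul, enorm_mul, hn, hn, hn, hn]

theorem tsum_bracket_split (f : (MultiIndex × MultiIndex) → (MultiIndex × MultiIndex) → ℤ → ℝ≥0∞) :
    ∑' p : (MultiIndex × MultiIndex) × (MultiIndex × MultiIndex) × ℤ, f p.1 p.2.1 p.2.2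
      = ∑' j, ∑' a, ∑' b, f a b j := by
  rw [ENNReal.tsum_prod (f := fun a (q : (MultiIndex × MultiIndex) × ℤ) => f a q.1 q.2)]
  rw [ENNReal.tsum_comm (f := fun j a => ∑' b, f a b j)]
  refine tsum_congr fun a => ?_
  rw [ENNReal.tsum_prod (f := fun b j => f a b j), ENNReal.tsum_comm]

theorem tsum_tsum_mul_mul (F S : Ham) (A B : MultiIndex × MultiIndex → ℝ≥0∞) :
    ∑' a, ∑' b, ‖F a‖ₑ * ‖S b‖ₑ * (A a * B b) = (∑' a, ‖F a‖ₑ * A a) * ∑' b, ‖S b‖ₑ * B b := by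
  rw [← ENNReal.tsum_mul_right]
  refine tsum_congr fun a => ?_
  rw [← ENNReal.tsum_mul_left]
  exact tsum_congr fun b => by ring

section BracketMonomials

variable {R : Type*} [CommSemiring R]

theorem mpow_bracketIndex_left (x : ℤ → R) (κ κ' : MultiIndex) (j : ℤ) :
    (κ j : R) * mpow x (κ + κ' - Finsupp.single j 1) = pd x κ j * mpow x κ' := by
  by_cases h : κ j = 0
  · simp [pd, h]
  · rw [add_sub_single h, mpow_add, pd, mul_assoc]

theorem mpow_bracketIndex_right (x : ℤ → R) (κ κ' : MultiIndex) (j : ℤ) :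
    (κ' j : R) * mpow x (κ + κ' - Finsupp.single j 1) = mpow x κ * pd x κ' j := by
  rw [add_comm κ, mpow_bracketIndex_left, mul_comm]

/-- The product rule for `∂_i` applied to `(∂_j x ^ κ) x ^ κ'`. The factor `κ j` removes the case in
which the truncated subtraction of `e_j` would take from `κ'`. -/
theorem pd_bracketIndex_left (x : ℤ → R) (κ κ' : MultiIndex) (i j : ℤ) :
    (κ j : R) * pd x (κ + κ' - Finsupp.single j 1) i
      = κ i * pd x (κ - Finsupp.single i 1) j * mpow x κ' + pd x κ j * pd x κ' i := by
  by_cases h : κ j = 0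
  · simp [pd, h]
  · rw [add_sub_single h, pd_add, mul_add, ← mul_assoc, mul_pd_sub_comm, ← mul_assoc]
    rfl

theorem pd_bracketIndex_right (x : ℤ → R) (κ κ' : MultiIndex) (i j : ℤ) :
    (κ' j : R) * pd x (κ + κ' - Finsupp.single j 1) i
      = κ' i * pd x (κ' - Finsupp.single i 1) j * mpow x κ + pd x κ' j * pd x κ i := by
  rw [add_comm κ, pd_bracketIndex_left]

end BracketMonomials

theorem mul_pd_restIndex (x : ℤ → ℝ≥0∞) (a : MultiIndex × MultiIndex) (i j : ℤ) :
    (a.2 i : ℝ≥0∞) * pd x (restIndex a i) j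
      = pd x a.1 j * pd x a.2 i + a.2 i * pd x (a.2 - Finsupp.single i 1) j * mpow x a.1 := by
  rw [restIndex, pd_add]
  simp only [pd]
  ring

/-- The vector field of a bracket is, up to sign, the commutator of the two fields, so its majorant
is at most `DX_F [X_S] + DX_S [X_F]`. After the triangle inequality on the coefficients the
rearrangement is an identity of nonnegative sums. -/
theorem majField_bracket_le {F S : Ham} (hF : ∀ α β : MultiIndex, F (α, β) = conj (F (β, α)))
    (hS : ∀ α β : MultiIndex, S (α, β) = conj (S (β, α))) (x : ℤ → ℝ≥0∞) (i : ℤ) :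
    majField (bracket F S) x i
      ≤ majDeriv F x (majField S x) i + majDeriv S x (majField F x) i := by
  have hD : ∀ (H : Ham) (v : ℤ → ℝ≥0∞), majDeriv H x v i
      = ∑' j, v j * ((∑' a, ‖H a‖ₑ * (pd x a.1 j * pd x a.2 i))
        + ∑' a, ‖H a‖ₑ * (a.2 i * pd x (a.2 - Finsupp.single i 1) j * mpow x a.1)) := by
    intro H v
    simp only [← ENNReal.tsum_add, ← mul_add, ← mul_pd_restIndex, ← ENNReal.tsum_mul_left]
    rw [ENNReal.tsum_comm]
    refine tsum_congr fun a => ?_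
    rw [dmpow, ← ENNReal.tsum_mul_left, ← ENNReal.tsum_mul_left]
    exact tsum_congr fun j => by ring
  have hX : ∀ (H : Ham) j, majField H x j = ∑' a, ‖H a‖ₑ * (mpow x a.1 * pd x a.2 j) := fun H j =>
    tsum_congr fun a => by rw [mul_mpow_restIndex]
  rw [majField]
  simp only [mul_mpow_restIndex]
  refine (tsum_enorm_bracket_mul_le F S _).trans ?_
  refine (ENNReal.tsum_le_tsum fun p => mul_le_mul_left (enorm_bracketCoeff_le F S p) _).trans ?_
  rw [hD F, hD S, ← ENNReal.tsum_add]
  rw [tsum_bracket_split (fun a b j => ‖F a‖ₑ * ‖S b‖ₑ *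
      ((a.1 j : ℝ≥0∞) * b.2 j + (a.2 j : ℝ≥0∞) * b.1 j) *
      (mpow x (bracketIndex (a, b, j)).1 * pd x (bracketIndex (a, b, j)).2 i))]
  refine le_of_eq (tsum_congr fun j => ?_)
  -- There are two terms in the bracket and two factors on which `∂_i` can fall. The first and third
  -- products sum to `DX_F [X_S]`, the second and fourth to `DX_S [X_F]`.
  have e : ∀ a b : MultiIndex × MultiIndex, ‖F a‖ₑ * ‖S b‖ₑ *
      ((a.1 j : ℝ≥0∞) * b.2 j + (a.2 j : ℝ≥0∞) * b.1 j) *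
      (mpow x (bracketIndex (a, b, j)).1 * pd x (bracketIndex (a, b, j)).2 i)
      = ‖F a‖ₑ * ‖S b‖ₑ * ((pd x a.1 j * pd x a.2 i) * (mpow x b.1 * pd x b.2 j))
      + ‖F a‖ₑ * ‖S b‖ₑ * ((pd x a.1 j * mpow x a.2) *
          (b.2 i * pd x (b.2 - Finsupp.single i 1) j * mpow x b.1))
      + ‖F a‖ₑ * ‖S b‖ₑ * ((a.2 i * pd x (a.2 - Finsupp.single i 1) j * mpow x a.1) *
          (pd x b.1 j * mpow x b.2))
      + ‖F a‖ₑ * ‖S b‖ₑ * ((mpow x a.1 * pd x a.2 j) * (pd x b.1 j * pd x b.2 i)) := by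
    intro a b
    have h1 := mpow_bracketIndex_left x a.1 b.1 j
    have h2 := mpow_bracketIndex_right x a.1 b.1 j
    have h3 := pd_bracketIndex_left x a.2 b.2 i j
    have h4 := pd_bracketIndex_right x a.2 b.2 i j
    simp only [bracketIndex]
    calc _ = ‖F a‖ₑ * ‖S b‖ₑ * (((a.1 j : ℝ≥0∞) * mpow x (a.1 + b.1 - Finsupp.single j 1)) *
              ((b.2 j : ℝ≥0∞) * pd x (a.2 + b.2 - Finsupp.single j 1) i))
            + ‖F a‖ₑ * ‖S b‖ₑ * (((b.1 j : ℝ≥0∞) * mpow x (a.1 + b.1 - Finsupp.single j 1)) *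
              ((a.2 j : ℝ≥0∞) * pd x (a.2 + b.2 - Finsupp.single j 1) i)) := by ring
      _ = _ := by rw [h1, h2, h3, h4]; ring
  simp only [e, ENNReal.tsum_add, tsum_tsum_mul_mul]
  rw [majField_conj hF, majField_conj hS, ← hX, ← hX]
  ring

/-- The Cauchy estimate is used once in the direction `X_S` and once in the direction `X_F`; hence
the factor `2`. -/
theorem fieldSup_bracket_le {w : Weight} {r r' : ℝ} (h0 : 0 ≤ r') (hr : r' < r) {F S : Ham}
    (hF : ∀ α β : MultiIndex, F (α, β) = conj (F (β, α)))
    (hS : ∀ α β : MultiIndex, S (α, β) = conj (S (β, α)))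
    (hF' : fieldSup r w F ≠ ⊤) (hS' : fieldSup r w S ≠ ⊤) :
    ENNReal.ofReal (r - r') * fieldSup r' w (bracket F S)
      ≤ 2 * (fieldSup r w S * fieldSup r w F) := by
  conv_lhs => rw [fieldSup]
  simp only [ENNReal.mul_iSup]
  refine iSup₂_le fun x hx => ?_
  have hx' : wnorm w x ≤ ENNReal.ofReal r := hx.trans (ENNReal.ofReal_le_ofReal hr.le)
  have bS := le_fieldSup S hx'
  have bF := le_fieldSup F hx'
  have h1 := wnorm_majDeriv_le h0 hr F hx (v := majField S x) (ne_top_of_le_ne_top hS' bS)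
  have h2 := wnorm_majDeriv_le h0 hr S hx (v := majField F x) (ne_top_of_le_ne_top hF' bF)
  have h3 := (wnorm_mono w (majField_bracket_le hF hS x)).trans (wnorm_add_le w _ _)
  calc ENNReal.ofReal (r - r') * wnorm w (majField (bracket F S) x)
      ≤ ENNReal.ofReal (r - r') * (wnorm w (majDeriv F x (majField S x))
          + wnorm w (majDeriv S x (majField F x))) := by gcongr
    _ ≤ fieldSup r w S * fieldSup r w F + fieldSup r w F * fieldSup r w S := by
        rw [mul_add]
        exact add_le_add (h1.trans (by gcongr)) (h2.trans (by gcongr))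
    _ = 2 * (fieldSup r w S * fieldSup r w F) := by ring

/-! ### The spaces `h_w` -/

theorem HSpace.coords_add {w : Weight} (u v : HSpace w) (j : ℤ) : (u + v) j = u j + v j := rfl

theorem HSpace.coords_real_smul {w : Weight} (c : ℝ) (u : HSpace w) (j : ℤ) :
    (c • u) j = (c : ℂ) * u j := rfl

theorem HSpace.ext {w : Weight} {u v : HSpace w} (h : ∀ j, u j = v j) : u = v :=
  Subtype.ext (funext h)

theorem tsum_enorm_ne_top_iff {ι : Type*} {f : ι → ℂ} :
    (∑' i, ‖f i‖ₑ) ≠ ⊤ ↔ Summable fun i => ‖f i‖ := by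
  have : (∑' i, ‖f i‖ₑ) = ∑' i, ((‖f i‖₊ : NNReal) : ℝ≥0∞) := rfl
  rw [this, ENNReal.tsum_coe_ne_top_iff_summable, ← NNReal.summable_coe]
  rfl

theorem summable_of_tsum_enorm_ne_top {ι : Type*} {f : ι → ℂ} (h : (∑' i, ‖f i‖ₑ) ≠ ⊤) :
    Summable f := (tsum_enorm_ne_top_iff.mp h).of_norm

theorem memℓp_two_iff {f : ℤ → ℂ} : Memℓp f 2 ↔ (∑' j, ‖f j‖ₑ ^ 2) ≠ ⊤ := by
  rw [memℓp_gen_iff (by norm_num)]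
  have e : ∀ j, ‖f j‖ₑ ^ 2 = ((‖f j‖₊ ^ 2 : NNReal) : ℝ≥0∞) := fun j => by
    rw [ENNReal.coe_pow]; rfl
  simp_rw [e]
  rw [ENNReal.tsum_coe_ne_top_iff_summable, ← NNReal.summable_coe]
  simp

theorem enorm_weight_mul (w : Weight) (f : ℤ → ℂ) (j : ℤ) :
    ‖(w.toFun j : ℂ) * f j‖ₑ = ENNReal.ofReal (w.toFun j) * ‖f j‖ₑ := by
  rw [enorm_mul]
  congr 1
  rw [← ofReal_norm, Complex.norm_real, Real.norm_of_nonneg (w.pos j).le]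

theorem wnorm_enorm_ne_top_iff {w : Weight} {f : ℤ → ℂ} :
    wnorm w (fun j => ‖f j‖ₑ) ≠ ⊤ ↔ Memℓp (fun j => (w.toFun j : ℂ) * f j) 2 := by
  rw [memℓp_two_iff, wnorm, Ne, ENNReal.rpow_eq_top_iff_of_pos (by norm_num)]
  simp_rw [enorm_weight_mul]

theorem one_le_ofReal_weight {w : Weight} (hw : ∀ j, 1 ≤ w.toFun j) (j : ℤ) :
    (1 : ℝ≥0∞) ≤ ENNReal.ofReal (w.toFun j) := by
  rw [← ENNReal.ofReal_one]; exact ENNReal.ofReal_le_ofReal (hw j)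

theorem memℓp_of_wnorm_ne_top {w : Weight} (hw : ∀ j, 1 ≤ w.toFun j) {f : ℤ → ℂ}
    (h : wnorm w (fun j => ‖f j‖ₑ) ≠ ⊤) : Memℓp f 2 := by
  rw [wnorm_enorm_ne_top_iff, memℓp_two_iff] at h
  rw [memℓp_two_iff]
  refine ne_top_of_le_ne_top h (ENNReal.tsum_le_tsum fun j => ?_)
  rw [enorm_weight_mul]
  gcongr
  exact le_mul_of_one_le_left' (one_le_ofReal_weight hw j)

/-- The element of `h_w` with given coordinates. -/
def HSpace.mk {w : Weight} (hw : ∀ j, 1 ≤ w.toFun j) (f : ℤ → ℂ)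
    (h : wnorm w (fun j => ‖f j‖ₑ) ≠ ⊤) : HSpace w :=
  ⟨f, memℓp_of_wnorm_ne_top hw h, wnorm_enorm_ne_top_iff.mp h⟩

theorem HSpace.norm_eq {w : Weight} (u : HSpace w) : ‖u‖ = ‖HSpace.toL2 w u‖ := rfl

theorem HSpace.enorm_eq {w : Weight} (u : HSpace w) : ‖u‖ₑ = wnorm w (fun j => ‖u j‖ₑ) := by
  rw [← ofReal_norm, HSpace.norm_eq, lp.norm_eq_tsum_rpow (by norm_num)]
  rw [← ENNReal.ofReal_rpow_of_nonneg (tsum_nonneg fun _ => by positivity) (by norm_num), wnorm]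
  have hs : Summable fun j => ‖HSpace.toL2 w u j‖ ^ (2 : ℝ≥0∞).toReal :=
    (memℓp_gen_iff (p := 2) (by norm_num)).mp u.2.2
  rw [ENNReal.ofReal_tsum_of_nonneg (fun _ => by positivity) hs]
  norm_num
  congr 1
  refine tsum_congr fun j => ?_
  rw [← enorm_weight_mul w u.coords]
  rfl

theorem HSpace.norm_le_iff {w : Weight} (u : HSpace w) {r : ℝ} (hr : 0 ≤ r) :
    ‖u‖ ≤ r ↔ wnorm w (fun j => ‖u j‖ₑ) ≤ ENNReal.ofReal r := by
  rw [← HSpace.enorm_eq, ← ofReal_norm, ENNReal.ofReal_le_ofReal_iff hr]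

theorem HSpace.wnorm_ne_top {w : Weight} (u : HSpace w) : wnorm w (fun j => ‖u j‖ₑ) ≠ ⊤ := by
  rw [← HSpace.enorm_eq]; exact enorm_ne_top

/-- The isometry `h_w ≃ ℓ²`. -/
def HSpace.equivL2 {w : Weight} (hw : ∀ j, 1 ≤ w.toFun j) :
    HSpace w ≃ₗᵢ[ℂ] lp (fun _ : ℤ => ℂ) 2 :=
  LinearIsometryEquiv.ofSurjective ⟨HSpace.toL2 w, fun _ => rfl⟩ (by
    intro y
    have hy : (fun j => (w.toFun j : ℂ) * ((w.toFun j : ℂ)⁻¹ * y j)) = fun j => y j := by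
      funext j
      exact mul_inv_cancel_left₀ (Complex.ofReal_ne_zero.mpr (w.pos j).ne') _
    have h : wnorm w (fun j => ‖(w.toFun j : ℂ)⁻¹ * y j‖ₑ) ≠ ⊤ := by
      rw [wnorm_enorm_ne_top_iff, hy]
      exact y.2
    refine ⟨HSpace.mk hw _ h, ?_⟩
    ext j
    exact congrFun hy j)

theorem HSpace.completeSpace {w : Weight} (hw : ∀ j, 1 ≤ w.toFun j) : CompleteSpace (HSpace w) :=
  ((HSpace.equivL2 hw).toIsometryEquiv.completeSpace_iff).mpr inferInstance

theorem HSpace.norm_coords_le {w : Weight} (hw : ∀ j, 1 ≤ w.toFun j) (u : HSpace w) (j : ℤ) :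
    ‖u j‖ ≤ ‖u‖ := by
  rw [← enorm_le_iff_norm_le, HSpace.enorm_eq]
  exact (le_mul_of_one_le_left' (one_le_ofReal_weight hw j)).trans
    (le_wnorm w (fun j => ‖u j‖ₑ) j)

/-- The coordinates as continuous real linear maps. -/
def HSpace.coordCLM {w : Weight} (hw : ∀ j, 1 ≤ w.toFun j) (j : ℤ) : HSpace w →L[ℝ] ℂ :=
  LinearMap.mkContinuous
    { toFun := fun u => u j
      map_add' := fun _ _ => rfl
      map_smul' := fun _ _ => rfl } 1
    fun u => by rw [one_mul]; exact HSpace.norm_coords_le hw u j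

/-- The norm of a Hamiltonian in terms of its majorant vector field. -/
theorem hamNorm_eq {r : ℝ} {w : Weight} (hw : ∀ j, 1 ≤ w.toFun j) (hr : 0 ≤ r) (H : Ham) :
    hamNorm r w H = fieldSup r w H / ENNReal.ofReal r := by
  unfold hamNorm
  congr 1
  have e : ∀ u : HSpace w, (∑' j : ℤ, (ENNReal.ofReal (w.toFun j) * majorantField H u j) ^ 2)
      ^ (1 / 2 : ℝ) = wnorm w (majField H fun i => ‖u i‖ₑ) := fun u => by
    simp only [wnorm, majField_eq]
  apply le_antisymm
  · refine iSup₂_le fun u hu => ?_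
    rw [e]
    exact le_fieldSup H ((u.norm_le_iff hr).mp hu)
  · refine iSup₂_le fun x hx => ?_
    -- Weights bounded below exclude infinite coordinates, so every point of the ball in `[0, ∞]` is
    -- the sequence of moduli of an element of `h_w`.
    have hxt : ∀ j, x j ≠ ⊤ := fun j h => by
      have := (le_wnorm w x j).trans hx
      rw [h, ENNReal.mul_top (zero_lt_one.trans_le (one_le_ofReal_weight hw j)).ne'] at this
      exact ENNReal.ofReal_ne_top (top_le_iff.mp this)
    have hx' : (fun j => ‖(((x j).toReal : ℝ) : ℂ)‖ₑ) = x := by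
      funext j
      rw [← ofReal_norm, Complex.norm_real, Real.norm_of_nonneg ENNReal.toReal_nonneg,
        ENNReal.ofReal_toReal (hxt j)]
    set u : HSpace w := HSpace.mk hw (fun j => (((x j).toReal : ℝ) : ℂ))
      (by rw [hx']; exact ne_top_of_le_ne_top ENNReal.ofReal_ne_top hx) with hu
    have hux : (fun j => ‖u j‖ₑ) = x := hx'
    have hur : ‖u‖ ≤ r := by rw [u.norm_le_iff hr, hux]; exact hx
    refine le_trans (le_of_eq ?_) (le_iSup₂ (f := fun (u : HSpace w) (_ : ‖u‖ ≤ r) =>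
      (∑' j : ℤ, (ENNReal.ofReal (w.toFun j) * majorantField H u j) ^ 2) ^ (1 / 2 : ℝ)) u hur)
    rw [e, hux]

/-! ### Values of Hamiltonians -/

theorem mono_eq (u : ℤ → ℂ) (a : MultiIndex × MultiIndex) :
    mono u a = mpow u a.1 * mpow (fun j => conj (u j)) a.2 := rfl

theorem enorm_mpow (x : ℤ → ℂ) (κ : MultiIndex) : ‖mpow x κ‖ₑ = mpow (fun j => ‖x j‖ₑ) κ := by
  have h : ∀ y : ℂ, ‖y‖ₑ = ((‖y‖₊ : NNReal) : ℝ≥0∞) := fun _ => rfl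
  simp only [h, mpow, Finsupp.prod, nnnorm_prod, nnnorm_pow, ENNReal.ofNNReal_finsetProd,
    ENNReal.coe_pow]

theorem enorm_conj (z : ℂ) : ‖conj z‖ₑ = ‖z‖ₑ := by
  rw [← ofReal_norm, Complex.norm_conj, ofReal_norm]

theorem enorm_natCast (n : ℕ) : ‖(n : ℂ)‖ₑ = n := by
  rw [← ofReal_norm, Complex.norm_natCast, ENNReal.ofReal_natCast]

theorem enorm_pd (x : ℤ → ℂ) (κ : MultiIndex) (j : ℤ) :
    ‖pd x κ j‖ₑ = pd (fun j => ‖x j‖ₑ) κ j := by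
  rw [pd, enorm_mul, enorm_natCast, enorm_mpow, pd]

theorem enorm_mono (u : ℤ → ℂ) (a : MultiIndex × MultiIndex) :
    ‖mono u a‖ₑ = mpow (fun j => ‖u j‖ₑ) (a.1 + a.2) := by
  rw [mono_eq, enorm_mul, enorm_mpow, enorm_mpow, mpow_add]
  simp only [enorm_conj]

/-- Euler's identity for monomials. -/
theorem dmpow_self (x : ℤ → ℝ≥0∞) (κ : MultiIndex) :
    dmpow x x κ = ((κ.sum fun _ n => n : ℕ) : ℝ≥0∞) * mpow x κ := by
  have h : ∀ j, x j * pd x κ j = (κ j : ℝ≥0∞) * mpow x κ := by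
    intro j
    by_cases hj : κ j = 0
    · simp [pd, hj]
    · conv_rhs => rw [← sub_single_add_single hj, mpow_add, mpow_single, pow_one]
      rw [pd, Finsupp.add_apply, Finsupp.tsub_apply, Finsupp.single_eq_same,
        Nat.sub_add_cancel (by omega)]
      ring
  rw [dmpow, tsum_congr h, ENNReal.tsum_mul_right]
  congr 1
  rw [tsum_eq_sum (s := κ.support) (fun j hj => by simpa using hj), Finsupp.sum]
  push_cast
  rfl

/-- By reality the derivatives in `u` and in `ū` contribute equally, whence the factor `2`. -/
theorem tsum_enorm_mul_dmpow {H : Ham} (hH : ∀ α β : MultiIndex, H (α, β) = conj (H (β, α)))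
    (x v : ℤ → ℝ≥0∞) :
    ∑' a, ‖H a‖ₑ * dmpow x v (a.1 + a.2) = 2 * ∑' j, v j * majField H x j := by
  have h : ∀ a : MultiIndex × MultiIndex, ‖H a‖ₑ * dmpow x v (a.1 + a.2)
      = ∑' j, (v j * (‖H a‖ₑ * (pd x a.1 j * mpow x a.2))
        + v j * (‖H a‖ₑ * (mpow x a.1 * pd x a.2 j))) := by
    intro a
    rw [dmpow, ← ENNReal.tsum_mul_left]
    refine tsum_congr fun j => ?_
    rw [pd_add]
    ring
  rw [tsum_congr h, ENNReal.tsum_comm, ← ENNReal.tsum_mul_left]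
  refine tsum_congr fun j => ?_
  rw [ENNReal.tsum_add, ENNReal.tsum_mul_left, ENNReal.tsum_mul_left, majField_conj hH]
  have : ∑' a, ‖H a‖ₑ * (mpow x a.1 * pd x a.2 j) = majField H x j :=
    tsum_congr fun a => by rw [mul_mpow_restIndex]
  rw [this]
  ring

theorem totalDegree_eq_sum (a : MultiIndex × MultiIndex) :
    totalDegree a = (a.1 + a.2).sum fun _ n => n := by
  rw [Finsupp.sum_add_index' (fun _ => rfl) (fun _ _ _ => rfl)]
  rfl

/-- By Euler's identity a monomial of degree at least one is bounded by its derivative in the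
direction of the point itself; Cauchy–Schwarz concludes. So a finite field implies absolute
convergence of the series. -/
theorem tsum_enorm_eval_le {w : Weight} (hw : ∀ j, 1 ≤ w.toFun j) {H : Ham}
    (hH : ∀ α β : MultiIndex, H (α, β) = conj (H (β, α)))
    (hd : ∀ a, H a ≠ 0 → 1 ≤ totalDegree a) (x : ℤ → ℝ≥0∞) :
    ∑' a, ‖H a‖ₑ * mpow x (a.1 + a.2) ≤ 2 * (wnorm w x * wnorm w (majField H x)) := by
  calc ∑' a, ‖H a‖ₑ * mpow x (a.1 + a.2)
      ≤ ∑' a, ‖H a‖ₑ * dmpow x x (a.1 + a.2) := by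
        refine ENNReal.tsum_le_tsum fun a => ?_
        by_cases ha : H a = 0
        · simp [ha]
        rw [dmpow_self, ← totalDegree_eq_sum]
        gcongr
        refine le_mul_of_one_le_left' ?_
        exact_mod_cast hd a ha
    _ = 2 * ∑' j, x j * majField H x j := tsum_enorm_mul_dmpow hH x x
    _ ≤ _ := by gcongr; exact tsum_mul_le_wnorm w hw _ _

theorem tsum_enorm_eval_le_fieldSup {w : Weight} (hw : ∀ j, 1 ≤ w.toFun j) {H : Ham}
    (hH : ∀ α β : MultiIndex, H (α, β) = conj (H (β, α)))
    (hd : ∀ a, H a ≠ 0 → 1 ≤ totalDegree a) {r : ℝ} (hr : 0 ≤ r) {u : HSpace w} (hu : ‖u‖ ≤ r) :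
    ∑' a, ‖H a * mono u a‖ₑ ≤ 2 * (ENNReal.ofReal r * fieldSup r w H) := by
  have hx := (u.norm_le_iff hr).mp hu
  calc ∑' a, ‖H a * mono u a‖ₑ = ∑' a, ‖H a‖ₑ * mpow (fun j => ‖u j‖ₑ) (a.1 + a.2) :=
        tsum_congr fun a => by rw [enorm_mul, enorm_mono]
    _ ≤ _ := tsum_enorm_eval_le hw hH hd _
    _ ≤ _ := by gcongr; exact le_fieldSup H hx

/-! ### A fundamental theorem of calculus for series -/

/-- Termwise integration by dominated convergence. Only the integrated identity is needed later,
which avoids proving that the sum is differentiable. -/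
theorem tsum_sub_tsum_eq_integral {ι : Type*} [Countable ι] {f f' : ι → ℝ → ℂ} {T : ℝ} (hT : 0 ≤ T)
    (hf : ∀ i t, HasDerivAt (f i) (f' i t) t) (hc : ∀ i, Continuous (f' i)) {B : ℝ≥0∞}
    (hB : B ≠ ⊤) (hb : ∀ t ∈ Set.Icc 0 T, ∑' i, ‖f' i t‖ₑ ≤ B)
    (h0 : Summable fun i => f i 0) (h1 : Summable fun i => f i T) :
    IntervalIntegrable (fun t => ∑' i, f' i t) MeasureTheory.volume 0 T ∧
    (∑' i, f i T) - ∑' i, f i 0 = ∫ t in (0 : ℝ)..T, ∑' i, f' i t := by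
  have hu : ∀ t ∈ Set.uIoc 0 T, t ∈ Set.Icc 0 T := fun t ht => by
    rw [Set.uIoc_of_le hT] at ht; exact ⟨ht.1.le, ht.2⟩
  have hs : ∀ t ∈ Set.uIoc 0 T, Summable fun i => ‖f' i t‖ := fun t ht =>
    tsum_enorm_ne_top_iff.mp (ne_top_of_le_ne_top hB (hb t (hu t ht)))
  have hnorm : ∀ t, ∑' i, ‖f' i t‖ = (∑' i, ‖f' i t‖ₑ).toReal := by
    intro t
    rw [ENNReal.tsum_toReal_eq fun i => enorm_ne_top]
    simp
  have hmeas : Measurable fun t => ∑' i, ‖f' i t‖ := by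
    simp_rw [hnorm]
    exact (Measurable.tsum fun i => (hc i).enorm.measurable).ennreal_toReal
  have hle : ∀ t ∈ Set.uIoc 0 T, ∑' i, ‖f' i t‖ ≤ B.toReal := fun t ht => by
    rw [hnorm]; exact ENNReal.toReal_mono hB (hb t (hu t ht))
  have hint : IntervalIntegrable (fun t => ∑' i, ‖f' i t‖) MeasureTheory.volume 0 T := by
    refine (intervalIntegrable_const (c := B.toReal)).mono_fun hmeas.aestronglyMeasurable ?_
    refine (MeasureTheory.ae_restrict_iff' measurableSet_uIoc).mpr (Filter.Eventually.of_forall ?_)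
    intro t ht
    beta_reduce
    rw [Real.norm_of_nonneg (tsum_nonneg fun _ => norm_nonneg _),
      Real.norm_of_nonneg ENNReal.toReal_nonneg]
    exact hle t ht
  have hd := intervalIntegral.hasSum_integral_of_dominated_convergence (F := f')
    (f := fun t => ∑' i, f' i t) (fun i t => ‖f' i t‖) (a := 0) (b := T)
    (μ := MeasureTheory.volume)
    (fun i => (hc i).aestronglyMeasurable) (fun i => Filter.Eventually.of_forall fun t _ => le_rfl)
    (Filter.Eventually.of_forall hs) hint
    (Filter.Eventually.of_forall fun t ht => (hs t ht).of_norm.hasSum)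
  constructor
  · refine hint.mono_fun ?_ ?_
    · refine aestronglyMeasurable_of_tendsto_ae Filter.atTop
        (f := fun (s : Finset ι) t => ∑ i ∈ s, f' i t)
        (fun s => (continuous_finsetSum s fun i _ => hc i).aestronglyMeasurable) ?_
      refine (MeasureTheory.ae_restrict_iff' measurableSet_uIoc).mpr
        (Filter.Eventually.of_forall fun t ht => (hs t ht).of_norm.hasSum)
    · refine (MeasureTheory.ae_restrict_iff' measurableSet_uIoc).mpr
        (Filter.Eventually.of_forall fun t ht => ?_)
      beta_reduce
      rw [Real.norm_of_nonneg (tsum_nonneg fun _ => norm_nonneg _)]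
      exact norm_tsum_le_tsum_norm (hs t ht)
  · rw [← hd.tsum_eq, ← h1.tsum_sub h0]
    refine tsum_congr fun i => ?_
    rw [intervalIntegral.integral_eq_sub_of_hasDerivAt (fun t _ => hf i t)
      ((hc i).intervalIntegrable _ _)]

/-! ### Derivatives of Hamiltonians along curves -/

theorem tsum_comm_of_enorm {α β : Type*} {f : α → β → ℂ} (h : ∑' a, ∑' b, ‖f a b‖ₑ ≠ ⊤) :
    ∑' a, ∑' b, f a b = ∑' b, ∑' a, f a b := by
  refine Summable.tsum_comm (f := fun b a => f a b) ?_
  refine summable_of_tsum_enorm_ne_top ?_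
  rw [ENNReal.tsum_prod', ENNReal.tsum_comm]
  exact h

theorem tsum_prod_of_enorm {α β : Type*} {f : α × β → ℂ} (h : ∑' p, ‖f p‖ₑ ≠ ⊤) :
    ∑' p, f p = ∑' a, ∑' b, f (a, b) :=
  (summable_of_tsum_enorm_ne_top h).tsum_prod

/-- The derivative of the monomial `x ^ κ` in the direction `v`. -/
def dpow (x v : ℤ → ℂ) (κ : MultiIndex) : ℂ := ∑' j, v j * pd x κ j

theorem summable_dpow (x v : ℤ → ℂ) (κ : MultiIndex) : Summable fun j => v j * pd x κ j :=
  summable_of_ne_finset_zero (s := κ.support) fun j hj => by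
    rw [pd_of_eq_zero _ (by simpa using hj), mul_zero]

theorem dpow_eq_sum (x v : ℤ → ℂ) (κ : MultiIndex) :
    dpow x v κ = ∑ j ∈ κ.support, v j * pd x κ j :=
  tsum_eq_sum fun j hj => by rw [pd_of_eq_zero _ (by simpa using hj), mul_zero]

theorem dpow_add (x v : ℤ → ℂ) (κ κ' : MultiIndex) :
    dpow x v (κ + κ') = dpow x v κ * mpow x κ' + mpow x κ * dpow x v κ' := by
  rw [dpow, dpow, dpow, ← tsum_mul_right, ← tsum_mul_left,
    ← ((summable_dpow x v κ).mul_right _).tsum_add ((summable_dpow x v κ').mul_left _)]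
  refine tsum_congr fun j => ?_
  rw [pd_add]
  ring

theorem enorm_dpow_le (x v : ℤ → ℂ) (κ : MultiIndex) :
    ‖dpow x v κ‖ₑ ≤ dmpow (fun j => ‖x j‖ₑ) (fun j => ‖v j‖ₑ) κ := by
  refine enorm_tsum_le_tsum_enorm.trans (le_of_eq (tsum_congr fun j => ?_))
  rw [enorm_mul, enorm_pd]

theorem hasDerivAt_mpow {γ : ℤ → ℝ → ℂ} {v : ℤ → ℂ} {t : ℝ}
    (h : ∀ j, HasDerivAt (γ j) (v j) t) (κ : MultiIndex) :
    HasDerivAt (fun s => mpow (fun j => γ j s) κ) (dpow (fun j => γ j t) v κ) t := by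
  induction κ using Finsupp.induction_linear with
  | zero => simpa [dpow] using hasDerivAt_const t (1 : ℂ)
  | add κ κ' h1 h2 =>
    simp only [mpow_add, dpow_add]
    exact h1.mul h2
  | single i n =>
    have e : dpow (fun j => γ j t) v (Finsupp.single i n) = n * γ i t ^ (n - 1) * v i := by
      rw [dpow, tsum_eq_single i, pd_single_same]
      · ring
      · intro j hj
        rw [pd_single_ne _ hj.symm, mul_zero]
    simp only [mpow_single, e]
    exact (h i).pow n

/-- The derivative of `u^α ū^β` in the direction `v`. -/
def dmono (u v : ℤ → ℂ) (a : MultiIndex × MultiIndex) : ℂ :=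
  dpow u v a.1 * mpow (fun j => conj (u j)) a.2 +
    mpow u a.1 * dpow (fun j => conj (u j)) (fun j => conj (v j)) a.2

theorem hasDerivAt_mono {γ : ℤ → ℝ → ℂ} {v : ℤ → ℂ} {t : ℝ}
    (h : ∀ j, HasDerivAt (γ j) (v j) t) (a : MultiIndex × MultiIndex) :
    HasDerivAt (fun s => mono (fun j => γ j s) a) (dmono (fun j => γ j t) v a) t := by
  have hc : ∀ j, HasDerivAt (fun s => conj (γ j s)) (conj (v j)) t := fun j =>
    (Complex.conjCLE : ℂ ≃L[ℝ] ℂ).hasFDerivAt.comp_hasDerivAt t (h j)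
  exact (hasDerivAt_mpow h a.1).mul (hasDerivAt_mpow hc a.2)

theorem continuous_mpow {γ : ℤ → ℝ → ℂ} (h : ∀ j, Continuous (γ j)) (κ : MultiIndex) :
    Continuous fun t => mpow (fun j => γ j t) κ :=
  continuous_finsetProd _ fun j _ => (h j).pow _

theorem continuous_dpow {γ v : ℤ → ℝ → ℂ} (h : ∀ j, Continuous (γ j))
    (hv : ∀ j, Continuous (v j)) (κ : MultiIndex) :
    Continuous fun t => dpow (fun j => γ j t) (fun j => v j t) κ := by
  simp only [dpow_eq_sum]
  exact continuous_finsetSum _ fun j _ =>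
    (hv j).mul (continuous_const.mul (continuous_mpow h _))

theorem continuous_dmono {γ v : ℤ → ℝ → ℂ} (h : ∀ j, Continuous (γ j))
    (hv : ∀ j, Continuous (v j)) (a : MultiIndex × MultiIndex) :
    Continuous fun t => dmono (fun j => γ j t) (fun j => v j t) a := by
  have hc : ∀ {f : ℤ → ℝ → ℂ}, (∀ j, Continuous (f j)) → ∀ j, Continuous fun t => conj (f j t) :=
    fun hf j => Complex.continuous_conj.comp (hf j)
  exact ((continuous_dpow h hv _).mul (continuous_mpow (hc h) _)).add
    ((continuous_mpow h _).mul (continuous_dpow (hc h) (hc hv) _))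

theorem enorm_dmono_le (u v : ℤ → ℂ) (a : MultiIndex × MultiIndex) :
    ‖dmono u v a‖ₑ ≤ dmpow (fun j => ‖u j‖ₑ) (fun j => ‖v j‖ₑ) (a.1 + a.2) := by
  rw [dmpow_add]
  refine (enorm_add_le _ _).trans (add_le_add ?_ ?_)
  · rw [enorm_mul, enorm_mpow]
    simp only [enorm_conj]
    exact mul_le_mul_left (enorm_dpow_le _ _ _) _
  · rw [enorm_mul, enorm_mpow]
    refine mul_le_mul_right ?_ _
    simpa only [enorm_conj] using
      enorm_dpow_le (fun j => conj (u j)) (fun j => conj (v j)) a.2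

theorem tsum_enorm_dmono_le {w : Weight} (hw : ∀ j, 1 ≤ w.toFun j) {H : Ham}
    (hH : ∀ α β : MultiIndex, H (α, β) = conj (H (β, α))) (u v : ℤ → ℂ) :
    ∑' a, ‖H a * dmono u v a‖ₑ
      ≤ 2 * (wnorm w (fun j => ‖v j‖ₑ) * wnorm w (majField H fun j => ‖u j‖ₑ)) := by
  calc ∑' a, ‖H a * dmono u v a‖ₑ
      ≤ ∑' a, ‖H a‖ₑ * dmpow (fun j => ‖u j‖ₑ) (fun j => ‖v j‖ₑ) (a.1 + a.2) := by
        refine ENNReal.tsum_le_tsum fun a => ?_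
        rw [enorm_mul]
        exact mul_le_mul_right (enorm_dmono_le u v a) _
    _ = 2 * ∑' j, ‖v j‖ₑ * majField H (fun j => ‖u j‖ₑ) j := tsum_enorm_mul_dmpow hH _ _
    _ ≤ _ := by gcongr; exact tsum_mul_le_wnorm w hw _ _

/-- The Hamiltonian vector field `-i ∂_{ū_j} H`. -/
def vectorField (H : Ham) (u : ℤ → ℂ) (j : ℤ) : ℂ :=
  -Complex.I * ∑' a, H a * (mpow u a.1 * pd (fun j => conj (u j)) a.2 j)

/-- The symplectic form on sequences. -/
def pairing (ξ η : ℤ → ℂ) : ℂ := Complex.I * ∑' j : ℤ, (ξ j * conj (η j) - conj (ξ j) * η j)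

theorem enorm_term_vectorField (H : Ham) (u : ℤ → ℂ) (j : ℤ) (a : MultiIndex × MultiIndex) :
    ‖H a * (mpow u a.1 * pd (fun j => conj (u j)) a.2 j)‖ₑ
      = ‖H a‖ₑ * ((a.2 j : ℝ≥0∞) * mpow (fun j => ‖u j‖ₑ) (restIndex a j)) := by
  rw [enorm_mul, enorm_mul, enorm_mpow, enorm_pd, mul_mpow_restIndex]
  simp only [enorm_conj]

theorem tsum_enorm_term_vectorField (H : Ham) (u : ℤ → ℂ) (j : ℤ) :
    ∑' a, ‖H a * (mpow u a.1 * pd (fun j => conj (u j)) a.2 j)‖ₑ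
      = majField H (fun j => ‖u j‖ₑ) j :=
  tsum_congr fun a => enorm_term_vectorField H u j a

theorem enorm_I_mul (z : ℂ) : ‖Complex.I * z‖ₑ = ‖z‖ₑ := by
  rw [enorm_mul, ← ofReal_norm, Complex.norm_I, ENNReal.ofReal_one, one_mul]

theorem enorm_vectorField_le (H : Ham) (u : ℤ → ℂ) (j : ℤ) :
    ‖vectorField H u j‖ₑ ≤ majField H (fun j => ‖u j‖ₑ) j := by
  rw [vectorField, neg_mul, enorm_neg, enorm_I_mul, ← tsum_enorm_term_vectorField]
  exact enorm_tsum_le_tsum_enorm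

theorem tsum_dbar_eq (H : Ham) (u : ℤ → ℂ) (j : ℤ) :
    ∑' a, H a * (mpow u a.1 * pd (fun j => conj (u j)) a.2 j) = Complex.I * vectorField H u j := by
  rw [vectorField, ← mul_assoc]
  simp

theorem conj_mpow (u : ℤ → ℂ) (κ : MultiIndex) :
    conj (mpow u κ) = mpow (fun j => conj (u j)) κ := by
  simp only [mpow, Finsupp.prod, map_prod, map_pow]

theorem conj_pd (u : ℤ → ℂ) (κ : MultiIndex) (j : ℤ) :
    conj (pd u κ j) = pd (fun j => conj (u j)) κ j := by
  rw [pd, pd, map_mul, conj_mpow, Complex.conj_natCast]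

theorem term_d_eq {H : Ham} (hH : ∀ α β : MultiIndex, H (α, β) = conj (H (β, α)))
    (u : ℤ → ℂ) (j : ℤ) (a : MultiIndex × MultiIndex) :
    H a * (pd u a.1 j * mpow (fun j => conj (u j)) a.2)
      = conj (H a.swap * (mpow u a.swap.1 * pd (fun j => conj (u j)) a.swap.2 j)) := by
  rw [map_mul, map_mul, conj_mpow, conj_pd]
  simp only [Complex.conj_conj, Prod.swap]
  rw [← hH a.1 a.2]
  ring

theorem tsum_d_eq {H : Ham} (hH : ∀ α β : MultiIndex, H (α, β) = conj (H (β, α)))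
    (u : ℤ → ℂ) (j : ℤ) :
    ∑' a, H a * (pd u a.1 j * mpow (fun j => conj (u j)) a.2)
      = -Complex.I * conj (vectorField H u j) := by
  simp_rw [term_d_eq hH]
  refine ((Equiv.prodComm MultiIndex MultiIndex).tsum_eq (fun a => conj (H a * (mpow u a.1 *
    pd (fun j => conj (u j)) a.2 j)))).trans ?_
  rw [← Complex.conj_tsum, tsum_dbar_eq, map_mul, Complex.conj_I]

theorem tsum_enorm_term_d {H : Ham} (hH : ∀ α β : MultiIndex, H (α, β) = conj (H (β, α)))
    (u : ℤ → ℂ) (j : ℤ) :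
    ∑' a, ‖H a * (pd u a.1 j * mpow (fun j => conj (u j)) a.2)‖ₑ
      = majField H (fun j => ‖u j‖ₑ) j := by
  simp_rw [term_d_eq hH, enorm_conj]
  refine ((Equiv.prodComm MultiIndex MultiIndex).tsum_eq (fun a => ‖H a * (mpow u a.1 *
    pd (fun j => conj (u j)) a.2 j)‖ₑ)).trans ?_
  rw [tsum_enorm_term_vectorField]

theorem majField_ne_top {w : Weight} {H : Ham} {x : ℤ → ℝ≥0∞} (h : wnorm w (majField H x) ≠ ⊤)
    (j : ℤ) : majField H x j ≠ ⊤ := by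
  intro hj
  have := le_wnorm w (majField H x) j
  rw [hj, ENNReal.mul_top (by simpa using w.pos j)] at this
  exact h (top_le_iff.mp this)

/-- The differential of a Hamiltonian in terms of its vector field. -/
theorem tsum_mul_dmono {w : Weight} (hw : ∀ j, 1 ≤ w.toFun j) {H : Ham}
    (hH : ∀ α β : MultiIndex, H (α, β) = conj (H (β, α))) {u v : ℤ → ℂ}
    (hv : wnorm w (fun j => ‖v j‖ₑ) ≠ ⊤) (hu : wnorm w (majField H fun j => ‖u j‖ₑ) ≠ ⊤) :
    ∑' a, H a * dmono u v a = pairing (vectorField H u) v := by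
  have hterm : ∀ a, H a * dmono u v a
      = ∑' j, (v j * (H a * (pd u a.1 j * mpow (fun j => conj (u j)) a.2))
        + conj (v j) * (H a * (mpow u a.1 * pd (fun j => conj (u j)) a.2 j))) := by
    intro a
    have s1 := ((summable_dpow u v a.1).mul_left (H a * mpow (fun j => conj (u j)) a.2))
    have s2 := ((summable_dpow (fun j => conj (u j)) (fun j => conj (v j)) a.2).mul_left
      (H a * mpow u a.1))
    rw [dmono, dpow, dpow, mul_add, mul_comm (∑' j, v j * pd u a.1 j), ← mul_assoc, ← mul_assoc,
      ← tsum_mul_left, ← tsum_mul_left, ← s1.tsum_add s2]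
    exact tsum_congr fun j => by ring
  have hfin : ∑' a, ∑' j, ‖v j * (H a * (pd u a.1 j * mpow (fun j => conj (u j)) a.2))
        + conj (v j) * (H a * (mpow u a.1 * pd (fun j => conj (u j)) a.2 j))‖ₑ ≠ ⊤ := by
    have : 2 * (wnorm w (fun j => ‖v j‖ₑ) * wnorm w (majField H fun j => ‖u j‖ₑ)) ≠ ⊤ :=
      ENNReal.mul_ne_top ENNReal.ofNat_ne_top (ENNReal.mul_ne_top hv hu)
    refine ne_top_of_le_ne_top this ?_
    rw [ENNReal.tsum_comm]
    calc _ ≤ ∑' j, 2 * (‖v j‖ₑ * majField H (fun j => ‖u j‖ₑ) j) := by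
          refine ENNReal.tsum_le_tsum fun j => ?_
          refine (ENNReal.tsum_le_tsum fun a => enorm_add_le _ _).trans ?_
          rw [ENNReal.tsum_add]
          simp only [enorm_mul (v j), enorm_mul (conj (v j)), enorm_conj (v j)]
          rw [ENNReal.tsum_mul_left, ENNReal.tsum_mul_left, tsum_enorm_term_d hH,
            tsum_enorm_term_vectorField, two_mul]
      _ ≤ _ := by
          rw [ENNReal.tsum_mul_left]
          gcongr
          exact tsum_mul_le_wnorm w hw _ _
  rw [tsum_congr hterm, tsum_comm_of_enorm hfin, pairing, ← tsum_mul_left]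
  refine tsum_congr fun j => ?_
  have s1 : Summable fun a => H a * (pd u a.1 j * mpow (fun j => conj (u j)) a.2) :=
    summable_of_tsum_enorm_ne_top (by rw [tsum_enorm_term_d hH]; exact majField_ne_top hu j)
  have s2 : Summable fun a => H a * (mpow u a.1 * pd (fun j => conj (u j)) a.2 j) :=
    summable_of_tsum_enorm_ne_top
      (by rw [tsum_enorm_term_vectorField]; exact majField_ne_top hu j)
  rw [(s1.mul_left _).tsum_add (s2.mul_left _), tsum_mul_left, tsum_mul_left, tsum_d_eq hH,
    tsum_dbar_eq]
  ring

/-- The value of a Poisson bracket. -/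
theorem eval_bracket {w : Weight} (hw : ∀ j, 1 ≤ w.toFun j) {F S : Ham}
    (hF : ∀ α β : MultiIndex, F (α, β) = conj (F (β, α)))
    (hS : ∀ α β : MultiIndex, S (α, β) = conj (S (β, α))) {u : ℤ → ℂ}
    (huF : wnorm w (majField F fun j => ‖u j‖ₑ) ≠ ⊤)
    (huS : wnorm w (majField S fun j => ‖u j‖ₑ) ≠ ⊤) :
    Ham.eval (bracket F S) u = pairing (vectorField F u) (vectorField S u) := by
  set A : Ham → ℤ → MultiIndex × MultiIndex → ℂ :=
    fun H j a => H a * (pd u a.1 j * mpow (fun j => conj (u j)) a.2) with hA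
  set B : Ham → ℤ → MultiIndex × MultiIndex → ℂ :=
    fun H j a => H a * (mpow u a.1 * pd (fun j => conj (u j)) a.2 j) with hB
  -- For fixed `j` the bracket is `-i (∂_u F ∂_ū S - ∂_ū F ∂_u S)`; summing over `a` and `b` first,
  -- the double sums factor into products of components of the two fields.
  have hτ : ∀ a b j, bracketCoeff F S (a, b, j) * mono u (bracketIndex (a, b, j))
      = -Complex.I * (A F j a * B S j b - B F j a * A S j b) := by
    intro a b j
    have h1 := mpow_bracketIndex_left u a.1 b.1 j
    have h2 := mpow_bracketIndex_right (fun j => conj (u j)) a.2 b.2 j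
    have h3 := mpow_bracketIndex_right u a.1 b.1 j
    have h4 := mpow_bracketIndex_left (fun j => conj (u j)) a.2 b.2 j
    rw [mono_eq, bracketCoeff, bracketIndex, hA, hB]
    dsimp only
    calc _ = -Complex.I * (F a * S b) *
          (((a.1 j : ℂ) * mpow u (a.1 + b.1 - Finsupp.single j 1)) *
            ((b.2 j : ℂ) * mpow (fun j => conj (u j)) (a.2 + b.2 - Finsupp.single j 1))
          - ((b.1 j : ℂ) * mpow u (a.1 + b.1 - Finsupp.single j 1)) *
            ((a.2 j : ℂ) * mpow (fun j => conj (u j)) (a.2 + b.2 - Finsupp.single j 1))) := by ring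
      _ = _ := by rw [h1, h2, h3, h4]; ring
  have hAX : ∀ {H : Ham}, (∀ α β : MultiIndex, H (α, β) = conj (H (β, α))) → ∀ j,
      ∑' a, ‖A H j a‖ₑ = majField H (fun j => ‖u j‖ₑ) j := fun hH j => tsum_enorm_term_d hH u j
  have hBX : ∀ (H : Ham) j, ∑' a, ‖B H j a‖ₑ = majField H (fun j => ‖u j‖ₑ) j :=
    fun H j => tsum_enorm_term_vectorField H u j
  have hfin : ∑' p, ‖bracketCoeff F S p * mono u (bracketIndex p)‖ₑ ≠ ⊤ := by
    have : 2 * (wnorm w (majField F fun j => ‖u j‖ₑ) * wnorm w (majField S fun j => ‖u j‖ₑ)) ≠ ⊤ :=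
      ENNReal.mul_ne_top ENNReal.ofNat_ne_top (ENNReal.mul_ne_top huF huS)
    refine ne_top_of_le_ne_top this ?_
    rw [tsum_bracket_split (fun a b j => ‖bracketCoeff F S (a, b, j) *
      mono u (bracketIndex (a, b, j))‖ₑ)]
    calc _ ≤ ∑' j, 2 * (majField F (fun j => ‖u j‖ₑ) j * majField S (fun j => ‖u j‖ₑ) j) := by
          refine ENNReal.tsum_le_tsum fun j => ?_
          calc _ ≤ ∑' a, ∑' b, (‖A F j a‖ₑ * ‖B S j b‖ₑ + ‖B F j a‖ₑ * ‖A S j b‖ₑ) := by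
                refine ENNReal.tsum_le_tsum fun a => ENNReal.tsum_le_tsum fun b => ?_
                rw [hτ, neg_mul, enorm_neg, enorm_I_mul, ← enorm_mul, ← enorm_mul]
                exact enorm_sub_le
            _ = _ := by
                simp only [ENNReal.tsum_add, ENNReal.tsum_mul_left, ENNReal.tsum_mul_right]
                rw [hAX hF, hAX hS, hBX, hBX, two_mul]
      _ ≤ _ := by
          rw [ENNReal.tsum_mul_left]
          gcongr
          exact tsum_mul_le_wnorm w hw _ _
  have step1 : Ham.eval (bracket F S) u
      = ∑' p, bracketCoeff F S p * mono u (bracketIndex p) := by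
    have e : ∀ c, bracket F S c * mono u c = ∑' p, (if bracketIndex p = c then
        bracketCoeff F S p * mono u (bracketIndex p) else 0) := by
      intro c
      rw [bracket, ← tsum_mul_right]
      refine tsum_congr fun p => ?_
      split_ifs with h
      · rw [h]
      · rw [zero_mul]
    have e2 : ∀ c p, ‖(if bracketIndex p = c then
        bracketCoeff F S p * mono u (bracketIndex p) else 0)‖ₑ = if bracketIndex p = c then
        ‖bracketCoeff F S p * mono u (bracketIndex p)‖ₑ else 0 := by
      intro c p
      split_ifs <;> simp
    rw [Ham.eval, tsum_congr e, tsum_comm_of_enorm]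
    · exact tsum_congr fun p => by simp
    · rw [ENNReal.tsum_comm]
      simp only [e2]
      refine ne_top_of_le_ne_top hfin (le_of_eq (tsum_congr fun p => by simp))
  let e : ℤ × (MultiIndex × MultiIndex) × (MultiIndex × MultiIndex) ≃
      (MultiIndex × MultiIndex) × (MultiIndex × MultiIndex) × ℤ :=
    ⟨fun q => (q.2.1, q.2.2, q.1), fun p => (p.2.2, p.1, p.2.1), fun _ => rfl, fun _ => rfl⟩
  have hfin' : ∑' q, ‖bracketCoeff F S (e q) * mono u (bracketIndex (e q))‖ₑ ≠ ⊤ := by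
    rwa [e.tsum_eq (fun p => ‖bracketCoeff F S p * mono u (bracketIndex p)‖ₑ)]
  rw [step1, ← e.tsum_eq, tsum_prod_of_enorm hfin', pairing, ← tsum_mul_left]
  refine tsum_congr fun j => ?_
  have sA : ∀ {H : Ham}, (∀ α β : MultiIndex, H (α, β) = conj (H (β, α))) →
      wnorm w (majField H fun j => ‖u j‖ₑ) ≠ ⊤ → Summable fun a => ‖A H j a‖ := fun hH hu =>
    tsum_enorm_ne_top_iff.mp (by rw [hAX hH]; exact majField_ne_top hu j)
  have sB : ∀ {H : Ham}, wnorm w (majField H fun j => ‖u j‖ₑ) ≠ ⊤ →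
      Summable fun a => ‖B H j a‖ := fun hu =>
    tsum_enorm_ne_top_iff.mp (by rw [hBX]; exact majField_ne_top hu j)
  have e3 : ∀ q : (MultiIndex × MultiIndex) × (MultiIndex × MultiIndex),
      bracketCoeff F S (e (j, q)) * mono u (bracketIndex (e (j, q)))
      = -Complex.I * (A F j q.1 * B S j q.2 - B F j q.1 * A S j q.2) := fun q => hτ q.1 q.2 j
  have s1 := summable_mul_of_summable_norm (sA hF huF) (sB huS)
  have s2 := summable_mul_of_summable_norm (sB huF) (sA hS huS)
  rw [tsum_congr e3, tsum_mul_left, s1.tsum_sub s2,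
    ← tsum_mul_tsum_of_summable_norm (sA hF huF) (sB huS),
    ← tsum_mul_tsum_of_summable_norm (sB huF) (sA hS huS)]
  rw [show ∑' a, A F j a = _ from tsum_d_eq hF u j, show ∑' a, A S j a = _ from tsum_d_eq hS u j,
    show ∑' a, B F j a = _ from tsum_dbar_eq F u j, show ∑' a, B S j a = _ from tsum_dbar_eq S u j]
  linear_combination (-Complex.I * (conj (vectorField F u j) * vectorField S u j
    - vectorField F u j * conj (vectorField S u j))) * (-Complex.I_sq)

/-- Integration of the differential of a Hamiltonian along a curve. -/
theorem eval_sub_eval_eq_integral {w : Weight} (hw : ∀ j, 1 ≤ w.toFun j) {F : Ham}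
    (hF : ∀ α β : MultiIndex, F (α, β) = conj (F (β, α)))
    (hd : ∀ a, F a ≠ 0 → 1 ≤ totalDegree a) {r T : ℝ} (hr : 0 ≤ r) (hT : 0 ≤ T)
    (hfin : fieldSup r w F ≠ ⊤) {Γ v : ℝ → HSpace w} (hv : Continuous v)
    (hΓ : ∀ t, HasDerivAt Γ (v t) t) (hball : ∀ t ∈ Set.Icc 0 T, ‖Γ t‖ ≤ r) :
    IntervalIntegrable (fun t => pairing (vectorField F (Γ t)) (v t)) MeasureTheory.volume 0 T ∧
    F.eval (Γ T) - F.eval (Γ 0) = ∫ t in (0 : ℝ)..T, pairing (vectorField F (Γ t)) (v t) := by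
  have hco : ∀ j t, HasDerivAt (fun s => (Γ s) j) ((v t) j) t := fun j t =>
    (HSpace.coordCLM hw j).hasFDerivAt.comp_hasDerivAt t (hΓ t)
  have hΓc : ∀ j, Continuous fun t => (Γ t) j := fun j =>
    continuous_iff_continuousAt.mpr fun t => (hco j t).continuousAt
  have hvc : ∀ j, Continuous fun t => (v t) j := fun j =>
    (HSpace.coordCLM hw j).continuous.comp hv
  have hmf : ∀ t ∈ Set.Icc 0 T, wnorm w (majField F fun j => ‖(Γ t) j‖ₑ) ≤ fieldSup r w F :=
    fun t ht => le_fieldSup F (((Γ t).norm_le_iff hr).mp (hball t ht))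
  have hsum : ∀ t ∈ Set.Icc 0 T, Summable fun a => F a * mono (Γ t) a := fun t ht =>
    summable_of_tsum_enorm_ne_top (ne_top_of_le_ne_top
      (ENNReal.mul_ne_top ENNReal.ofNat_ne_top (ENNReal.mul_ne_top ENNReal.ofReal_ne_top hfin))
      (tsum_enorm_eval_le_fieldSup hw hF hd hr (hball t ht)))
  obtain ⟨V, hV⟩ := isCompact_Icc.exists_bound_of_continuousOn (s := Set.Icc 0 T) hv.continuousOn
  have key := tsum_sub_tsum_eq_integral hT (f := fun a t => F a * mono (Γ t) a)
    (f' := fun a t => F a * dmono (Γ t) (v t) a)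
    (fun a t => (hasDerivAt_mono (fun j => hco j t) a).const_mul (F a))
    (fun a => continuous_const.mul (continuous_dmono hΓc hvc a))
    (B := 2 * (ENNReal.ofReal V * fieldSup r w F))
    (ENNReal.mul_ne_top ENNReal.ofNat_ne_top (ENNReal.mul_ne_top ENNReal.ofReal_ne_top hfin))
    (by
      intro t ht
      refine (tsum_enorm_dmono_le hw hF _ _).trans ?_
      gcongr
      · have h := hV t ht
        rwa [(v t).norm_le_iff ((norm_nonneg _).trans h)] at h
      · exact hmf t ht)
    (hsum 0 ⟨le_rfl, hT⟩) (hsum T ⟨hT, le_rfl⟩)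
  have he : ∀ t ∈ Set.Icc 0 T, ∑' a, F a * dmono (Γ t) (v t) a
      = pairing (vectorField F (Γ t)) (v t) := fun t ht =>
    tsum_mul_dmono hw hF (v t).wnorm_ne_top (ne_top_of_le_ne_top hfin (hmf t ht))
  have hu : ∀ t ∈ Set.uIoc 0 T, t ∈ Set.Icc 0 T := fun t ht => by
    rw [Set.uIoc_of_le hT] at ht; exact ⟨ht.1.le, ht.2⟩
  refine ⟨key.1.congr fun t ht => he t (hu t ht), ?_⟩
  rw [Ham.eval, Ham.eval, key.2]
  refine intervalIntegral.integral_congr fun t ht => he t ?_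
  rwa [Set.uIcc_of_le hT] at ht

/-! ### Vector fields of homogeneous Hamiltonians as multilinear maps -/

/-- The list `L` does not depend on `R`, so the same ordering of the factors serves for values in
`ℂ` and for majorants in `[0, ∞]`. -/
theorem exists_factorization (n : ℕ) : ∀ b : MultiIndex × MultiIndex, totalDegree b = n →
    ∃ L : Fin n → ℤ × Bool, ∀ (R : Type) [CommSemiring R] (x y : ℤ → R),
      ∏ l, (if (L l).2 then x (L l).1 else y (L l).1) = mpow x b.1 * mpow y b.2 := by
  induction n with
  | zero =>
    intro b hb
    have h1 : b.1 = 0 := by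
      ext i
      by_contra hi
      have h2 : b.1 i ≤ b.1.sum fun _ n => n :=
        Finset.single_le_sum (f := fun i => b.1 i) (fun _ _ => Nat.zero_le _)
          (Finsupp.mem_support_iff.mpr hi)
      have : b.1 i ≠ 0 := hi
      unfold totalDegree at hb
      omega
    have h2 : b.2 = 0 := by
      ext i
      by_contra hi
      have h2 : b.2 i ≤ b.2.sum fun _ n => n :=
        Finset.single_le_sum (f := fun i => b.2 i) (fun _ _ => Nat.zero_le _)
          (Finsupp.mem_support_iff.mpr hi)
      have : b.2 i ≠ 0 := hi
      unfold totalDegree at hb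
      omega
    exact ⟨Fin.elim0, fun R _ x y => by simp [h1, h2]⟩
  | succ n ih =>
    intro b hb
    have hsplit : ∀ (κ : MultiIndex) (i : ℤ), κ i ≠ 0 →
        ((κ - Finsupp.single i 1).sum fun _ n => n) + 1 = κ.sum fun _ n => n := by
      intro κ i hi
      have := congrArg (fun κ : MultiIndex => κ.sum fun _ n => n) (sub_single_add_single hi)
      beta_reduce at this
      rwa [Finsupp.sum_add_index' (fun _ => rfl) (fun _ _ _ => rfl),
        Finsupp.sum_single_index rfl] at this
    by_cases h : b.1 = 0
    · have h2 : b.2 ≠ 0 := by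
        intro h2
        simp [totalDegree, h, h2] at hb
      obtain ⟨i, hi⟩ := Finsupp.ne_iff.mp h2
      have hi' : b.2 i ≠ 0 := hi
      obtain ⟨L, hL⟩ := ih (b.1, b.2 - Finsupp.single i 1) (by
        have := hsplit b.2 i hi'
        unfold totalDegree at hb ⊢
        simp only
        omega)
      refine ⟨Fin.cons (i, false) L, fun R _ x y => ?_⟩
      rw [Fin.prod_univ_succ]
      simp only [Fin.cons_zero, Fin.cons_succ]
      rw [hL R x y]
      conv_rhs => rw [← sub_single_add_single hi', mpow_add, mpow_single, pow_one]
      simp only [Bool.false_eq_true, if_false]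
      ring
    · obtain ⟨i, hi⟩ := Finsupp.ne_iff.mp h
      have hi' : b.1 i ≠ 0 := hi
      obtain ⟨L, hL⟩ := ih (b.1 - Finsupp.single i 1, b.2) (by
        have := hsplit b.1 i hi'
        unfold totalDegree at hb ⊢
        simp only
        omega)
      refine ⟨Fin.cons (i, true) L, fun R _ x y => ?_⟩
      rw [Fin.prod_univ_succ]
      simp only [Fin.cons_zero, Fin.cons_succ]
      rw [hL R x y]
      conv_rhs => rw [← sub_single_add_single hi', mpow_add, mpow_single, pow_one]
      simp only [if_true]
      ring

open Classical in
/-- An ordering of the factors of the monomial `u^α ū^β` of degree `n`. -/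
def factorization (n : ℕ) (b : MultiIndex × MultiIndex) : Fin n → ℤ × Bool :=
  if h : totalDegree b = n then (exists_factorization n b h).choose else fun _ => (0, true)

theorem prod_factorization {n : ℕ} {b : MultiIndex × MultiIndex} (h : totalDegree b = n)
    {R : Type} [CommSemiring R] (x y : ℤ → R) :
    ∏ l, (if (factorization n b l).2 then x (factorization n b l).1
      else y (factorization n b l).1) = mpow x b.1 * mpow y b.2 := by
  rw [factorization, dif_pos h]
  exact (exists_factorization n b h).choose_spec R x y

/-- The coordinates `u_i` and `ū_i`. -/
def signedCoord {w : Weight} (k : ℤ × Bool) : HSpace w →ₗ[ℝ] ℂ where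
  toFun u := if k.2 then u k.1 else conj (u k.1)
  map_add' u v := by
    simp only [HSpace.coords_add, map_add]
    split_ifs <;> rfl
  map_smul' c u := by
    simp only [HSpace.coords_real_smul, map_mul, Complex.conj_ofReal, RingHom.id_apply,
      Complex.real_smul]
    split_ifs <;> rfl

theorem enorm_signedCoord {w : Weight} (k : ℤ × Bool) (u : HSpace w) :
    ‖signedCoord k u‖ₑ = ‖u k.1‖ₑ := by
  change ‖(if k.2 then u k.1 else conj (u k.1))‖ₑ = _
  split_ifs
  · rfl
  · exact enorm_conj _

/-- The multilinear form on `h_w` with the factors of a monomial of degree `n`. -/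
def factorForm {w : Weight} (n : ℕ) (b : MultiIndex × MultiIndex) :
    MultilinearMap ℝ (fun _ : Fin n => HSpace w) ℂ :=
  (MultilinearMap.mkPiAlgebra ℝ (Fin n) ℂ).compLinearMap fun l => signedCoord (factorization n b l)

theorem factorForm_apply {w : Weight} (n : ℕ) (b : MultiIndex × MultiIndex)
    (us : Fin n → HSpace w) :
    factorForm n b us = ∏ l, signedCoord (factorization n b l) (us l) := rfl

theorem factorForm_diag {w : Weight} {n : ℕ} {b : MultiIndex × MultiIndex}
    (h : totalDegree b = n) (u : HSpace w) : factorForm n b (fun _ => u) = mono u b :=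
  prod_factorization h u.coords fun j => conj (u j)

/-- Each factor is at most the sum of the moduli of all arguments, so the form is dominated by the
monomial at one single point. No symmetrization of the form is required. -/
theorem enorm_factorForm_le {w : Weight} {n : ℕ} {b : MultiIndex × MultiIndex}
    (h : totalDegree b = n) (us : Fin n → HSpace w) :
    ‖factorForm n b us‖ₑ ≤ mpow (fun j => ∑ l, ‖us l j‖ₑ) (b.1 + b.2) := by
  have hp : ‖factorForm n b us‖ₑ = ∏ l, ‖us l (factorization n b l).1‖ₑ := by
    rw [factorForm_apply]
    have e : ∀ z : ℂ, ‖z‖ₑ = ((‖z‖₊ : NNReal) : ℝ≥0∞) := fun _ => rfl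
    rw [e, nnnorm_prod, ENNReal.ofNNReal_finsetProd]
    exact Finset.prod_congr rfl fun l _ => enorm_signedCoord _ _
  have h2 := prod_factorization h (fun j => ∑ l, ‖us l j‖ₑ) (fun j => ∑ l, ‖us l j‖ₑ)
  simp only [ite_self] at h2
  rw [hp, mpow_add, ← h2]
  exact Finset.prod_le_prod' fun l _ =>
    Finset.single_le_sum (f := fun l' => ‖us l' (factorization n b l).1‖ₑ) (fun _ _ => by simp)
      (Finset.mem_univ l)

/-- The exponents `(α, β - e_j)`. -/
def lowerIndex (a : MultiIndex × MultiIndex) (j : ℤ) : MultiIndex × MultiIndex :=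
  (a.1, a.2 - Finsupp.single j 1)

theorem totalDegree_lowerIndex {a : MultiIndex × MultiIndex} {j : ℤ} (h : a.2 j ≠ 0) :
    totalDegree (lowerIndex a j) + 1 = totalDegree a := by
  rw [← restIndex_sum h, totalDegree_eq_sum]
  rfl

section Homogeneous

variable {w : Weight} {S : Ham} {n : ℕ}

/-- By homogeneity, finiteness on one ball implies finiteness at every point of finite norm. -/
theorem wnorm_majField_ne_top (hS : ∀ a, S a ≠ 0 → totalDegree a = n + 1) {r : ℝ} (hr : 0 < r)
    (hfin : fieldSup r w S ≠ ⊤) {x : ℤ → ℝ≥0∞} (hx : wnorm w x ≠ ⊤) :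
    wnorm w (majField S x) ≠ ⊤ := by
  obtain ⟨θ, hθ, hle⟩ : ∃ θ : ℝ, 0 < θ ∧ wnorm w x ≤ ENNReal.ofReal (θ * r) := by
    refine ⟨((wnorm w x).toReal + 1) / r, by positivity, ?_⟩
    rw [div_mul_cancel₀ _ hr.ne']
    refine (ENNReal.ofReal_toReal hx).symm.le.trans (ENNReal.ofReal_le_ofReal ?_)
    linarith
  have hx' := wnorm_div_le hθ hle
  have e : x = fun j => ENNReal.ofReal θ * (ENNReal.ofReal θ⁻¹ * x j) := by
    funext j; rw [ofReal_mul_ofReal_inv_mul hθ]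
  rw [e, show majField S (fun j => ENNReal.ofReal θ * (ENNReal.ofReal θ⁻¹ * x j))
    = fun j => ENNReal.ofReal θ ^ n * majField S (fun j => ENNReal.ofReal θ⁻¹ * x j) j from
    funext fun j => majField_smul_eq hS _ _ j, wnorm_smul]
  exact ENNReal.mul_ne_top (ENNReal.pow_ne_top ENNReal.ofReal_ne_top)
    (ne_top_of_le_ne_top hfin (le_fieldSup S hx'))

theorem fieldSup_ne_top (hS : ∀ a, S a ≠ 0 → totalDegree a = n + 1) {r : ℝ} (hr : 0 < r)
    (hfin : fieldSup r w S ≠ ⊤) (r' : ℝ) : fieldSup r' w S ≠ ⊤ := by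
  set θ := max (r' / r) 1 with hθ
  have hθ0 : 0 < θ := lt_max_of_lt_right one_pos
  have hle : r' ≤ θ * r := by
    rw [← div_le_iff₀ hr]; exact le_max_left _ _
  refine ne_top_of_le_ne_top (ENNReal.mul_ne_top
    (ENNReal.pow_ne_top ENNReal.ofReal_ne_top : ENNReal.ofReal θ ^ n ≠ ⊤) hfin)
    (iSup₂_le fun x hx => ?_)
  have hx' := wnorm_div_le hθ0 (hx.trans (ENNReal.ofReal_le_ofReal hle))
  have e : x = fun j => ENNReal.ofReal θ * (ENNReal.ofReal θ⁻¹ * x j) := by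
    funext j; rw [ofReal_mul_ofReal_inv_mul hθ0]
  conv_lhs => rw [e]
  rw [show majField S (fun j => ENNReal.ofReal θ * (ENNReal.ofReal θ⁻¹ * x j))
    = fun j => ENNReal.ofReal θ ^ n * majField S (fun j => ENNReal.ofReal θ⁻¹ * x j) j from
    funext fun j => majField_smul_eq hS _ _ j, wnorm_smul]
  gcongr
  exact le_fieldSup S hx'

/-- The polarized vector field. -/
def polarField (S : Ham) (n : ℕ) (us : Fin n → HSpace w) (j : ℤ) : ℂ :=
  -Complex.I * ∑' a, S a * ((a.2 j : ℂ) * factorForm n (lowerIndex a j) us)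

theorem tsum_enorm_polar_le (hS : ∀ a, S a ≠ 0 → totalDegree a = n + 1)
    (us : Fin n → HSpace w) (j : ℤ) :
    ∑' a, ‖S a * ((a.2 j : ℂ) * factorForm n (lowerIndex a j) us)‖ₑ
      ≤ majField S (fun j => ∑ l, ‖us l j‖ₑ) j := by
  refine ENNReal.tsum_le_tsum fun a => ?_
  rw [enorm_mul, enorm_mul, enorm_natCast]
  by_cases ha : S a = 0
  · simp [ha]
  by_cases hj : a.2 j = 0
  · simp [hj]
  have h1 := totalDegree_lowerIndex hj
  have h2 := hS a ha
  gcongr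
  exact enorm_factorForm_le (by omega) us

theorem wnorm_sum_ne_top (us : Fin n → HSpace w) :
    wnorm w (fun j => ∑ l, ‖us l j‖ₑ) ≠ ⊤ :=
  ne_top_of_le_ne_top (ENNReal.sum_ne_top.mpr fun l _ => (us l).wnorm_ne_top)
    (wnorm_sum_le w Finset.univ fun l j => ‖us l j‖ₑ)

theorem wnorm_polarField_le (hS : ∀ a, S a ≠ 0 → totalDegree a = n + 1) (us : Fin n → HSpace w) :
    wnorm w (fun j => ‖polarField S n us j‖ₑ)
      ≤ wnorm w (majField S fun j => ∑ l, ‖us l j‖ₑ) := by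
  refine wnorm_mono w fun j => ?_
  rw [polarField, neg_mul, enorm_neg, enorm_I_mul]
  exact enorm_tsum_le_tsum_enorm.trans (tsum_enorm_polar_le hS us j)

theorem summable_polar (hS : ∀ a, S a ≠ 0 → totalDegree a = n + 1) {r : ℝ} (hr : 0 < r)
    (hfin : fieldSup r w S ≠ ⊤) (us : Fin n → HSpace w) (j : ℤ) :
    Summable fun a => S a * ((a.2 j : ℂ) * factorForm n (lowerIndex a j) us) :=
  summable_of_tsum_enorm_ne_top (ne_top_of_le_ne_top
    (majField_ne_top (wnorm_majField_ne_top hS hr hfin (wnorm_sum_ne_top us)) j)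
    (tsum_enorm_polar_le hS us j))

theorem polarField_diag (hS : ∀ a, S a ≠ 0 → totalDegree a = n + 1) (u : HSpace w) (j : ℤ) :
    polarField S n (fun _ => u) j = vectorField S u j := by
  rw [polarField, vectorField]
  congr 1
  refine tsum_congr fun a => ?_
  by_cases ha : S a = 0
  · simp [ha]
  by_cases hj : a.2 j = 0
  · simp [hj, pd]
  have h1 := totalDegree_lowerIndex hj
  have h2 := hS a ha
  rw [factorForm_diag (by omega), mono_eq, lowerIndex, pd]
  ring

/-- The vector field of a homogeneous Hamiltonian as a multilinear map. -/
def polarMap (hw : ∀ j, 1 ≤ w.toFun j) (hS : ∀ a, S a ≠ 0 → totalDegree a = n + 1) {r : ℝ}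
    (hr : 0 < r) (hfin : fieldSup r w S ≠ ⊤) :
    MultilinearMap ℝ (fun _ : Fin n => HSpace w) (HSpace w) where
  toFun us := HSpace.mk hw (polarField S n us) (ne_top_of_le_ne_top
    (wnorm_majField_ne_top hS hr hfin (wnorm_sum_ne_top us)) (wnorm_polarField_le hS us))
  map_update_add' us l x y := by
    refine HSpace.ext fun j => ?_
    rw [HSpace.coords_add]
    change polarField S n _ j = polarField S n _ j + polarField S n _ j
    rw [polarField, polarField, polarField, ← mul_add,
      ← (summable_polar hS hr hfin _ j).tsum_add (summable_polar hS hr hfin _ j)]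
    congr 1
    refine tsum_congr fun a => ?_
    rw [MultilinearMap.map_update_add]
    ring
  map_update_smul' us l c x := by
    refine HSpace.ext fun j => ?_
    rw [HSpace.coords_real_smul]
    change polarField S n _ j = c * polarField S n _ j
    rw [polarField, polarField, mul_left_comm (c : ℂ), ← tsum_mul_left (a := (c : ℂ))]
    congr 1
    refine tsum_congr fun a => ?_
    rw [MultilinearMap.map_update_smul, Complex.real_smul]
    ring

/-- Each argument is rescaled to norm `r / n`. The sum of the moduli then lies in the ball of radius
`r`, where the field is controlled. -/
theorem norm_polarMap_le (hw : ∀ j, 1 ≤ w.toFun j)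
    (hS : ∀ a, S a ≠ 0 → totalDegree a = n + 1) {r : ℝ} (hr : 0 < r)
    (hfin : fieldSup r w S ≠ ⊤) (hn : 1 ≤ n) (us : Fin n → HSpace w) :
    ‖polarMap hw hS hr hfin us‖ ≤ (n / r) ^ n * (fieldSup r w S).toReal * ∏ l, ‖us l‖ := by
  have hn0 : (0 : ℝ) < n := by exact_mod_cast hn
  have hunit : ∀ vs : Fin n → HSpace w, (∀ l, ‖vs l‖ ≤ r / n) →
      ‖polarMap hw hS hr hfin vs‖ ≤ (fieldSup r w S).toReal := by
    intro vs hvs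
    rw [HSpace.norm_le_iff _ ENNReal.toReal_nonneg, ENNReal.ofReal_toReal hfin]
    refine (wnorm_polarField_le hS vs).trans (le_fieldSup S ?_)
    refine (wnorm_sum_le w Finset.univ fun l j => ‖vs l j‖ₑ).trans ?_
    calc ∑ l, wnorm w (fun j => ‖vs l j‖ₑ) ≤ ∑ _l : Fin n, ENNReal.ofReal (r / n) :=
          Finset.sum_le_sum fun l _ => ((vs l).norm_le_iff (by positivity)).mp (hvs l)
      _ = ENNReal.ofReal r := by
          rw [Finset.sum_const, Finset.card_univ, Fintype.card_fin, nsmul_eq_mul,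
            ← ENNReal.ofReal_natCast, ← ENNReal.ofReal_mul hn0.le, mul_div_cancel₀ _ hn0.ne']
  by_cases h0 : ∃ l, us l = 0
  · obtain ⟨l, hl⟩ := h0
    rw [(polarMap hw hS hr hfin).map_coord_zero l hl, norm_zero]
    positivity
  push Not at h0
  set vs : Fin n → HSpace w := fun l => (r / (n * ‖us l‖)) • us l with hvs
  have e : us = fun l => (n * ‖us l‖ / r) • vs l := by
    funext l
    have : ‖us l‖ ≠ 0 := norm_ne_zero_iff.mpr (h0 l)
    rw [hvs, smul_smul]
    rw [show (n * ‖us l‖ / r) * (r / (n * ‖us l‖)) = 1 by field_simp, one_smul]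
  have hv : ∀ l, ‖vs l‖ ≤ r / n := by
    intro l
    have : ‖us l‖ ≠ 0 := norm_ne_zero_iff.mpr (h0 l)
    rw [hvs, norm_smul, Real.norm_of_nonneg (by positivity)]
    exact le_of_eq (by field_simp)
  have hprod : ∏ l, (n * ‖us l‖ / r) = (n / r) ^ n * ∏ l, ‖us l‖ := by
    rw [Finset.prod_congr rfl fun l _ => show n * ‖us l‖ / r = n / r * ‖us l‖ by ring,
      Finset.prod_mul_distrib, Finset.prod_const, Finset.card_univ, Fintype.card_fin]
  conv_lhs => rw [e]
  rw [(polarMap hw hS hr hfin).map_smul_univ, norm_smul, hprod,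
    Real.norm_of_nonneg (by positivity)]
  have := hunit vs hv
  calc (n / r) ^ n * (∏ l, ‖us l‖) * ‖polarMap hw hS hr hfin vs‖
      ≤ (n / r) ^ n * (∏ l, ‖us l‖) * (fieldSup r w S).toReal := by gcongr
    _ = _ := by ring

/-! ### The symplectic form -/

theorem summable_symplectic (hw : ∀ j, 1 ≤ w.toFun j) (ξ η : HSpace w) :
    Summable fun j => ξ j * conj (η j) := by
  refine summable_of_tsum_enorm_ne_top (ne_top_of_le_ne_top
    (ENNReal.mul_ne_top ξ.wnorm_ne_top η.wnorm_ne_top) ?_)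
  refine le_trans (le_of_eq (tsum_congr fun j => ?_)) (tsum_mul_le_wnorm w hw _ _)
  rw [enorm_mul, enorm_conj]

theorem summable_symplectic' (hw : ∀ j, 1 ≤ w.toFun j) (ξ η : HSpace w) :
    Summable fun j => conj (ξ j) * η j := by
  simpa only [mul_comm] using summable_symplectic hw η ξ

theorem norm_symplecticForm_le (hw : ∀ j, 1 ≤ w.toFun j) (ξ η : HSpace w) :
    ‖symplecticForm ξ η‖ ≤ 2 * ‖ξ‖ * ‖η‖ := by
  have h : ‖symplecticForm ξ η‖ₑ ≤ 2 * (‖ξ‖ₑ * ‖η‖ₑ) := by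
    rw [symplecticForm, enorm_I_mul, ξ.enorm_eq, η.enorm_eq]
    refine enorm_tsum_le_tsum_enorm.trans ?_
    calc _ ≤ ∑' j, 2 * (‖ξ j‖ₑ * ‖η j‖ₑ) := by
          refine ENNReal.tsum_le_tsum fun j => enorm_sub_le.trans (le_of_eq ?_)
          rw [enorm_mul, enorm_mul, enorm_conj, enorm_conj, two_mul]
      _ ≤ _ := by
          rw [ENNReal.tsum_mul_left]
          gcongr
          exact tsum_mul_le_wnorm w hw _ _
  have h2 := ENNReal.toReal_mono (ENNReal.mul_ne_top ENNReal.ofNat_ne_top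
    (ENNReal.mul_ne_top enorm_ne_top enorm_ne_top)) h
  simpa [mul_assoc] using h2

/-- The symplectic form as a continuous real bilinear map. -/
def symplecticCLM (hw : ∀ j, 1 ≤ w.toFun j) : HSpace w →L[ℝ] HSpace w →L[ℝ] ℂ :=
  LinearMap.mkContinuous₂
    (LinearMap.mk₂ ℝ (fun ξ η : HSpace w => symplecticForm ξ η)
      (fun ξ ξ' η => by
        have s1 := summable_symplectic hw ξ η
        have s2 := summable_symplectic hw ξ' η
        have s3 := summable_symplectic' hw ξ η
        have s4 := summable_symplectic' hw ξ' η
        rw [symplecticForm, symplecticForm, symplecticForm, ← mul_add,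
          ← (s1.sub s3).tsum_add (s2.sub s4)]
        congr 1
        refine tsum_congr fun j => ?_
        rw [HSpace.coords_add, map_add]
        ring)
      (fun c ξ η => by
        rw [symplecticForm, symplecticForm, Complex.real_smul, mul_left_comm (c : ℂ),
          ← tsum_mul_left (a := (c : ℂ))]
        congr 1
        refine tsum_congr fun j => ?_
        rw [HSpace.coords_real_smul, map_mul, Complex.conj_ofReal]
        ring)
      (fun ξ η η' => by
        have s1 := summable_symplectic hw ξ η
        have s2 := summable_symplectic hw ξ η'
        have s3 := summable_symplectic' hw ξ η
        have s4 := summable_symplectic' hw ξ η'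
        rw [symplecticForm, symplecticForm, symplecticForm, ← mul_add,
          ← (s1.sub s3).tsum_add (s2.sub s4)]
        congr 1
        refine tsum_congr fun j => ?_
        rw [HSpace.coords_add, map_add]
        ring)
      (fun c ξ η => by
        rw [symplecticForm, symplecticForm, Complex.real_smul, mul_left_comm (c : ℂ),
          ← tsum_mul_left (a := (c : ℂ))]
        congr 1
        refine tsum_congr fun j => ?_
        rw [HSpace.coords_real_smul, map_mul, Complex.conj_ofReal]
        ring))
    2 fun ξ η => norm_symplecticForm_le hw ξ η

theorem symplecticCLM_apply (hw : ∀ j, 1 ≤ w.toFun j) (ξ η : HSpace w) :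
    symplecticCLM hw ξ η = symplecticForm ξ η := rfl

theorem symplecticForm_swap (ξ η : HSpace w) : symplecticForm ξ η = -symplecticForm η ξ := by
  rw [symplecticForm, symplecticForm, ← mul_neg, ← tsum_neg]
  congr 1
  refine tsum_congr fun j => ?_
  ring

/-- The differential of a homogeneous Hamiltonian. -/
theorem hasFDerivAt_eval (hw : ∀ j, 1 ≤ w.toFun j)
    (hreal : ∀ α β : MultiIndex, S (α, β) = conj (S (β, α)))
    (hS : ∀ a, S a ≠ 0 → totalDegree a = n + 1) {r : ℝ} (hr : 0 < r)
    (hfin : fieldSup r w S ≠ ⊤) {X : HSpace w → HSpace w} (hX : Continuous X)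
    (hXS : ∀ u j, X u j = vectorField S u j) (u : HSpace w) :
    HasFDerivAt (fun u : HSpace w => S.eval u) (symplecticCLM hw (X u)) u := by
  -- The differential is known along curves. On the segment from `u` to `u + h` it gives an integral
  -- of `Ω (X, h)`, and continuity of `X` turns this into a Fréchet derivative.
  have hint : ∀ h : HSpace w, S.eval (HSpace.coords (u + h)) - S.eval u
      = ∫ t in (0 : ℝ)..1, symplecticCLM hw (X (u + t • h)) h := by
    intro h
    have h1 := (eval_sub_eval_eq_integral hw hreal (fun a ha => by rw [hS a ha]; omega)
      (r := ‖u‖ + ‖h‖) (T := 1) (by positivity) zero_le_one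
      (fieldSup_ne_top hS hr hfin _) (Γ := fun t => u + t • h) (v := fun _ => h)
      continuous_const (fun t => by
        simpa using ((hasDerivAt_id t).smul_const h).const_add u)
      (fun t ht => by
        refine (norm_add_le _ _).trans ?_
        rw [norm_smul, Real.norm_of_nonneg ht.1]
        gcongr
        exact mul_le_of_le_one_left (norm_nonneg _) ht.2)).2
    simp only [one_smul, zero_smul, add_zero] at h1
    rw [h1]
    refine intervalIntegral.integral_congr fun t _ => ?_
    rw [symplecticCLM_apply, symplecticForm, pairing]
    simp only [hXS]
  rw [hasFDerivAt_iff_isLittleO_nhds_zero, Asymptotics.isLittleO_iff]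
  intro c hc
  have hB : 0 < ‖symplecticCLM hw‖ + 1 := by positivity
  obtain ⟨δ, hδ, hball⟩ := Metric.continuousAt_iff.mp (hX.continuousAt (x := u))
    (c / (‖symplecticCLM hw‖ + 1)) (by positivity)
  rw [Metric.eventually_nhds_iff]
  refine ⟨δ, hδ, fun h hh => ?_⟩
  rw [dist_zero_right] at hh
  have hcont : Continuous fun t : ℝ => symplecticCLM hw (X (u + t • h)) h := by
    have : Continuous fun t : ℝ => symplecticCLM hw (X (u + t • h)) := by fun_prop
    exact this.clm_apply continuous_const
  have e : S.eval (HSpace.coords (u + h)) - S.eval u - symplecticCLM hw (X u) h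
      = ∫ t in (0 : ℝ)..1, symplecticCLM hw (X (u + t • h) - X u) h := by
    rw [hint]
    have : symplecticCLM hw (X u) h = ∫ t in (0 : ℝ)..1, symplecticCLM hw (X u) h := by simp
    rw [this, ← intervalIntegral.integral_sub (hcont.intervalIntegrable _ _)
      intervalIntegrable_const]
    refine intervalIntegral.integral_congr fun t _ => ?_
    simp
  rw [e]
  have hb := intervalIntegral.norm_integral_le_of_norm_le_const (a := 0) (b := 1)
    (f := fun t => symplecticCLM hw (X (u + t • h) - X u) h) (C := c * ‖h‖) (fun t ht => by
      rw [Set.uIoc_of_le zero_le_one] at ht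
      have h1 : dist (u + t • h) u < δ := by
        rw [dist_eq_norm, add_sub_cancel_left, norm_smul, Real.norm_of_nonneg ht.1.le]
        exact (mul_le_of_le_one_left (norm_nonneg _) ht.2).trans_lt hh
      have h2 := hball h1
      rw [dist_eq_norm, lt_div_iff₀ hB] at h2
      refine ((symplecticCLM hw).le_opNorm₂ _ _).trans ?_
      gcongr
      nlinarith [norm_nonneg (X (u + t • h) - X u)])
  simpa using hb

/-- The vector field of a Hamiltonian is infinitesimally symplectic. -/
theorem symplecticForm_fderiv (hw : ∀ j, 1 ≤ w.toFun j)
    (hreal : ∀ α β : MultiIndex, S (α, β) = conj (S (β, α)))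
    (hS : ∀ a, S a ≠ 0 → totalDegree a = n + 1) {r : ℝ} (hr : 0 < r)
    (hfin : fieldSup r w S ≠ ⊤) {X : HSpace w → HSpace w} (hX : Differentiable ℝ X)
    (hXS : ∀ u j, X u j = vectorField S u j) (u ξ η : HSpace w) :
    symplecticForm (fderiv ℝ X u ξ) η + symplecticForm ξ (fderiv ℝ X u η) = 0 := by
  have h1 := fun y => hasFDerivAt_eval hw hreal hS hr hfin hX.continuous hXS y
  have h2 : HasFDerivAt (fun y => symplecticCLM hw (X y))
      ((symplecticCLM hw).comp (fderiv ℝ X u)) u :=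
    (symplecticCLM hw).hasFDerivAt.comp u (hX u).hasFDerivAt
  -- The second derivative of `S` is `Ω (DX ξ, η)`, so this expression is symmetric in `ξ` and `η`.
  have h3 := second_derivative_symmetric h1 h2 ξ η
  simp only [ContinuousLinearMap.comp_apply, symplecticCLM_apply] at h3
  rw [h3, symplecticForm_swap ξ]
  ring

/-- The time-one flow of a homogeneous Hamiltonian. -/
theorem exists_hamiltonian_flow (hw : ∀ j, 1 ≤ w.toFun j)
    (hreal : ∀ α β : MultiIndex, S (α, β) = conj (S (β, α))) (hn : 1 ≤ n)
    (hS : ∀ a, S a ≠ 0 → totalDegree a = n + 1) {r A : ℝ} (hr : 0 < r) (hA : 0 ≤ A)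
    (hSA : fieldSup r w S ≤ ENNReal.ofReal A) {R : ℝ} (hR : 0 < R)
    (hsmall : (n / r) ^ n * A * n * R ^ (n - 1) ≤ 1 / 2) :
    ∃ (Φ : HSpace w → HSpace w) (Γ : HSpace w → ℝ → HSpace w),
      (∀ u, ‖u‖ < R / 2 → AnalyticAt ℝ Φ u ∧ ∀ ξ η,
        symplecticForm (fderiv ℝ Φ u ξ) (fderiv ℝ Φ u η) = symplecticForm ξ η) ∧
      ∀ u, ‖u‖ ≤ R / 2 → Γ u 0 = u ∧ Γ u 1 = Φ u ∧
        (∀ t ∈ Set.Icc (0 : ℝ) 1, ‖Γ u t‖ ≤ 2 * ‖u‖) ∧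
        ∃ v : ℝ → HSpace w, Continuous v ∧ (∀ t, HasDerivAt (Γ u) (v t) t) ∧
          ∀ t ∈ Set.Icc (0 : ℝ) 1, (∀ j, v t j = vectorField S (Γ u t) j) ∧
            ‖v t‖ ≤ (n / r) ^ n * A * ‖Γ u t‖ ^ n := by
  have hfin : fieldSup r w S ≠ ⊤ := ne_top_of_le_ne_top ENNReal.ofReal_ne_top hSA
  have hAr : (fieldSup r w S).toReal ≤ A := ENNReal.toReal_le_of_le_ofReal hA hSA
  have : CompleteSpace (HSpace w) := HSpace.completeSpace hw
  have hbound : ∀ us : Fin n → HSpace w, ‖polarMap hw hS hr hfin us‖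
      ≤ (n / r) ^ n * A * ∏ l, ‖us l‖ := fun us =>
    (norm_polarMap_le hw hS hr hfin hn us).trans (by gcongr)
  set M := (polarMap hw hS hr hfin).mkContinuous _ hbound with hM
  have hMn : ‖M‖ ≤ (n / r) ^ n * A := MultilinearMap.mkContinuous_norm_le _ (by positivity) _
  have hMS : ∀ (u : HSpace w) j, (M fun _ => u) j = vectorField S u j := fun u j =>
    polarField_diag hS u j
  obtain ⟨Φ, Γ, h1, h2, h3⟩ := exists_flow hn M hR ((by gcongr : ‖M‖ * n * R ^ (n - 1)
    ≤ (n / r) ^ n * A * n * R ^ (n - 1)).trans hsmall)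
  have hXd : Differentiable ℝ fun z : HSpace w => M fun _ => z :=
    (M.contDiff.comp (contDiff_pi.mpr fun _ => contDiff_id) :
      ContDiff ℝ ⊤ fun z : HSpace w => M fun _ => z).differentiable (by simp)
  refine ⟨Φ, Γ, fun u hu => ⟨h1 u hu, fun ξ η => ?_⟩, fun u hu => ?_⟩
  · obtain ⟨ξt, ξw, a0, a1, a2, a3⟩ := h3 u hu ξ
    obtain ⟨ηt, ηw, b0, b1, b2, b3⟩ := h3 u hu η
    have hd : ∀ t, HasDerivAt (fun t => symplecticCLM hw (ξt t) (ηt t))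
        (symplecticCLM hw (ξw t) (ηt t) + symplecticCLM hw (ξt t) (ηw t)) t := fun t =>
      ((symplecticCLM hw).hasFDerivAt.comp_hasDerivAt t (a2 t)).clm_apply (b2 t)
    -- Along two solutions of the linearized equation the form has zero derivative, because the
    -- vector field is infinitesimally symplectic.
    have hconst := constant_of_has_deriv_right_zero (a := 0) (b := 1)
      (f := fun t => symplecticCLM hw (ξt t) (ηt t))
      (fun t _ => (hd t).continuousAt.continuousWithinAt)
      (fun t ht => by
        have h := (hd t).hasDerivWithinAt (s := Set.Ici t)
        have ht' : t ∈ Set.Icc (0 : ℝ) 1 := ⟨ht.1, ht.2.le⟩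
        rw [a3 t ht', b3 t ht', symplecticCLM_apply, symplecticCLM_apply,
          symplecticForm_fderiv hw hreal hS hr hfin hXd hMS] at h
        exact h) 1 (by simp)
    beta_reduce at hconst
    rwa [a0, a1, b0, b1] at hconst
  · obtain ⟨c0, c1, c2, v, c3, c4, c5⟩ := h2 u hu
    refine ⟨c0, c1, c2, v, c3, c4, fun t ht => ⟨fun j => ?_, ?_⟩⟩
    · rw [c5 t ht, hMS]
    · rw [c5 t ht]
      refine (M.le_opNorm _).trans ?_
      rw [Finset.prod_const, Finset.card_univ, Fintype.card_fin]
      gcongr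

end Homogeneous

/-! ### Algebraic properties of the Poisson bracket -/

/-- Real, momentum preserving Hamiltonians of scaling degree at least `d`. -/
structure IsFormalHam (d : ℕ) (H : Ham) : Prop where
  reality : ∀ α β : MultiIndex, H (α, β) = conj (H (β, α))
  momentum_eq : ∀ a, H a ≠ 0 → momentum a = 0
  degree : ScalingDegreeGE d H

theorem IsFormalHam.of_le {d d' : ℕ} {H : Ham} (h : IsFormalHam d H) (hd : d' ≤ d) :
    IsFormalHam d' H :=
  ⟨h.reality, h.momentum_eq, fun a ha => le_trans (by omega) (h.degree a ha)⟩

theorem IsFormalHam.one_le {d : ℕ} {H : Ham} (h : IsFormalHam d H) (a : MultiIndex × MultiIndex)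
    (ha : H a ≠ 0) : 1 ≤ totalDegree a :=
  le_trans (by omega) (h.degree a ha)

theorem IsFormalHam.add {d : ℕ} {F G : Ham} (hF : IsFormalHam d F) (hG : IsFormalHam d G) :
    IsFormalHam d (F + G) := by
  have h : ∀ a, (F + G) a ≠ 0 → F a ≠ 0 ∨ G a ≠ 0 := by
    intro a ha
    by_contra! hc
    exact ha (by rw [Pi.add_apply, hc.1, hc.2, add_zero])
  refine ⟨fun α β => ?_, fun a ha => ?_, fun a ha => ?_⟩
  · rw [Pi.add_apply, Pi.add_apply, map_add, hF.reality α β, hG.reality α β]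
  · exact (h a ha).elim (hF.momentum_eq a) (hG.momentum_eq a)
  · exact (h a ha).elim (hF.degree a) (hG.degree a)

/-- The total exponent of a multi-index weighted by a function on `ℤ`. -/
def windex (f : ℤ → ℝ) (κ : MultiIndex) : ℝ := κ.sum fun j n => f j * n

theorem windex_add (f : ℤ → ℝ) (κ κ' : MultiIndex) :
    windex f (κ + κ') = windex f κ + windex f κ' :=
  Finsupp.sum_add_index' (fun _ => by simp) fun _ _ _ => by push_cast; ring

theorem windex_single (f : ℤ → ℝ) (j : ℤ) (n : ℕ) : windex f (Finsupp.single j n) = f j * n :=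
  Finsupp.sum_single_index (by simp)

theorem momentum_eq_windex (a : MultiIndex × MultiIndex) :
    (momentum a : ℝ) = windex (fun j => (j : ℝ)) a.1 - windex (fun j => (j : ℝ)) a.2 := by
  simp [momentum, windex, Finsupp.sum]

theorem totalDegree_eq_windex (a : MultiIndex × MultiIndex) :
    (totalDegree a : ℝ) = windex (fun _ => 1) a.1 + windex (fun _ => 1) a.2 := by
  simp [totalDegree, windex, Finsupp.sum]

/-- The relations between the exponents are written additively, so that momentum and degree, being
additive, can be read off from them. -/
theorem bracket_ne_zero {F S : Ham} {c : MultiIndex × MultiIndex} (h : bracket F S c ≠ 0) :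
    ∃ a b j, bracketIndex (a, b, j) = c ∧ F a ≠ 0 ∧ S b ≠ 0 ∧
      c.1 + Finsupp.single j 1 = a.1 + b.1 ∧ c.2 + Finsupp.single j 1 = a.2 + b.2 := by
  have : ∃ p, (if bracketIndex p = c then bracketCoeff F S p else 0) ≠ 0 := by
    by_contra! hc
    exact h (by rw [bracket]; simp_rw [hc]; exact tsum_zero)
  obtain ⟨⟨a, b, j⟩, hp⟩ := this
  rw [ne_eq, ite_eq_right_iff, Classical.not_imp] at hp
  obtain ⟨h1, h2⟩ := hp
  rw [bracketCoeff] at h2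
  have hF : F a ≠ 0 := fun h0 => h2 (by simp [h0])
  have hS : S b ≠ 0 := fun h0 => h2 (by simp [h0])
  have hj : ((a.1 + b.1) j ≠ 0) ∧ ((a.2 + b.2) j ≠ 0) := by
    rw [Finsupp.add_apply, Finsupp.add_apply]
    by_contra hc
    apply h2
    have : (a.1 j = 0 ∧ b.1 j = 0) ∨ (a.2 j = 0 ∧ b.2 j = 0) := by omega
    rcases this with ⟨e1, e2⟩ | ⟨e1, e2⟩ <;> simp [e1, e2]
  refine ⟨a, b, j, h1, hF, hS, ?_, ?_⟩
  · rw [← h1]; exact sub_single_add_single hj.1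
  · rw [← h1]; exact sub_single_add_single hj.2

theorem bracket_real {F S : Ham} (hF : ∀ α β : MultiIndex, F (α, β) = conj (F (β, α)))
    (hS : ∀ α β : MultiIndex, S (α, β) = conj (S (β, α))) (α β : MultiIndex) :
    bracket F S (α, β) = conj (bracket F S (β, α)) := by
  let e : (MultiIndex × MultiIndex) × (MultiIndex × MultiIndex) × ℤ ≃
      (MultiIndex × MultiIndex) × (MultiIndex × MultiIndex) × ℤ :=
    (Equiv.prodComm _ _).prodCongr ((Equiv.prodComm _ _).prodCongr (Equiv.refl ℤ))
  rw [bracket, bracket, Complex.conj_tsum, ← e.tsum_eq]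
  refine tsum_congr fun p => ?_
  have h1 : bracketIndex (e p) = (bracketIndex p).swap := rfl
  have h2 : bracketCoeff F S (e p) = conj (bracketCoeff F S p) := by
    have hF' : ∀ a : MultiIndex × MultiIndex, F a.swap = conj (F a) := fun a => hF a.2 a.1
    have hS' : ∀ a : MultiIndex × MultiIndex, S a.swap = conj (S a) := fun a => hS a.2 a.1
    change -Complex.I * (F p.1.swap * S p.2.1.swap) * (((p.1.2 p.2.2 : ℕ) : ℂ) * (p.2.1.1 p.2.2 : ℕ)
      - ((p.1.1 p.2.2 : ℕ) : ℂ) * (p.2.1.2 p.2.2 : ℕ)) = _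
    rw [bracketCoeff, hF', hS']
    simp only [map_mul, map_neg, map_sub, Complex.conj_I, Complex.conj_natCast]
    ring
  rw [h1, h2]
  have h3 : (bracketIndex p).swap = (α, β) ↔ bracketIndex p = (β, α) :=
    ⟨fun h => by rw [← Prod.swap_swap (bracketIndex p), h]; rfl, fun h => by rw [h]; rfl⟩
  by_cases h : bracketIndex p = (β, α)
  · rw [if_pos h, if_pos (h3.mpr h)]
  · rw [if_neg h, if_neg (mt h3.mp h), map_zero]

theorem IsFormalHam.bracket {d e : ℕ} {F S : Ham} (hF : IsFormalHam d F) (hS : IsFormalHam e S) :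
    IsFormalHam (d + e) (bracket F S) := by
  refine ⟨bracket_real hF.reality hS.reality, fun c hc => ?_, fun c hc => ?_⟩
  · obtain ⟨a, b, j, -, ha, hb, h1, h2⟩ := bracket_ne_zero hc
    have e1 := congrArg (windex fun j => (j : ℝ)) h1
    have e2 := congrArg (windex fun j => (j : ℝ)) h2
    simp only [windex_add] at e1 e2
    have ma := momentum_eq_windex a
    have mb := momentum_eq_windex b
    rw [hF.momentum_eq a ha] at ma
    rw [hS.momentum_eq b hb] at mb
    push_cast at ma mb
    have : (momentum c : ℝ) = 0 := by rw [momentum_eq_windex]; linarith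
    exact_mod_cast this
  · obtain ⟨a, b, j, -, ha, hb, h1, h2⟩ := bracket_ne_zero hc
    have e1 := congrArg (windex fun _ => 1) h1
    have e2 := congrArg (windex fun _ => 1) h2
    simp only [windex_add, windex_single, Nat.cast_one] at e1 e2
    have ma := totalDegree_eq_windex a
    have mb := totalDegree_eq_windex b
    have mc := totalDegree_eq_windex c
    have h3 : ((d + 2 : ℕ) : ℝ) ≤ totalDegree a := by exact_mod_cast hF.degree a ha
    have h4 : ((e + 2 : ℕ) : ℝ) ≤ totalDegree b := by exact_mod_cast hS.degree b hb
    have : ((d + e + 2 : ℕ) : ℝ) ≤ totalDegree c := by push_cast at *; linarith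
    exact_mod_cast this

/-! ### Lie series -/

/-- The iterated Poisson brackets `{…{{F, S}, S}, …, S}`. -/
def adIter (S : Ham) (k : ℕ) (F : Ham) : Ham := (fun G => bracket G S)^[k] F

@[simp] theorem adIter_zero (S F : Ham) : adIter S 0 F = F := rfl

theorem adIter_succ (S : Ham) (k : ℕ) (F : Ham) :
    adIter S (k + 1) F = bracket (adIter S k F) S :=
  Function.iterate_succ_apply' _ _ _

theorem IsFormalHam.adIter {d e : ℕ} {F S : Ham} (hF : IsFormalHam d F) (hS : IsFormalHam e S)
    (k : ℕ) : IsFormalHam (d + k * e) (adIter S k F) := by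
  induction k with
  | zero => simpa using hF
  | succ k ih =>
    rw [adIter_succ]
    exact (ih.bracket hS).of_le (by rw [add_mul, one_mul, add_assoc])

/-- The loss of radius `r - r'` is divided into `k` equal parts, one for each bracket. -/
theorem fieldSup_adIter_le {w : Weight} {d e : ℕ} {F S : Ham} (hF : IsFormalHam d F)
    (hS : IsFormalHam e S) {r r' A B : ℝ} (h0 : 0 ≤ r') (hr : r' < r) (hA : 0 ≤ A) (_hB : 0 ≤ B)
    (hSA : fieldSup r w S ≤ ENNReal.ofReal A) (hFB : fieldSup r w F ≤ ENNReal.ofReal B) (k : ℕ) :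
    fieldSup r' w (adIter S k F) ≤ ENNReal.ofReal ((2 * k * A / (r - r')) ^ k * B) := by
  rcases Nat.eq_zero_or_pos k with rfl | hk
  · simpa using (fieldSup_mono_radius hr.le w F).trans hFB
  have hk0 : (0 : ℝ) < k := by exact_mod_cast hk
  set σ := (r - r') / k with hσ
  have hσ0 : 0 < σ := div_pos (by linarith) hk0
  have key : ∀ l : ℕ, l ≤ k → fieldSup (r - l * σ) w (adIter S l F)
      ≤ ENNReal.ofReal ((2 * A / σ) ^ l * B) := by
    intro l
    induction l with
    | zero => intro _; simpa using hFB
    | succ l ih =>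
      intro hl
      have ih' := ih (by omega)
      have hle : (l + 1 : ℝ) * σ ≤ r - r' := by
        have : (l + 1 : ℝ) ≤ k := by exact_mod_cast hl
        calc (l + 1 : ℝ) * σ ≤ k * σ := by gcongr
          _ = r - r' := by rw [hσ]; field_simp
      have hlσ : 0 ≤ (l : ℝ) * σ := by positivity
      have hS' : fieldSup (r - l * σ) w S ≤ ENNReal.ofReal A :=
        (fieldSup_mono_radius (by linarith) w S).trans hSA
      have h1 := fieldSup_bracket_le (w := w) (r := r - l * σ) (r' := r - (l + 1 : ℕ) * σ)
        (by push_cast; linarith) (by push_cast; linarith) (hF.adIter hS l).reality hS.reality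
        (ne_top_of_le_ne_top ENNReal.ofReal_ne_top ih')
        (ne_top_of_le_ne_top ENNReal.ofReal_ne_top hS')
      rw [show r - l * σ - (r - (l + 1 : ℕ) * σ) = σ by push_cast; ring, ← adIter_succ] at h1
      have h2 : ENNReal.ofReal σ * fieldSup (r - (l + 1 : ℕ) * σ) w (adIter S (l + 1) F)
          ≤ ENNReal.ofReal σ * ENNReal.ofReal ((2 * A / σ) ^ (l + 1) * B) := by
        refine h1.trans ?_
        calc _ ≤ 2 * (ENNReal.ofReal A * ENNReal.ofReal ((2 * A / σ) ^ l * B)) := by gcongr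
          _ = ENNReal.ofReal (2 * (A * ((2 * A / σ) ^ l * B))) := by
            rw [ENNReal.ofReal_mul (p := 2) (by norm_num), ENNReal.ofReal_mul (p := A) hA]
            norm_num
          _ = _ := by
            rw [← ENNReal.ofReal_mul hσ0.le]
            congr 1
            rw [pow_succ]
            field_simp
      rwa [ENNReal.mul_le_mul_iff_right (by simpa using hσ0) ENNReal.ofReal_ne_top] at h2
  have := key k le_rfl
  rw [show r - k * σ = r' by rw [hσ]; field_simp; ring] at this
  convert this using 4
  rw [hσ]
  field_simp

/-- From `k ^ k / k! ≤ e ^ k` and `e < 3`. The growth `k ^ k` caused by dividing the radius is thus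
compensated by the factorials of the Lie series. -/
theorem natCast_pow_le_factorial (k : ℕ) : (k : ℝ) ^ k ≤ 3 ^ k * k.factorial := by
  have h := Real.pow_div_factorial_le_exp (k : ℝ) (Nat.cast_nonneg k) k
  rw [div_le_iff₀ (by positivity)] at h
  refine h.trans ?_
  gcongr
  rw [← Real.exp_one_pow]
  gcongr
  exact Real.exp_one_lt_d9.le.trans (by norm_num)

theorem fieldSup_adIter_le_factorial {w : Weight} {d e : ℕ} {F S : Ham} (hF : IsFormalHam d F)
    (hS : IsFormalHam e S) {r r' A B : ℝ} (h0 : 0 ≤ r') (hr : r' < r) (hA : 0 ≤ A) (hB : 0 ≤ B)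
    (hSA : fieldSup r w S ≤ ENNReal.ofReal A) (hFB : fieldSup r w F ≤ ENNReal.ofReal B) (k : ℕ) :
    fieldSup r' w (adIter S k F)
      ≤ ENNReal.ofReal ((6 * A / (r - r')) ^ k * k.factorial * B) := by
  refine (fieldSup_adIter_le hF hS h0 hr hA hB hSA hFB k).trans (ENNReal.ofReal_le_ofReal ?_)
  have hσ : 0 < r - r' := by linarith
  have h1 : (2 * k * A / (r - r')) ^ k = (2 * A / (r - r')) ^ k * (k : ℝ) ^ k := by
    rw [← mul_pow]; congr 1; ring
  have h2 : (6 * A / (r - r')) ^ k = (2 * A / (r - r')) ^ k * 3 ^ k := by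
    rw [← mul_pow]; congr 1; ring
  rw [h1, h2, mul_assoc _ (3 ^ k : ℝ)]
  gcongr
  exact natCast_pow_le_factorial k

/-- The tail `∑_{k ≥ 0} c_k ad_S^{k+1} F` of a Lie series. -/
def lieTail (c : ℕ → ℝ) (S F : Ham) : Ham := fun a => ∑' k, (c k : ℂ) * adIter S (k + 1) F a

theorem IsFormalHam.lieTail {d e : ℕ} {F S : Ham} (hF : IsFormalHam d F) (hS : IsFormalHam e S)
    (c : ℕ → ℝ) : IsFormalHam (d + e) (lieTail c S F) := by
  have hne : ∀ a, BeamBNF.lieTail c S F a ≠ 0 → ∃ k, BeamBNF.adIter S (k + 1) F a ≠ 0 := by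
    intro a ha
    by_contra! hc
    exact ha (by rw [BeamBNF.lieTail]; simp_rw [hc]; simp)
  have hk : ∀ k, IsFormalHam (d + e) (BeamBNF.adIter S (k + 1) F) := fun k =>
    (hF.adIter hS (k + 1)).of_le (by rw [add_mul, one_mul]; omega)
  refine ⟨fun α β => ?_, fun a ha => ?_, fun a ha => ?_⟩
  · rw [BeamBNF.lieTail, BeamBNF.lieTail, Complex.conj_tsum]
    refine tsum_congr fun k => ?_
    rw [map_mul, Complex.conj_ofReal, ← (hk k).reality α β]
  · obtain ⟨k, h⟩ := hne a ha
    exact (hk k).momentum_eq a h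
  · obtain ⟨k, h⟩ := hne a ha
    exact (hk k).degree a h

section LieTail

variable {w : Weight} {d e : ℕ} {F S : Ham} {r r' A B : ℝ} {c : ℕ → ℝ}

theorem fieldSup_smul_adIter_le (hF : IsFormalHam d F) (hS : IsFormalHam e S) (h0 : 0 ≤ r')
    (hr : r' < r) (hA : 0 ≤ A) (hB : 0 ≤ B) (hSA : fieldSup r w S ≤ ENNReal.ofReal A)
    (hFB : fieldSup r w F ≤ ENNReal.ofReal B) (hc0 : ∀ k, 0 ≤ c k)
    (hc : ∀ k, c k * (k + 1).factorial ≤ 1) (k : ℕ) :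
    fieldSup r' w (fun a => (c k : ℂ) * adIter S (k + 1) F a)
      ≤ ENNReal.ofReal ((6 * A / (r - r')) ^ (k + 1) * B) := by
  rw [fieldSup_const_mul]
  have h1 := fieldSup_adIter_le_factorial hF hS h0 hr hA hB hSA hFB (k + 1)
  have h2 : ‖(c k : ℂ)‖ₑ = ENNReal.ofReal (c k) := by
    rw [← ofReal_norm, Complex.norm_real, Real.norm_of_nonneg (hc0 k)]
  have hσ : 0 < r - r' := by linarith
  calc ‖(c k : ℂ)‖ₑ * fieldSup r' w (adIter S (k + 1) F)
      ≤ ENNReal.ofReal (c k) * ENNReal.ofReal ((6 * A / (r - r')) ^ (k + 1) *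
          (k + 1).factorial * B) := by rw [h2]; gcongr
    _ = ENNReal.ofReal ((6 * A / (r - r')) ^ (k + 1) * (c k * (k + 1).factorial) * B) := by
        rw [← ENNReal.ofReal_mul (hc0 k)]; congr 1; ring
    _ ≤ _ := by
        apply ENNReal.ofReal_le_ofReal
        gcongr
        exact mul_le_of_le_one_right (by positivity) (hc k)

theorem tsum_ofReal_geometric {q B : ℝ} (hq0 : 0 ≤ q) (hq : q ≤ 1 / 4) (hB : 0 ≤ B) :
    ∑' k : ℕ, ENNReal.ofReal (q ^ (k + 1) * B) ≤ ENNReal.ofReal (B / 3) := by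
  have hs : HasSum (fun k : ℕ => q ^ (k + 1) * B) ((1 - q)⁻¹ * (q * B)) := by
    have h := (hasSum_geometric_of_lt_one hq0 (by linarith)).mul_right (q * B)
    have e : (fun k : ℕ => q ^ (k + 1) * B) = fun k => q ^ k * (q * B) := by
      funext k
      ring
    rwa [e]
  rw [← ENNReal.ofReal_tsum_of_nonneg (fun k => by positivity) hs.summable, hs.tsum_eq]
  apply ENNReal.ofReal_le_ofReal
  have : (1 - q)⁻¹ * q ≤ 1 / 3 := by
    rw [inv_mul_le_iff₀ (by linarith)]
    linarith
  calc (1 - q)⁻¹ * (q * B) = (1 - q)⁻¹ * q * B := by ring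
    _ ≤ 1 / 3 * B := by gcongr
    _ = B / 3 := by ring

/-- With `q = 6 A / (r - r') ≤ 1 / 4`, the terms are bounded by `q ^ (k + 1) B`, and the geometric
series sums to at most `B / 3`. -/
theorem fieldSup_lieTail_le (hF : IsFormalHam d F) (hS : IsFormalHam e S) (h0 : 0 ≤ r')
    (hr : r' < r) (hA : 0 ≤ A) (hB : 0 ≤ B) (hSA : fieldSup r w S ≤ ENNReal.ofReal A)
    (hFB : fieldSup r w F ≤ ENNReal.ofReal B) (hc0 : ∀ k, 0 ≤ c k)
    (hc : ∀ k, c k * (k + 1).factorial ≤ 1) (hq : 6 * A / (r - r') ≤ 1 / 4) :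
    fieldSup r' w (lieTail c S F) ≤ ENNReal.ofReal (B / 3) := by
  refine (fieldSup_tsum_le r' w fun k a => (c k : ℂ) * adIter S (k + 1) F a).trans ?_
  refine (ENNReal.tsum_le_tsum fun k =>
    fieldSup_smul_adIter_le hF hS h0 hr hA hB hSA hFB hc0 hc k).trans ?_
  exact tsum_ofReal_geometric (by have : 0 < r - r' := by linarith
                                  positivity) hq hB

theorem eval_lieTail (hw : ∀ j, 1 ≤ w.toFun j) (hF : IsFormalHam d F) (hS : IsFormalHam e S)
    (h0 : 0 ≤ r') (hr : r' < r) (hA : 0 ≤ A) (hB : 0 ≤ B)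
    (hSA : fieldSup r w S ≤ ENNReal.ofReal A) (hFB : fieldSup r w F ≤ ENNReal.ofReal B)
    (hc0 : ∀ k, 0 ≤ c k) (hc : ∀ k, c k * (k + 1).factorial ≤ 1)
    (hq : 6 * A / (r - r') ≤ 1 / 4) {u : HSpace w} (hu : ‖u‖ ≤ r') :
    (lieTail c S F).eval u = ∑' k, (c k : ℂ) * (adIter S (k + 1) F).eval u := by
  have hσ : 0 < r - r' := by linarith
  have e1 : ∀ a, lieTail c S F a * mono u a
      = ∑' k, (c k : ℂ) * adIter S (k + 1) F a * mono u a := fun a => by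
    rw [lieTail, tsum_mul_right]
  have hform : ∀ k, IsFormalHam (d + (k + 1) * e) (fun a => (c k : ℂ) * adIter S (k + 1) F a) := by
    intro k
    have := hF.adIter hS (k + 1)
    refine ⟨fun α β => ?_, fun a ha => this.momentum_eq a (right_ne_zero_of_mul ha),
      fun a ha => this.degree a (right_ne_zero_of_mul ha)⟩
    rw [map_mul, Complex.conj_ofReal, ← this.reality α β]
  rw [Ham.eval, tsum_congr e1, tsum_comm_of_enorm]
  · refine tsum_congr fun k => ?_
    rw [Ham.eval, ← tsum_mul_left]
    exact tsum_congr fun a => mul_assoc _ _ _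
  · rw [ENNReal.tsum_comm]
    have h1 : ∀ k, ∑' a, ‖(c k : ℂ) * adIter S (k + 1) F a * mono u a‖ₑ
        ≤ 2 * (ENNReal.ofReal r' * ENNReal.ofReal ((6 * A / (r - r')) ^ (k + 1) * B)) := by
      intro k
      refine (tsum_enorm_eval_le_fieldSup hw (hform k).reality (hform k).one_le h0 hu).trans ?_
      gcongr
      exact fieldSup_smul_adIter_le hF hS h0 hr hA hB hSA hFB hc0 hc k
    refine ne_top_of_le_ne_top ?_ (ENNReal.tsum_le_tsum h1)
    rw [ENNReal.tsum_mul_left, ENNReal.tsum_mul_left]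
    refine ENNReal.mul_ne_top ENNReal.ofNat_ne_top (ENNReal.mul_ne_top ENNReal.ofReal_ne_top ?_)
    exact ne_top_of_le_ne_top ENNReal.ofReal_ne_top (tsum_ofReal_geometric (by positivity) hq hB)

end LieTail

/-! ### Taylor expansion along a chain of primitives -/

/-- Taylor's inequality by repeated integration: the link between `g k` and `g (k + 1)` is used only
in integrated form. -/
theorem norm_sub_taylor_le (n : ℕ) : ∀ (g : ℕ → ℝ → ℂ),
    (∀ k, ∀ T ∈ Set.Icc (0 : ℝ) 1, IntervalIntegrable (g (k + 1)) MeasureTheory.volume 0 T ∧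
      g k T - g k 0 = ∫ t in (0 : ℝ)..T, g (k + 1) t) →
    ∀ M : ℝ, (∀ t ∈ Set.Icc (0 : ℝ) 1, ‖g n t‖ ≤ M) → ∀ T ∈ Set.Icc (0 : ℝ) 1,
      ‖g 0 T - ∑ k ∈ Finset.range n, (T ^ k / k.factorial : ℝ) * g k 0‖
        ≤ M * (T ^ n / n.factorial) := by
  induction n with
  | zero => intro g _ M hM T hT; simpa using hM T hT
  | succ n ih =>
    intro g hg M hM T hT
    have ih' := ih (fun k => g (k + 1)) (fun k => hg (k + 1)) M hM
    have hpoly : ∀ k, IntervalIntegrable (fun t : ℝ => ((t ^ k / k.factorial : ℝ) : ℂ) * g (k + 1) 0)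
        MeasureTheory.volume 0 T := fun k =>
      Continuous.intervalIntegrable (by fun_prop) _ _
    have hsum : ∫ t in (0 : ℝ)..T, ∑ k ∈ Finset.range n,
        ((t ^ k / k.factorial : ℝ) : ℂ) * g (k + 1) 0
        = ∑ k ∈ Finset.range n, ((T ^ (k + 1) / (k + 1).factorial : ℝ) : ℂ) * g (k + 1) 0 := by
      rw [intervalIntegral.integral_finsetSum fun k _ => hpoly k]
      refine Finset.sum_congr rfl fun k _ => ?_
      rw [intervalIntegral.integral_mul_const, intervalIntegral.integral_ofReal,
        intervalIntegral.integral_div, integral_pow]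
      congr 2
      rw [Nat.factorial_succ]
      push_cast
      have : (k.factorial : ℝ) ≠ 0 := by positivity
      field_simp
      simp
    have hIS : IntervalIntegrable (fun t : ℝ => ∑ k ∈ Finset.range n,
        ((t ^ k / k.factorial : ℝ) : ℂ) * g (k + 1) 0) MeasureTheory.volume 0 T :=
      Continuous.intervalIntegrable (by fun_prop) _ _
    have e : g 0 T - ∑ k ∈ Finset.range (n + 1), ((T ^ k / k.factorial : ℝ) : ℂ) * g k 0
        = ∫ t in (0 : ℝ)..T, (g 1 t - ∑ k ∈ Finset.range n,
          ((t ^ k / k.factorial : ℝ) : ℂ) * g (k + 1) 0) := by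
      rw [intervalIntegral.integral_sub (hg 0 T hT).1 hIS, ← (hg 0 T hT).2, hsum,
        Finset.sum_range_succ']
      simp
      ring
    rw [e]
    have hMint : ∫ t in (0 : ℝ)..T, M * (t ^ n / n.factorial)
        = M * (T ^ (n + 1) / (n + 1).factorial) := by
      rw [intervalIntegral.integral_const_mul, intervalIntegral.integral_div, integral_pow]
      congr 1
      rw [Nat.factorial_succ]
      push_cast
      have : (n.factorial : ℝ) ≠ 0 := by positivity
      field_simp
      simp
    rw [← hMint]
    refine intervalIntegral.norm_integral_le_of_norm_le hT.1
      (Filter.Eventually.of_forall fun t ht => ?_)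
      (Continuous.intervalIntegrable (by fun_prop) _ _)
    exact ih' t ⟨ht.1.le, ht.2.trans hT.2⟩

/-- The hypothesis `hgb` makes the remainder at time one at most `b n`, which tends to zero. -/
theorem hasSum_taylor {g : ℕ → ℝ → ℂ}
    (hg : ∀ k, ∀ T ∈ Set.Icc (0 : ℝ) 1, IntervalIntegrable (g (k + 1)) MeasureTheory.volume 0 T ∧
      g k T - g k 0 = ∫ t in (0 : ℝ)..T, g (k + 1) t) {b : ℕ → ℝ} (hb : Summable b)
    (hgb : ∀ k, ∀ t ∈ Set.Icc (0 : ℝ) 1, ‖g (k + 1) t‖ ≤ (k + 1).factorial * b k) :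
    HasSum (fun k => ((1 / (k + 1).factorial : ℝ) : ℂ) * g (k + 1) 0) (g 0 1 - g 0 0) := by
  have h0 : (0 : ℝ) ∈ Set.Icc (0 : ℝ) 1 := by simp
  have h1 : (1 : ℝ) ∈ Set.Icc (0 : ℝ) 1 := by simp
  have hs : Summable fun k => ((1 / (k + 1).factorial : ℝ) : ℂ) * g (k + 1) 0 := by
    refine Summable.of_norm_bounded hb fun k => ?_
    rw [norm_mul, Complex.norm_real, Real.norm_of_nonneg (by positivity), one_div,
      inv_mul_le_iff₀ (by positivity)]
    exact hgb k 0 h0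
  have ht := hs.hasSum.tendsto_sum_nat
  have hlim : Filter.Tendsto (fun n => ∑ k ∈ Finset.range n,
      ((1 / (k + 1).factorial : ℝ) : ℂ) * g (k + 1) 0) Filter.atTop (nhds (g 0 1 - g 0 0)) := by
    rw [tendsto_iff_norm_sub_tendsto_zero]
    refine squeeze_zero (fun _ => norm_nonneg _) (fun n => ?_) hb.tendsto_atTop_zero
    have := norm_sub_taylor_le (n + 1) g hg _ (hgb n) 1 h1
    rw [Finset.sum_range_succ', norm_sub_rev] at this
    have e1 : (∑ k ∈ Finset.range n, (((1 : ℝ) ^ (k + 1) / (k + 1).factorial : ℝ) : ℂ) * g (k + 1) 0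
        + (((1 : ℝ) ^ 0 / Nat.factorial 0 : ℝ) : ℂ) * g 0 0 - g 0 1)
        = ∑ k ∈ Finset.range n, ((1 / (k + 1).factorial : ℝ) : ℂ) * g (k + 1) 0
          - (g 0 1 - g 0 0) := by
      simp only [one_pow, Nat.factorial_zero, Nat.cast_one, div_one, Complex.ofReal_one, one_mul]
      ring
    rw [e1] at this
    refine this.trans (le_of_eq ?_)
    have : ((n + 1).factorial : ℝ) ≠ 0 := by positivity
    rw [one_pow]
    field_simp
  exact (tendsto_nhds_unique ht hlim) ▸ hs.hasSum

/-! ### The quadratic Hamiltonian along a flow -/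

theorem mul_pd {R : Type*} [CommSemiring R] (x : ℤ → R) (κ : MultiIndex) (j : ℤ) :
    x j * pd x κ j = κ j * mpow x κ := by
  by_cases hj : κ j = 0
  · simp [pd, hj]
  · conv_rhs => rw [← sub_single_add_single hj, mpow_add, mpow_single, pow_one]
    rw [sub_single_add_single hj, pd]
    ring

theorem tsum_weight_mul_le_wnorm (w : Weight) (f g : ℤ → ℝ≥0∞) :
    ∑' j, ENNReal.ofReal (w.toFun j) ^ 2 * (f j * g j) ≤ wnorm w f * wnorm w g := by
  have e : ∀ j, ENNReal.ofReal (w.toFun j) ^ 2 * (f j * g j)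
      = (ENNReal.ofReal (w.toFun j) * f j) * (ENNReal.ofReal (w.toFun j) * g j) := fun j => by ring
  simp_rw [e]
  rw [← MeasureTheory.lintegral_count, wnorm_eq_lintegral, wnorm_eq_lintegral]
  exact ENNReal.lintegral_mul_le_Lp_mul_Lq _ Real.HolderConjugate.two_two
    (measurable_of_countable _).aemeasurable (measurable_of_countable _).aemeasurable

/-- The frequency `ω · (α - β)` of a monomial. -/
def monoFreq (ω : ℤ → ℝ) (a : MultiIndex × MultiIndex) : ℝ := windex ω a.1 - windex ω a.2

section Quadratic

variable {w : Weight} {ω : ℤ → ℝ} {c : ℝ}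

theorem enorm_freq_mul_le (hω : ∀ j, |ω j| ≤ c * w.toFun j ^ 2) (j : ℤ) (y : ℝ≥0∞) :
    ‖(ω j : ℂ)‖ₑ * y ≤ ENNReal.ofReal c * (ENNReal.ofReal (w.toFun j) ^ 2 * y) := by
  rw [← mul_assoc]
  gcongr
  rw [← ofReal_norm, Complex.norm_real, Real.norm_eq_abs, ← ENNReal.ofReal_pow (w.pos j).le]
  rw [← ENNReal.ofReal_mul' (by positivity)]
  exact ENNReal.ofReal_le_ofReal (hω j)

theorem tsum_enorm_freq_mul_le (hω : ∀ j, |ω j| ≤ c * w.toFun j ^ 2) (f g : ℤ → ℝ≥0∞) :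
    ∑' j, ‖(ω j : ℂ)‖ₑ * (f j * g j) ≤ ENNReal.ofReal c * (wnorm w f * wnorm w g) := by
  refine (ENNReal.tsum_le_tsum fun j => enorm_freq_mul_le hω j _).trans ?_
  rw [ENNReal.tsum_mul_left]
  gcongr
  exact tsum_weight_mul_le_wnorm w f g

/-- The derivative of `∑ ω_j |u_j| ^ 2` along the vector field of a Hamiltonian. -/
theorem tsum_freq_vectorField (hω : ∀ j, |ω j| ≤ c * w.toFun j ^ 2) {S N : Ham}
    (hS : ∀ α β : MultiIndex, S (α, β) = conj (S (β, α)))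
    (hN : ∀ a, N a = -Complex.I * monoFreq ω a * S a) {u : ℤ → ℂ}
    (hu : wnorm w (fun j => ‖u j‖ₑ) ≠ ⊤) (huS : wnorm w (majField S fun j => ‖u j‖ₑ) ≠ ⊤) :
    ∑' j, (ω j : ℂ) * (vectorField S u j * conj (u j) + u j * conj (vectorField S u j))
      = -N.eval u := by
  set P : ℤ → MultiIndex × MultiIndex → ℂ :=
    fun j a => S a * (pd u a.1 j * mpow (fun j => conj (u j)) a.2) with hP
  set Q : ℤ → MultiIndex × MultiIndex → ℂ :=
    fun j a => S a * (mpow u a.1 * pd (fun j => conj (u j)) a.2 j) with hQ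
  have sP : ∀ j, ∑' a, ‖P j a‖ₑ = majField S (fun j => ‖u j‖ₑ) j := tsum_enorm_term_d hS u
  have sQ : ∀ j, ∑' a, ‖Q j a‖ₑ = majField S (fun j => ‖u j‖ₑ) j := tsum_enorm_term_vectorField S u
  -- The frequencies may be unbounded. Since `|ω_j| ≤ c w_j ^ 2`, one factor `w_j` goes to `u` and
  -- one to the field of `S`.
  have hfin : ∑' j, ∑' a, ‖(ω j : ℂ) * (Complex.I * (u j * P j a - conj (u j) * Q j a))‖ₑ ≠ ⊤ := by
    refine ne_top_of_le_ne_top (ENNReal.mul_ne_top (ENNReal.ofNat_ne_top (n := 2))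
      (ENNReal.mul_ne_top (ENNReal.ofReal_ne_top (r := c)) (ENNReal.mul_ne_top hu huS))) ?_
    calc _ ≤ ∑' j, 2 * (‖(ω j : ℂ)‖ₑ * (‖u j‖ₑ * majField S (fun j => ‖u j‖ₑ) j)) := by
          refine ENNReal.tsum_le_tsum fun j => ?_
          calc _ ≤ ∑' a, ‖(ω j : ℂ)‖ₑ * (‖u j‖ₑ * ‖P j a‖ₑ + ‖u j‖ₑ * ‖Q j a‖ₑ) := by
                refine ENNReal.tsum_le_tsum fun a => ?_
                rw [enorm_mul, enorm_I_mul]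
                gcongr
                refine enorm_sub_le.trans ?_
                rw [enorm_mul (u j), enorm_mul (conj (u j)), enorm_conj]
            _ = _ := by
                rw [ENNReal.tsum_mul_left, ENNReal.tsum_add, ENNReal.tsum_mul_left,
                  ENNReal.tsum_mul_left, sP, sQ]
                ring
      _ ≤ _ := by
          rw [ENNReal.tsum_mul_left]
          gcongr
          exact tsum_enorm_freq_mul_le hω _ _
  have h1 : ∀ j, (ω j : ℂ) * (vectorField S u j * conj (u j) + u j * conj (vectorField S u j))
      = ∑' a, (ω j : ℂ) * (Complex.I * (u j * P j a - conj (u j) * Q j a)) := by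
    intro j
    have s1 : Summable fun a => P j a :=
      summable_of_tsum_enorm_ne_top (by rw [sP]; exact majField_ne_top huS j)
    have s2 : Summable fun a => Q j a :=
      summable_of_tsum_enorm_ne_top (by rw [sQ]; exact majField_ne_top huS j)
    rw [tsum_mul_left, tsum_mul_left, (s1.mul_left _).tsum_sub (s2.mul_left _), tsum_mul_left,
      tsum_mul_left, tsum_d_eq hS, tsum_dbar_eq]
    linear_combination (ω j : ℂ) *
      (vectorField S u j * conj (u j) + u j * conj (vectorField S u j)) * Complex.I_sq
  rw [tsum_congr h1, tsum_comm_of_enorm hfin, Ham.eval, ← tsum_neg]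
  refine tsum_congr fun a => ?_
  -- The operators `u_j ∂_{u_j}` and `ū_j ∂_{ū_j}` multiply a monomial by `α_j` and `β_j`; summed
  -- over `j` they produce `ω · (α - β)`.
  have h2 : ∀ j, (ω j : ℂ) * (Complex.I * (u j * P j a - conj (u j) * Q j a))
      = Complex.I * S a * mono u a * ((ω j : ℂ) * a.1 j - (ω j : ℂ) * a.2 j) := by
    intro j
    have e1 := mul_pd u a.1 j
    have e2 := mul_pd (fun j => conj (u j)) a.2 j
    simp only [hP, hQ, mono_eq]
    linear_combination (ω j : ℂ) * Complex.I * S a * mpow (fun j => conj (u j)) a.2 * e1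
      - (ω j : ℂ) * Complex.I * S a * mpow u a.1 * e2
  have h3 : ∀ κ : MultiIndex, HasSum (fun j => (ω j : ℂ) * κ j) (windex ω κ : ℂ) := by
    intro κ
    have h4 : HasSum (fun j => (ω j : ℂ) * κ j) (∑ j ∈ κ.support, (ω j : ℂ) * κ j) :=
      hasSum_sum_of_ne_finset_zero
        (fun j hj => by rw [Finsupp.notMem_support_iff.mp hj]; simp)
    simpa [windex, Finsupp.sum] using h4
  rw [tsum_congr h2, (((h3 a.1).sub (h3 a.2)).mul_left _).tsum_eq, hN, monoFreq]
  push_cast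
  ring

theorem summable_quadratic (hω : ∀ j, |ω j| ≤ c * w.toFun j ^ 2) (u : HSpace w) :
    Summable fun j => (ω j : ℂ) * (u j * conj (u j)) := by
  refine summable_of_tsum_enorm_ne_top (ne_top_of_le_ne_top (ENNReal.mul_ne_top
    (ENNReal.ofReal_ne_top (r := c)) (ENNReal.mul_ne_top u.wnorm_ne_top u.wnorm_ne_top))
    (le_trans (ENNReal.tsum_le_tsum fun j => ?_) (tsum_enorm_freq_mul_le hω _ _)))
  rw [enorm_mul, enorm_mul, enorm_conj]

theorem ofReal_quadraticHam (ω : ℤ → ℝ) (u : ℤ → ℂ) :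
    (quadraticHam ω u : ℂ) = ∑' j, (ω j : ℂ) * (u j * conj (u j)) := by
  rw [quadraticHam, Complex.ofReal_tsum]
  refine tsum_congr fun j => ?_
  rw [Complex.mul_conj, Complex.normSq_eq_norm_sq]
  push_cast
  ring

end Quadratic

/-! ### Transformation of Hamiltonians under a flow -/

/-- A trajectory, for times in `[0, 1]`, of the Hamiltonian flow of `S`, in the ball of radius
`r`. -/
structure IsTrajectory {w : Weight} (S : Ham) (r : ℝ) (Γ v : ℝ → HSpace w) : Prop where
  cont : Continuous v
  deriv : ∀ t, HasDerivAt Γ (v t) t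
  ball : ∀ t ∈ Set.Icc (0 : ℝ) 1, ‖Γ t‖ ≤ r
  field : ∀ t ∈ Set.Icc (0 : ℝ) 1, ∀ j, v t j = vectorField S (Γ t) j

section Transform

variable {w : Weight} {d e : ℕ} {F S N : Ham} {r r' A B : ℝ} {Γ v : ℝ → HSpace w}
  {ω : ℤ → ℝ} {C : ℝ}

theorem uIoc_zero_subset {T : ℝ} (hT : T ∈ Set.Icc (0 : ℝ) 1) {t : ℝ} (ht : t ∈ Set.uIoc 0 T) :
    t ∈ Set.Icc (0 : ℝ) 1 := by
  rw [Set.uIoc_of_le hT.1] at ht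
  exact ⟨ht.1.le, ht.2.trans hT.2⟩

theorem integral_congr_of_Icc {f g : ℝ → ℂ} (h : ∀ t ∈ Set.Icc (0 : ℝ) 1, f t = g t) {T : ℝ}
    (hT : T ∈ Set.Icc (0 : ℝ) 1) {x : ℂ} (hf : IntervalIntegrable f MeasureTheory.volume 0 T ∧
      x = ∫ t in (0 : ℝ)..T, f t) : IntervalIntegrable g MeasureTheory.volume 0 T ∧
      x = ∫ t in (0 : ℝ)..T, g t := by
  have hfg : Set.EqOn f g (Set.uIoc 0 T) := fun t ht => h t (uIoc_zero_subset hT ht)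
  refine ⟨hf.1.congr hfg, hf.2.trans (intervalIntegral.integral_congr_ae ?_)⟩
  exact Filter.Eventually.of_forall fun t ht => hfg ht

theorem IsTrajectory.eval_sub_eval (h : IsTrajectory S r Γ v) (hw : ∀ j, 1 ≤ w.toFun j)
    (hr : 0 ≤ r) (hF : IsFormalHam d F) (hS : IsFormalHam e S) (hfF : fieldSup r w F ≠ ⊤)
    (hfS : fieldSup r w S ≠ ⊤) {T : ℝ} (hT : T ∈ Set.Icc (0 : ℝ) 1) :
    IntervalIntegrable (fun t => (bracket F S).eval (Γ t)) MeasureTheory.volume 0 T ∧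
      F.eval (Γ T) - F.eval (Γ 0) = ∫ t in (0 : ℝ)..T, (bracket F S).eval (Γ t) := by
  have h1 := eval_sub_eval_eq_integral hw hF.reality hF.one_le hr hT.1 hfF h.cont h.deriv
    (fun t ht => h.ball t ⟨ht.1, ht.2.trans hT.2⟩)
  refine integral_congr_of_Icc (fun t ht => ?_) hT h1
  have hx := ((Γ t).norm_le_iff hr).mp (h.ball t ht)
  rw [eval_bracket hw hF.reality hS.reality (ne_top_of_le_ne_top hfF (le_fieldSup F hx))
    (ne_top_of_le_ne_top hfS (le_fieldSup S hx))]
  congr 1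
  funext j
  exact h.field t ht j

/-- The vector field of `D_ω` may be unbounded, so `IsTrajectory.eval_sub_eval` does not cover it;
the series of `D_ω` is differentiated term by term instead. -/
theorem IsTrajectory.quadratic_sub_quadratic (h : IsTrajectory S r Γ v) (hr : 0 ≤ r)
    (hw : ∀ j, 1 ≤ w.toFun j)
    (hω : ∀ j, |ω j| ≤ C * w.toFun j ^ 2) (hS : IsFormalHam e S) (hfS : fieldSup r w S ≠ ⊤)
    (hN : ∀ a, N a = -Complex.I * monoFreq ω a * S a) {T : ℝ} (hT : T ∈ Set.Icc (0 : ℝ) 1) :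
    IntervalIntegrable (fun t => -N.eval (Γ t)) MeasureTheory.volume 0 T ∧
      (quadraticHam ω (Γ T) : ℂ) - quadraticHam ω (Γ 0)
        = ∫ t in (0 : ℝ)..T, -N.eval (Γ t) := by
  have hco : ∀ j t, HasDerivAt (fun s => (Γ s) j) ((v t) j) t := fun j t =>
    (HSpace.coordCLM hw j).hasFDerivAt.comp_hasDerivAt t (h.deriv t)
  have hΓc : ∀ j, Continuous fun t => (Γ t) j := fun j =>
    continuous_iff_continuousAt.mpr fun t => (hco j t).continuousAt
  have hvc : ∀ j, Continuous fun t => (v t) j := fun j =>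
    (HSpace.coordCLM hw j).continuous.comp h.cont
  have hcj : ∀ j t, HasDerivAt (fun s => conj ((Γ s) j)) (conj ((v t) j)) t := fun j t =>
    Complex.conjCLE.toContinuousLinearMap.hasFDerivAt.comp_hasDerivAt t (hco j t)
  have hx : ∀ t ∈ Set.Icc (0 : ℝ) 1, wnorm w (fun j => ‖(Γ t) j‖ₑ) ≤ ENNReal.ofReal r :=
    fun t ht => ((Γ t).norm_le_iff hr).mp (h.ball t ht)
  have h1 := tsum_sub_tsum_eq_integral (ι := ℤ) (T := T) hT.1
    (f := fun j t => (ω j : ℂ) * ((Γ t) j * conj ((Γ t) j)))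
    (f' := fun j t => (ω j : ℂ) * ((v t) j * conj ((Γ t) j) + (Γ t) j * conj ((v t) j)))
    (fun j t => ((hco j t).mul (hcj j t)).const_mul _)
    (fun j => by have h1 := hΓc j; have h2 := hvc j; fun_prop)
    (B := 2 * (ENNReal.ofReal C * (fieldSup r w S * ENNReal.ofReal r)))
    (ENNReal.mul_ne_top ENNReal.ofNat_ne_top (ENNReal.mul_ne_top ENNReal.ofReal_ne_top
      (ENNReal.mul_ne_top hfS ENNReal.ofReal_ne_top)))
    (fun t ht => by
      have ht1 : t ∈ Set.Icc (0 : ℝ) 1 := ⟨ht.1, ht.2.trans hT.2⟩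
      have hv : wnorm w (fun j => ‖(v t) j‖ₑ) ≤ fieldSup r w S := by
        refine le_trans (wnorm_mono w fun j => ?_) (le_fieldSup S (hx t ht1))
        rw [h.field t ht1 j]
        exact enorm_vectorField_le S _ j
      calc _ ≤ ∑' j, 2 * (‖(ω j : ℂ)‖ₑ * (‖(v t) j‖ₑ * ‖(Γ t) j‖ₑ)) := by
            refine ENNReal.tsum_le_tsum fun j => ?_
            rw [enorm_mul]
            refine (mul_le_mul_right (enorm_add_le _ _) _).trans ?_
            rw [enorm_mul, enorm_mul, enorm_conj, enorm_conj]
            apply le_of_eq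
            ring
        _ ≤ _ := by
            rw [ENNReal.tsum_mul_left]
            gcongr
            exact (tsum_enorm_freq_mul_le hω _ _).trans (by gcongr; exact hx t ht1))
    (summable_quadratic hω _) (summable_quadratic hω _)
  rw [ofReal_quadraticHam, ofReal_quadraticHam]
  refine integral_congr_of_Icc (fun t ht => ?_) hT h1
  rw [← tsum_freq_vectorField hω hS.reality hN (Γ t).wnorm_ne_top
    (ne_top_of_le_ne_top hfS (le_fieldSup S (hx t ht)))]
  refine tsum_congr fun j => ?_
  rw [h.field t ht j]

theorem norm_eval_adIter_le (hw : ∀ j, 1 ≤ w.toFun j) (hF : IsFormalHam d F)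
    (hS : IsFormalHam e S) (h0 : 0 ≤ r') (hr : r' < r) (hA : 0 ≤ A) (hB : 0 ≤ B)
    (hSA : fieldSup r w S ≤ ENNReal.ofReal A) (hFB : fieldSup r w F ≤ ENNReal.ofReal B)
    {u : HSpace w} (hu : ‖u‖ ≤ r') (k : ℕ) :
    ‖(adIter S k F).eval u‖ ≤ k.factorial * (2 * r' * B * (6 * A / (r - r')) ^ k) := by
  have h1 := tsum_enorm_eval_le_fieldSup hw (hF.adIter hS k).reality (hF.adIter hS k).one_le h0 hu
  have h2 := fieldSup_adIter_le_factorial hF hS h0 hr hA hB hSA hFB k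
  have h3 : ‖(adIter S k F).eval u‖ₑ
      ≤ ENNReal.ofReal (2 * (r' * ((6 * A / (r - r')) ^ k * k.factorial * B))) := by
    refine enorm_tsum_le_tsum_enorm.trans (h1.trans ?_)
    rw [ENNReal.ofReal_mul (p := 2) (by norm_num), ENNReal.ofReal_mul (p := r') h0]
    norm_num
    gcongr
  have hσ : 0 < r - r' := by linarith
  rw [← ofReal_norm, ENNReal.ofReal_le_ofReal_iff (by positivity)] at h3
  exact h3.trans_eq (by ring)

theorem summable_geometric_bound (hr : r' < r) (hA : 0 ≤ A) (hq : 6 * A / (r - r') ≤ 1 / 4)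
    (c : ℝ) : Summable fun k : ℕ => c * (6 * A / (r - r')) ^ k := by
  have hσ : 0 < r - r' := by linarith
  exact (summable_geometric_of_lt_one (by positivity) (by linarith)).mul_left c

theorem factorial_coeff_le (k : ℕ) :
    (1 / ((k + 2).factorial : ℝ)) * (k + 1).factorial ≤ 1 := by
  rw [one_div, inv_mul_le_iff₀ (by positivity), mul_one]
  exact_mod_cast Nat.factorial_le (by omega)

/-- The transformation of a Hamiltonian of formal scaling degree at least `d` under the time one
flow of `S`. -/
theorem IsTrajectory.eval_one (h : IsTrajectory S r' Γ v) (hw : ∀ j, 1 ≤ w.toFun j)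
    (hF : IsFormalHam d F) (hS : IsFormalHam e S) (h0 : 0 ≤ r') (hr : r' < r) (hA : 0 ≤ A)
    (hB : 0 ≤ B) (hSA : fieldSup r w S ≤ ENNReal.ofReal A)
    (hFB : fieldSup r w F ≤ ENNReal.ofReal B) (hq : 6 * A / (r - r') ≤ 1 / 4) :
    F.eval (Γ 1) = F.eval (Γ 0)
      + (lieTail (fun k => 1 / ((k + 1).factorial : ℝ)) S F).eval (Γ 0) := by
  have hfS : fieldSup r' w S ≠ ⊤ :=
    ne_top_of_le_ne_top ENNReal.ofReal_ne_top ((fieldSup_mono_radius hr.le w S).trans hSA)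
  have hb : Summable fun k : ℕ => 2 * r' * B * (6 * A / (r - r')) ^ (k + 1) :=
    (summable_nat_add_iff (f := fun k => 2 * r' * B * (6 * A / (r - r')) ^ k) 1).mpr
      (summable_geometric_bound hr hA hq _)
  have ht := hasSum_taylor (g := fun k t => (adIter S k F).eval (Γ t))
    (fun k T hT => by
      simp_rw [adIter_succ]
      exact h.eval_sub_eval hw h0 (hF.adIter hS k) hS (ne_top_of_le_ne_top ENNReal.ofReal_ne_top
        (fieldSup_adIter_le_factorial hF hS h0 hr hA hB hSA hFB k)) hfS hT)
    hb (fun k t ht => norm_eval_adIter_le hw hF hS h0 hr hA hB hSA hFB (h.ball t ht) (k + 1))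
  have hc : ∀ k : ℕ, (1 / ((k + 1).factorial : ℝ)) * (k + 1).factorial ≤ 1 := fun k =>
    le_of_eq (one_div_mul_cancel (by positivity))
  have h2 := ht.tsum_eq
  simp only [adIter_zero] at h2
  rw [eval_lieTail hw hF hS h0 hr hA hB hSA hFB (fun k => by positivity) hc hq
    (h.ball 0 (by simp)), h2]
  ring

/-- The transformation of the quadratic Hamiltonian under the time one flow of `S`. -/
theorem IsTrajectory.quadratic_one (h : IsTrajectory S r' Γ v) (hw : ∀ j, 1 ≤ w.toFun j)
    (hω : ∀ j, |ω j| ≤ C * w.toFun j ^ 2) (hNF : IsFormalHam d N)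
    (hN : ∀ a, N a = -Complex.I * monoFreq ω a * S a)
    (hS : IsFormalHam e S) (h0 : 0 ≤ r') (hr : r' < r) (hA : 0 ≤ A)
    (hB : 0 ≤ B) (hSA : fieldSup r w S ≤ ENNReal.ofReal A)
    (hNB : fieldSup r w N ≤ ENNReal.ofReal B) (hq : 6 * A / (r - r') ≤ 1 / 4) :
    (quadraticHam ω (Γ 1) : ℂ) = quadraticHam ω (Γ 0) - N.eval (Γ 0)
      - (lieTail (fun k => 1 / ((k + 2).factorial : ℝ)) S N).eval (Γ 0) := by
  have hfS : fieldSup r' w S ≠ ⊤ :=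
    ne_top_of_le_ne_top ENNReal.ofReal_ne_top ((fieldSup_mono_radius hr.le w S).trans hSA)
  have ht := hasSum_taylor (b := fun k => 2 * r' * B * (6 * A / (r - r')) ^ k)
    -- The chain starts at `D_ω` and continues with `-ad_S^k N`, because `{D_ω, S} = -N`. This shift
    -- by one explains the coefficients `1 / (k + 2)!` in the tail.
    (g := fun k t => Nat.casesOn k (quadraticHam ω (Γ t) : ℂ) fun k => -(adIter S k N).eval (Γ t))
    (fun k T hT => by
      cases k with
      | zero => exact h.quadratic_sub_quadratic h0 hw hω hS hfS hN hT
      | succ k =>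
        have h1 := h.eval_sub_eval hw h0 (hNF.adIter hS k) hS
          (ne_top_of_le_ne_top ENNReal.ofReal_ne_top
            (fieldSup_adIter_le_factorial hNF hS h0 hr hA hB hSA hNB k)) hfS hT
        rw [← adIter_succ] at h1
        refine ⟨h1.1.neg, ?_⟩
        simp only
        rw [intervalIntegral.integral_neg, ← h1.2]
        ring)
    (summable_geometric_bound hr hA hq _)
    (fun k t ht => by
      have hσ : 0 < r - r' := by linarith
      simp only [norm_neg]
      refine (norm_eval_adIter_le hw hNF hS h0 hr hA hB hSA hNB (h.ball t ht) k).trans ?_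
      gcongr
      omega)
  have h2 := ht.tsum_eq
  rw [ht.summable.tsum_eq_zero_add] at h2
  simp only [adIter_zero, mul_neg, tsum_neg] at h2
  rw [eval_lieTail hw hNF hS h0 hr hA hB hSA hNB (fun k => by positivity)
    factorial_coeff_le hq (h.ball 0 (by simp))]
  norm_num at h2 ⊢
  linear_combination -h2

end Transform

/-! ### Splitting of Hamiltonians and the homological equation -/

theorem totalDegree_swap (a : MultiIndex × MultiIndex) : totalDegree a.swap = totalDegree a :=
  add_comm _ _

theorem momentum_swap (a : MultiIndex × MultiIndex) : momentum a.swap = -momentum a :=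
  (neg_sub _ _).symm

theorem monoFreq_swap (ω : ℤ → ℝ) (a : MultiIndex × MultiIndex) :
    monoFreq ω a.swap = -monoFreq ω a :=
  (neg_sub _ _).symm

theorem isResonantIndex_swap (a : MultiIndex × MultiIndex) :
    IsResonantIndex a.swap ↔ IsResonantIndex a := by
  unfold IsResonantIndex
  rw [momentum_swap, neg_eq_zero]
  exact and_congr_right fun _ => forall_congr' fun j => eq_comm

open Classical in
/-- The restriction of a Hamiltonian to the monomials with a given property. -/
def Ham.restrict (p : MultiIndex × MultiIndex → Prop) (H : Ham) : Ham :=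
  fun a => if p a then H a else 0

theorem Ham.restrict_ne_zero {p : MultiIndex × MultiIndex → Prop} {H : Ham}
    {a : MultiIndex × MultiIndex} (h : H.restrict p a ≠ 0) : p a ∧ H a ≠ 0 := by
  unfold Ham.restrict at h
  split_ifs at h with hp
  · exact ⟨hp, h⟩
  · exact absurd rfl h

theorem IsFormalHam.restrict {d d' : ℕ} {H : Ham} (hH : IsFormalHam d H)
    {p : MultiIndex × MultiIndex → Prop} (hp : ∀ a, p a.swap ↔ p a)
    (hd : ∀ a, p a → H a ≠ 0 → d' + 2 ≤ totalDegree a) : IsFormalHam d' (H.restrict p) := by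
  refine ⟨fun α β => ?_, fun a ha => hH.momentum_eq a (Ham.restrict_ne_zero ha).2,
    fun a ha => hd a (Ham.restrict_ne_zero ha).1 (Ham.restrict_ne_zero ha).2⟩
  have h := hp (α, β)
  simp only [Prod.swap] at h
  unfold Ham.restrict
  by_cases hpa : p (α, β)
  · rw [if_pos hpa, if_pos (h.mpr hpa)]
    exact hH.reality α β
  · rw [if_neg hpa, if_neg (mt h.mp hpa), map_zero]

theorem fieldSup_restrict_le (p : MultiIndex × MultiIndex → Prop) (r : ℝ) (w : Weight) (H : Ham) :
    fieldSup r w (H.restrict p) ≤ fieldSup r w H := by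
  refine fieldSup_le_of_le fun a => ?_
  unfold Ham.restrict
  split_ifs
  · exact le_rfl
  · simp

/-- The solution of the homological equation with right hand side `N`. -/
def homological (ω : ℤ → ℝ) (N : Ham) : Ham := fun a => Complex.I * N a / monoFreq ω a

theorem homological_ne_zero {ω : ℤ → ℝ} {N : Ham} {a : MultiIndex × MultiIndex}
    (h : homological ω N a ≠ 0) : N a ≠ 0 := by
  intro h0
  exact h (by simp [homological, h0])

theorem IsFormalHam.homological {d : ℕ} {N : Ham} (hN : IsFormalHam d N) (ω : ℤ → ℝ) :
    IsFormalHam d (homological ω N) := by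
  refine ⟨fun α β => ?_, fun a ha => hN.momentum_eq a (homological_ne_zero ha),
    fun a ha => hN.degree a (homological_ne_zero ha)⟩
  have h := monoFreq_swap ω (α, β)
  simp only [Prod.swap] at h
  simp only [BeamBNF.homological]
  rw [hN.reality α β, h, map_div₀, map_mul, Complex.conj_I, Complex.conj_ofReal]
  push_cast
  ring

theorem homological_spec {ω : ℤ → ℝ} {N : Ham} (h : ∀ a, N a ≠ 0 → monoFreq ω a ≠ 0)
    (a : MultiIndex × MultiIndex) :
    N a = -Complex.I * monoFreq ω a * homological ω N a := by
  by_cases h0 : N a = 0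
  · simp [homological, h0]
  · have : (monoFreq ω a : ℂ) ≠ 0 := Complex.ofReal_ne_zero.mpr (h a h0)
    rw [homological]
    field_simp
    rw [Complex.I_sq]
    ring

theorem fieldSup_homological_le {ω : ℤ → ℝ} {N : Ham} {w w' : Weight} {C : ℝ} (hC : 0 ≤ C)
    (h : ∀ a j, N a ≠ 0 → a.2 j ≠ 0 → |monoFreq ω a|⁻¹ * (w'.toFun j / w.toFun j)
      ≤ C * mpow (fun i => w'.toFun i / w.toFun i) (restIndex a j)) (r : ℝ) :
    fieldSup r w' (homological ω N) ≤ ENNReal.ofReal C * fieldSup r w N := by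
  refine fieldSup_change_weight hC (fun a j haj => ?_) r
  by_cases h0 : N a = 0
  · simp [homological, h0]
  · rw [homological, norm_div, norm_mul, Complex.norm_I, one_mul, Complex.norm_real,
      Real.norm_eq_abs, div_eq_mul_inv, mul_assoc]
    calc _ ≤ ‖N a‖ * (C * mpow (fun i => w'.toFun i / w.toFun i) (restIndex a j)) := by
          exact mul_le_mul_of_nonneg_left (h a j h0 haj) (norm_nonneg _)
      _ = _ := by ring

theorem fieldSup_neg (r : ℝ) (w : Weight) (F : Ham) : fieldSup r w (-F) = fieldSup r w F :=
  le_antisymm (fieldSup_le_of_le fun a => by simp)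
    (fieldSup_le_of_le fun a => by simp)

theorem IsFormalHam.neg {d : ℕ} {F : Ham} (hF : IsFormalHam d F) : IsFormalHam d (-F) :=
  ⟨fun α β => by rw [Pi.neg_apply, Pi.neg_apply, map_neg, hF.reality α β],
    fun a ha => hF.momentum_eq a (by simpa using ha), fun a ha => hF.degree a (by simpa using ha)⟩

theorem fieldSup_add_le_ofReal {r : ℝ} {w : Weight} {F G : Ham} {a b : ℝ} (ha : 0 ≤ a)
    (hb : 0 ≤ b)
    (hF : fieldSup r w F ≤ ENNReal.ofReal a) (hG : fieldSup r w G ≤ ENNReal.ofReal b) :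
    fieldSup r w (F + G) ≤ ENNReal.ofReal (a + b) := by
  rw [ENNReal.ofReal_add ha hb]
  exact (fieldSup_add_le r w F G).trans (add_le_add hF hG)

theorem IsFormalHam.summable_eval {w : Weight} {d : ℕ} {F : Ham} (hw : ∀ j, 1 ≤ w.toFun j)
    (hF : IsFormalHam d F) {r : ℝ} (hr : 0 ≤ r) (hfin : fieldSup r w F ≠ ⊤) {u : HSpace w}
    (hu : ‖u‖ ≤ r) : Summable fun a => F a * mono u a :=
  summable_of_tsum_enorm_ne_top (ne_top_of_le_ne_top (ENNReal.mul_ne_top ENNReal.ofNat_ne_top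
    (ENNReal.mul_ne_top ENNReal.ofReal_ne_top hfin))
    (tsum_enorm_eval_le_fieldSup hw hF.reality hF.one_le hr hu))

theorem IsFormalHam.eval_add {w : Weight} {d e : ℕ} {F G : Ham} (hw : ∀ j, 1 ≤ w.toFun j)
    (hF : IsFormalHam d F) (hG : IsFormalHam e G) {r : ℝ} (hr : 0 ≤ r)
    (hfF : fieldSup r w F ≠ ⊤) (hfG : fieldSup r w G ≠ ⊤) {u : HSpace w} (hu : ‖u‖ ≤ r) :
    (F + G).eval u = F.eval u + G.eval u := by
  simp only [Ham.eval, Pi.add_apply, add_mul]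
  exact (hF.summable_eval hw hr hfF hu).tsum_add (hG.summable_eval hw hr hfG hu)

theorem Ham.eval_neg (F : Ham) (u : ℤ → ℂ) : (-F).eval u = -F.eval u := by
  simp only [Ham.eval, Pi.neg_apply, neg_mul, tsum_neg]

/-! ### One step of the normal form iteration -/

section Step

variable {w w' wf : Weight} {ω : ℤ → ℝ}

/-- The norms of Hamiltonians of positive scaling degree decrease from `w` to `w'`. -/
def FieldSupAntitone (w w' : Weight) : Prop :=
  ∀ F, IsFormalHam 1 F → ∀ r, fieldSup r w' F ≤ fieldSup r w F

/-- The small divisors of the monomials of degree `D` are controlled by the ratio of two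
weights. -/
def SmallDivisorBound (ω : ℤ → ℝ) (w w' : Weight) (D : ℕ) (L : ℝ) : Prop :=
  ∀ a, momentum a = 0 → ¬ IsResonantIndex a → totalDegree a = D → monoFreq ω a ≠ 0 ∧
    ∀ j, a.2 j ≠ 0 → |monoFreq ω a|⁻¹ * (w'.toFun j / w.toFun j)
      ≤ L * mpow (fun i => w'.toFun i / w.toFun i) (restIndex a j)

/-- Write `R = E + N + G` with `E` resonant and `N` nonresonant of degree `i + 3`, and `G` of higher
degree. The new Hamiltonian is `D_ω + (Z + E) + (G + T1 - T2)`, where `T1` and `T2` are the Lie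
tails of `Z + R` and of `N`. They are at most `2 B / 3` and `B / 3`, so both new norms are at most
`2 B`. Coefficients are estimated in `w'`, while the flow acts on the final space, in whose weight
the norms are no larger. -/
theorem exists_normal_form_step (hwf : ∀ j, 1 ≤ wf.toFun j) {c : ℝ}
    (hω : ∀ j, |ω j| ≤ c * wf.toFun j ^ 2) (hww' : FieldSupAntitone w w')
    (hwwf : FieldSupAntitone w' wf) {i : ℕ} {L : ℝ} (hL : 0 ≤ L)
    (hdiv : SmallDivisorBound ω w w' (i + 3) L) {Z R : Ham} (hZ : IsFormalHam 1 Z)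
    (hZres : IsResonant Z) (hZdeg : ScalingDegreeLE i Z) (hR : IsFormalHam (i + 1) R)
    {r r' B : ℝ} (hr' : 0 < r') (hr : r' < r) (hB : 0 ≤ B)
    (hZB : fieldSup r w Z ≤ ENNReal.ofReal B) (hRB : fieldSup r w R ≤ ENNReal.ofReal B)
    (hq : 6 * (L * B) / (r - r') ≤ 1 / 4) {s κ : ℝ} (hs : 0 < s)
    (hsmall : (((i + 2 : ℕ) : ℝ) / r) ^ (i + 2) * (L * B) * (i + 2 : ℕ) * (2 * s) ^ (i + 2 - 1)
      ≤ 1 / 2)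
    (hκ : (((i + 2 : ℕ) : ℝ) / r) ^ (i + 2) * (L * B) * (2 ^ (i + 2) * s ^ i) ≤ κ) :
    ∃ (Φ : HSpace wf → HSpace wf) (Z' R' : Ham),
      (IsFormalHam 1 Z' ∧ IsResonant Z' ∧ ScalingDegreeLE (i + 1) Z' ∧
        fieldSup r' w' Z' ≤ ENNReal.ofReal (2 * B)) ∧
      (IsFormalHam (i + 2) R' ∧ fieldSup r' w' R' ≤ ENNReal.ofReal (2 * B)) ∧
      ∀ u : HSpace wf, ‖u‖ < s → AnalyticAt ℝ Φ u ∧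
        (∀ ξ η, symplecticForm (fderiv ℝ Φ u ξ) (fderiv ℝ Φ u η) = symplecticForm ξ η) ∧
        ‖Φ u - u‖ ≤ κ * ‖u‖ ^ 2 ∧
        (‖u‖ + κ * ‖u‖ ^ 2 ≤ r' →
          (quadraticHam ω (Φ u) : ℂ) + Z.eval (Φ u) + R.eval (Φ u)
            = quadraticHam ω u + Z'.eval u + R'.eval u) := by
  set pr : MultiIndex × MultiIndex → Prop := fun a => totalDegree a = i + 3 ∧ IsResonantIndex a
  set pn : MultiIndex × MultiIndex → Prop := fun a => totalDegree a = i + 3 ∧ ¬ IsResonantIndex a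
  set ph : MultiIndex × MultiIndex → Prop := fun a => i + 3 < totalDegree a
  set N := R.restrict pn with hNdef
  set S := homological ω N with hSdef
  set E := R.restrict pr with hEdef
  set G := R.restrict ph with hGdef
  have hN : IsFormalHam (i + 1) N := hR.restrict
    (fun a => by simp only [pn]; rw [totalDegree_swap, isResonantIndex_swap])
    fun a _ ha => hR.degree a ha
  have hE : IsFormalHam (i + 1) E := hR.restrict
    (fun a => by simp only [pr]; rw [totalDegree_swap, isResonantIndex_swap])
    fun a _ ha => hR.degree a ha
  have hG : IsFormalHam (i + 2) G := hR.restrict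
    (fun a => by simp only [ph]; rw [totalDegree_swap]) fun a ha _ => by simp only [ph] at ha; omega
  have hS : IsFormalHam (i + 1) S := hN.homological ω
  have hNd : ∀ a, N a ≠ 0 → totalDegree a = i + 3 ∧ ¬ IsResonantIndex a ∧ momentum a = 0 :=
    fun a ha => ⟨(Ham.restrict_ne_zero ha).1.1, (Ham.restrict_ne_zero ha).1.2, hN.momentum_eq a ha⟩
  have hNS : ∀ a, N a = -Complex.I * monoFreq ω a * S a := homological_spec fun a ha =>
    (hdiv a (hNd a ha).2.2 (hNd a ha).2.1 (hNd a ha).1).1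
  have hsplit : Z + R = (Z + E) + (N + G) := by
    rw [add_assoc]
    congr 1
    funext a
    simp only [Pi.add_apply, hEdef, hNdef, hGdef, Ham.restrict, pr, pn, ph]
    by_cases ha : R a = 0
    · simp [ha]
    · have := hR.degree a ha
      by_cases h1 : totalDegree a = i + 3
      · by_cases h2 : IsResonantIndex a <;> simp [h1, h2]
      · have h3 : i + 3 < totalDegree a := by omega
        simp [h1, h3]
  have hfS : fieldSup r w' S ≤ ENNReal.ofReal (L * B) := by
    refine (fieldSup_homological_le hL (fun a j ha haj =>
      (hdiv a (hNd a ha).2.2 (hNd a ha).2.1 (hNd a ha).1).2 j haj) r).trans ?_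
    rw [ENNReal.ofReal_mul hL]
    gcongr
    exact (fieldSup_restrict_le _ _ _ _).trans hRB
  have hLB : 0 ≤ L * B := mul_nonneg hL hB
  have hR1 : IsFormalHam 1 R := hR.of_le (by omega)
  have hZR : IsFormalHam 1 (Z + R) := hZ.add hR1
  have hfZ : fieldSup r w' Z ≤ ENNReal.ofReal B := (hww' Z hZ r).trans hZB
  have hfR : fieldSup r w' R ≤ ENNReal.ofReal B := (hww' R hR1 r).trans hRB
  have hfN : fieldSup r w' N ≤ ENNReal.ofReal B := (fieldSup_restrict_le _ _ _ _).trans hfR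
  have hfE : fieldSup r w' E ≤ ENNReal.ofReal B := (fieldSup_restrict_le _ _ _ _).trans hfR
  have hfG : fieldSup r w' G ≤ ENNReal.ofReal B := (fieldSup_restrict_le _ _ _ _).trans hfR
  have hfZR : fieldSup r w' (Z + R) ≤ ENNReal.ofReal (B + B) :=
    fieldSup_add_le_ofReal hB hB hfZ hfR
  set T1 := lieTail (fun k => 1 / ((k + 1).factorial : ℝ)) S (Z + R) with hT1
  set T2 := lieTail (fun k => 1 / ((k + 2).factorial : ℝ)) S N with hT2
  have hT1F : IsFormalHam (i + 2) T1 := (hZR.lieTail hS _).of_le (by omega)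
  have hT2F : IsFormalHam (i + 2) T2 := (hN.lieTail hS _).of_le (by omega)
  have hfT1 : fieldSup r' w' T1 ≤ ENNReal.ofReal ((B + B) / 3) :=
    fieldSup_lieTail_le hZR hS hr'.le hr hLB (by positivity) hfS hfZR (fun k => by positivity)
      (fun k => le_of_eq (one_div_mul_cancel (by positivity))) hq
  have hfT2 : fieldSup r' w' T2 ≤ ENNReal.ofReal (B / 3) :=
    fieldSup_lieTail_le hN hS hr'.le hr hLB hB hfS hfN (fun k => by positivity)
      factorial_coeff_le hq
  have hZ'F : IsFormalHam 1 (Z + E) := hZ.add (hE.of_le (by omega))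
  have hTF : IsFormalHam (i + 2) (T1 + -T2) := hT1F.add hT2F.neg
  have hR'F : IsFormalHam (i + 2) (G + (T1 + -T2)) := hG.add hTF
  have hfZ' : fieldSup r' w' (Z + E) ≤ ENNReal.ofReal (2 * B) := by
    rw [two_mul]
    exact (fieldSup_mono_radius hr.le _ _).trans (fieldSup_add_le_ofReal hB hB hfZ hfE)
  have hfT : fieldSup r' w' (T1 + -T2) ≤ ENNReal.ofReal B := by
    have := fieldSup_add_le_ofReal (by positivity) (by positivity) hfT1
      ((fieldSup_neg r' w' T2).le.trans hfT2)
    rwa [show (B + B) / 3 + B / 3 = B by ring] at this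
  have hfR' : fieldSup r' w' (G + (T1 + -T2)) ≤ ENNReal.ofReal (2 * B) := by
    rw [two_mul]
    exact fieldSup_add_le_ofReal hB hB ((fieldSup_mono_radius hr.le _ _).trans hfG) hfT
  have hr0 : 0 < r := hr'.trans hr
  obtain ⟨Φ, Γ, hΦ, hΓ⟩ := exists_hamiltonian_flow (n := i + 2) (R := 2 * s) hwf hS.reality
    (by omega) (fun a ha => (hNd a (homological_ne_zero ha)).1) hr0 hLB
    ((hwwf S (hS.of_le (by omega)) r).trans hfS) (by positivity) hsmall
  rw [show 2 * s / 2 = s by ring] at hΦ hΓ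
  refine ⟨Φ, Z + E, G + (T1 + -T2), ⟨hZ'F, fun a ha => ?_, fun a ha => ?_, hfZ'⟩,
    ⟨hR'F, hfR'⟩, fun u hu => ?_⟩
  · rcases ne_or_eq (Z a) 0 with h | h
    · exact hZres a h
    · rw [Pi.add_apply, h, zero_add] at ha
      exact (Ham.restrict_ne_zero ha).1.2
  · rcases ne_or_eq (Z a) 0 with h | h
    · exact (hZdeg a h).trans (by omega)
    · rw [Pi.add_apply, h, zero_add] at ha
      exact (Ham.restrict_ne_zero ha).1.1.le
  obtain ⟨h0, h1, h2, v, hvc, hvd, hvf⟩ := hΓ u hu.le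
  -- The velocity has degree `i + 2` in `u`. Two powers of `‖u‖` are kept and the other `i` are
  -- bounded by powers of `s`, so the displacement is quadratic whatever `i` is.
  have hvb : ∀ t ∈ Set.Icc (0 : ℝ) 1, ‖v t‖ ≤ κ * ‖u‖ ^ 2 := by
    intro t ht
    calc ‖v t‖ ≤ (((i + 2 : ℕ) : ℝ) / r) ^ (i + 2) * (L * B) * ‖Γ u t‖ ^ (i + 2) := (hvf t ht).2
      _ ≤ (((i + 2 : ℕ) : ℝ) / r) ^ (i + 2) * (L * B) * (2 * ‖u‖) ^ (i + 2) := by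
          gcongr
          exact h2 t ht
      _ = (((i + 2 : ℕ) : ℝ) / r) ^ (i + 2) * (L * B) * (2 ^ (i + 2) * ‖u‖ ^ i) * ‖u‖ ^ 2 := by
          ring
      _ ≤ (((i + 2 : ℕ) : ℝ) / r) ^ (i + 2) * (L * B) * (2 ^ (i + 2) * s ^ i) * ‖u‖ ^ 2 := by
          gcongr
      _ ≤ κ * ‖u‖ ^ 2 := by gcongr
  have hdist : ∀ t ∈ Set.Icc (0 : ℝ) 1, ‖Γ u t - u‖ ≤ κ * ‖u‖ ^ 2 := by
    intro t ht
    have hκ0 : 0 ≤ κ * ‖u‖ ^ 2 := (norm_nonneg _).trans (hvb t ht)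
    have h3 := norm_image_sub_le_of_norm_deriv_le_segment' (f := Γ u) (f' := v) (a := 0) (b := 1)
      (fun x _ => (hvd x).hasDerivWithinAt) (fun x hx => hvb x ⟨hx.1, hx.2.le⟩) t ht
    rw [h0, sub_zero] at h3
    exact h3.trans (mul_le_of_le_one_right hκ0 ht.2)
  refine ⟨(hΦ u hu).1, (hΦ u hu).2, h1 ▸ hdist 1 (by simp), fun hur => ?_⟩
  have hball : ∀ t ∈ Set.Icc (0 : ℝ) 1, ‖Γ u t‖ ≤ r' := fun t ht => by
    have h4 : ‖Γ u t‖ ≤ ‖u‖ + ‖Γ u t - u‖ := by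
      simpa using norm_add_le u (Γ u t - u)
    linarith [hdist t ht]
  have htraj : IsTrajectory S r' (Γ u) v := ⟨hvc, hvd, hball, fun t ht => (hvf t ht).1⟩
  have hu' : ‖u‖ ≤ r' := h0 ▸ hball 0 (by simp)
  have hfin : ∀ {F : Ham} {x : ℝ}, IsFormalHam 1 F → fieldSup r' w' F ≤ ENNReal.ofReal x →
      fieldSup r' wf F ≠ ⊤ := fun {F x} hF h =>
    ne_top_of_le_ne_top ENNReal.ofReal_ne_top ((hwwf F hF r').trans h)
  have hm : ∀ {F : Ham} {x : ℝ}, fieldSup r w' F ≤ ENNReal.ofReal x →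
      fieldSup r' w' F ≤ ENNReal.ofReal x := fun h => (fieldSup_mono_radius hr.le _ _).trans h
  have hSf := (hwwf S (hS.of_le (by omega)) r).trans hfS
  have e1 := htraj.eval_one hwf hZR hS hr'.le hr hLB (by positivity) hSf
    ((hwwf _ hZR r).trans hfZR) hq
  have e2 := htraj.quadratic_one hwf hω hN hNS hS hr'.le hr hLB hB hSf
    ((hwwf _ (hN.of_le (by omega)) r).trans hfN) hq
  rw [h0, h1, ← hT1] at e1
  rw [h0, h1, ← hT2] at e2
  have hΦr : ‖Φ u‖ ≤ r' := h1 ▸ hball 1 (by simp)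
  have s1 : (Z + R).eval (Φ u) = Z.eval (Φ u) + R.eval (Φ u) :=
    hZ.eval_add hwf hR hr'.le (hfin hZ (hm hfZ)) (hfin hR1 (hm hfR)) hΦr
  have hN1 : IsFormalHam 1 N := hN.of_le (by omega)
  have hG1 : IsFormalHam 1 G := hG.of_le (by omega)
  have hNGf : fieldSup r w' (N + G) ≤ ENNReal.ofReal (B + B) :=
    fieldSup_add_le_ofReal hB hB hfN hfG
  have s2 : (Z + R).eval u = (Z + E).eval u + (N.eval u + G.eval u) := by
    rw [hsplit, hZ'F.eval_add hwf (hN1.add hG1) hr'.le (hfin hZ'F hfZ')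
      (hfin (hN1.add hG1) (hm hNGf)) hu', hN1.eval_add hwf hG1 hr'.le (hfin hN1 (hm hfN))
      (hfin hG1 (hm hfG)) hu']
  have s3 : (G + (T1 + -T2)).eval u = G.eval u + (T1.eval u - T2.eval u) := by
    rw [hG.eval_add hwf hTF hr'.le (hfin hG1 (hm hfG)) (hfin (hTF.of_le (by omega)) hfT) hu',
      hT1F.eval_add hwf hT2F.neg hr'.le (hfin (hT1F.of_le (by omega)) hfT1)
        (hfin (hT2F.neg.of_le (by omega)) ((fieldSup_neg r' w' T2).le.trans hfT2)) hu',
      Ham.eval_neg]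
    ring
  rw [s3]
  linear_combination e1 + e2 - s1 + s2

end Step

/-! ### Iteration of the normal form step -/

section Iteration

/-- The factors `8/3` and `4/3` are rounded up to `3` and `3/2`; the radii of the iteration stay
between `3 ρ / 4` and `ρ`. -/
theorem pow_ratio_le {x r ρ s : ℝ} (hx : 0 ≤ x) (hρ : 0 < ρ) (hr : 3 / 4 * ρ ≤ r)
    (hs : s ≤ ρ) : x / r * (2 * s) ≤ 3 * x ∧ x / r ≤ 3 * x / (2 * ρ) := by
  have hr0 : 0 < r := lt_of_lt_of_le (by positivity) hr
  constructor
  · rw [div_mul_eq_mul_div, div_le_iff₀ hr0]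
    nlinarith
  · rw [div_le_div_iff₀ hr0 (by positivity)]
    nlinarith

theorem flow_smallness {x r ρ s X : ℝ} (i : ℕ) (hx : 0 ≤ x) (hρ : 0 < ρ) (hr : 3 / 4 * ρ ≤ r)
    (hs0 : 0 ≤ s) (hs : s ≤ ρ) (hX : 0 ≤ X) :
    (x / r) ^ (i + 2) * X * x * (2 * s) ^ (i + 1) ≤ (3 * x) ^ (i + 2) * x * X / (2 * ρ) := by
  obtain ⟨h1, h2⟩ := pow_ratio_le hx hρ hr hs
  have hr0 : 0 < r := lt_of_lt_of_le (by positivity) hr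
  calc (x / r) ^ (i + 2) * X * x * (2 * s) ^ (i + 1)
      = (x / r * (2 * s)) ^ (i + 1) * (x / r) * (X * x) := by rw [mul_pow]; ring
    _ ≤ (3 * x) ^ (i + 1) * (3 * x / (2 * ρ)) * (X * x) := by gcongr
    _ = _ := by ring

theorem flow_displacement {x r ρ s X : ℝ} (i : ℕ) (hx : 0 ≤ x) (hρ : 0 < ρ) (hr : 3 / 4 * ρ ≤ r)
    (hs0 : 0 ≤ s) (hs : s ≤ ρ) (hX : 0 ≤ X) :
    (x / r) ^ (i + 2) * X * (2 ^ (i + 2) * s ^ i) ≤ (3 * x) ^ (i + 2) * X / ρ ^ 2 := by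
  obtain ⟨h1, h2⟩ := pow_ratio_le hx hρ hr hs
  have hr0 : 0 < r := lt_of_lt_of_le (by positivity) hr
  calc (x / r) ^ (i + 2) * X * (2 ^ (i + 2) * s ^ i)
      = (x / r * (2 * s)) ^ i * (x / r) ^ 2 * (4 * X) := by rw [mul_pow, mul_pow]; ring
    _ ≤ (3 * x) ^ i * (3 * x / (2 * ρ)) ^ 2 * (4 * X) := by gcongr
    _ = _ := by field_simp; ring

theorem fieldSupAntitone_chain {W : ℕ → Weight} {K : ℕ}
    (hW : ∀ i < K, FieldSupAntitone (W i) (W (i + 1))) {i : ℕ} (hi : i ≤ K) :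
    FieldSupAntitone (W i) (W K) := by
  induction K, hi using Nat.le_induction with
  | base => exact fun F _ r => le_rfl
  | succ K hK ih =>
    intro F hF r
    exact (hW K (Nat.lt_succ_self K) F hF r).trans (ih (fun j hj => hW j (by omega)) F hF r)

/-- The result of the first `i` steps of the normal form procedure, with Hamiltonians controlled on
the ball of radius `r` by `B` in the weight `w`, and a change of variables of `h_{wf}` defined on
the open ball of radius `s` and at quadratic distance from the identity. -/
def NormalFormAt (ω : ℤ → ℝ) (R₀ : Ham) (wf w : Weight) (i : ℕ) (r B s κ : ℝ) : Prop :=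
  ∃ (Ψ : HSpace wf → HSpace wf) (Z R : Ham),
    (IsFormalHam 1 Z ∧ IsResonant Z ∧ ScalingDegreeLE i Z ∧
      fieldSup r w Z ≤ ENNReal.ofReal B) ∧
    (IsFormalHam (i + 1) R ∧ fieldSup r w R ≤ ENNReal.ofReal B) ∧
    ∀ u : HSpace wf, ‖u‖ < s → AnalyticAt ℝ Ψ u ∧
      (∀ ξ η, symplecticForm (fderiv ℝ Ψ u ξ) (fderiv ℝ Ψ u η) = symplecticForm ξ η) ∧
      ‖Ψ u - u‖ ≤ κ * ‖u‖ ^ 2 ∧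
      (quadraticHam ω (Ψ u) : ℂ) + R₀.eval (Ψ u)
        = quadraticHam ω u + Z.eval u + R.eval u

/-- The new map is the inner one. It moves points by at most `κ s' ^ 2`, so it stays in the domain
of the old map, and by `κ s' ≤ 1` it at most doubles the norm. The square of this doubling is the
`4` in `4 κ' + κ`. -/
theorem NormalFormAt.step {ω : ℤ → ℝ} {R₀ : Ham} {wf w w' : Weight} {i : ℕ} {r r' B s s' κ κ' : ℝ}
    (h : NormalFormAt ω R₀ wf w i r B s κ')
    (hwf : ∀ j, 1 ≤ wf.toFun j) {c : ℝ} (hω : ∀ j, |ω j| ≤ c * wf.toFun j ^ 2)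
    (hww' : FieldSupAntitone w w') (hwwf : FieldSupAntitone w' wf) {L : ℝ} (hL : 0 ≤ L)
    (hdiv : SmallDivisorBound ω w w' (i + 3) L) (hr' : 0 < r') (hr : r' < r) (hB : 0 ≤ B)
    (hq : 6 * (L * B) / (r - r') ≤ 1 / 4) (hs : 0 < s')
    (hsmall : (((i + 2 : ℕ) : ℝ) / r) ^ (i + 2) * (L * B) * (i + 2 : ℕ) * (2 * s') ^ (i + 1)
      ≤ 1 / 2)
    (hκ : (((i + 2 : ℕ) : ℝ) / r) ^ (i + 2) * (L * B) * (2 ^ (i + 2) * s' ^ i) ≤ κ)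
    (hκ0 : 0 ≤ κ') (hs'r : s' + κ * s' ^ 2 ≤ r') (hs's : s' + κ * s' ^ 2 ≤ s)
    (hκs : κ * s' ≤ 1) : NormalFormAt ω R₀ wf w' (i + 1) r' (2 * B) s' (4 * κ' + κ) := by
  obtain ⟨Ψ, Z, R, ⟨hZ, hZres, hZdeg, hZB⟩, ⟨hR, hRB⟩, hΨ⟩ := h
  obtain ⟨Φ, Z', R', hZ', hR', hΦ⟩ := exists_normal_form_step hwf hω hww' hwwf hL hdiv hZ hZres
    hZdeg hR hr' hr hB hZB hRB hq hs hsmall hκ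
  refine ⟨Ψ ∘ Φ, Z', R', hZ', hR', fun u hu => ?_⟩
  obtain ⟨h1, h2, h3, h4⟩ := hΦ u hu
  have hκp : 0 ≤ κ := by
    have hr0 : 0 < r := hr'.trans hr
    exact le_trans (by positivity) hκ
  have hle : ‖u‖ + κ * ‖u‖ ^ 2 < s' + κ * s' ^ 2 := by
    have : κ * ‖u‖ ^ 2 ≤ κ * s' ^ 2 := by gcongr
    linarith
  have hΦu : ‖Φ u‖ ≤ ‖u‖ + κ * ‖u‖ ^ 2 := by
    have : ‖Φ u‖ ≤ ‖u‖ + ‖Φ u - u‖ := by simpa using norm_add_le u (Φ u - u)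
    linarith
  obtain ⟨g1, g2, g3, g4⟩ := hΨ (Φ u) (by linarith)
  have hder : fderiv ℝ (Ψ ∘ Φ) u = (fderiv ℝ Ψ (Φ u)).comp (fderiv ℝ Φ u) :=
    fderiv_comp u g1.differentiableAt h1.differentiableAt
  refine ⟨g1.comp h1, fun ξ η => ?_, ?_, ?_⟩
  · rw [hder, ContinuousLinearMap.comp_apply, ContinuousLinearMap.comp_apply, g2, h2]
  · have h5 : ‖Φ u‖ ≤ 2 * ‖u‖ := by
      have : κ * ‖u‖ ≤ 1 := le_trans (by gcongr) hκs
      nlinarith [norm_nonneg u]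
    calc ‖(Ψ ∘ Φ) u - u‖ ≤ ‖Ψ (Φ u) - Φ u‖ + ‖Φ u - u‖ := norm_sub_le_norm_sub_add_norm_sub ..
      _ ≤ κ' * (2 * ‖u‖) ^ 2 + κ * ‖u‖ ^ 2 := by
          gcongr
          exact g3.trans (by gcongr)
      _ = _ := by ring
  · rw [Function.comp_apply, g4, h4 (by linarith)]

/-- `Q` collects the combinatorial factors of the flow and the growth `2 ^ i` of the norms. Each
step loses the radius `ρ / (4 K)`, and the Lie series requires `6 L B · 4 K / ρ ≤ 1 / 4`; this is
the constant `96 K`. -/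
theorem normalFormAt_of_smallness {ω : ℤ → ℝ} {R₀ : Ham} {W : ℕ → Weight} {K : ℕ} (hK : 1 ≤ K)
    (hwf : ∀ j, 1 ≤ (W K).toFun j) {c : ℝ} (hω : ∀ j, |ω j| ≤ c * (W K).toFun j ^ 2)
    (hW : ∀ i < K, FieldSupAntitone (W i) (W (i + 1))) {L : ℝ} (hL : 0 ≤ L)
    (hdiv : ∀ i < K, SmallDivisorBound ω (W i) (W (i + 1)) (i + 3) L) (hR₀ : IsFormalHam 1 R₀)
    {ρ η Q : ℝ} (hρ : 0 < ρ) (hη : 0 ≤ η) (hR₀η : fieldSup ρ (W 0) R₀ ≤ ENNReal.ofReal η)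
    (hQ : ∀ i < K, (3 * ((i + 2 : ℕ) : ℝ)) ^ (i + 2) * (i + 2 : ℕ) * 2 ^ i ≤ Q)
    (hsmall : 96 * K * Q * L * η ≤ ρ) :
    NormalFormAt ω R₀ (W K) (W K) K (3 / 4 * ρ) (2 ^ K * η) (5 / 8 * ρ)
      (5 ^ K * (Q * L * η / ρ ^ 2)) := by
  have hK0 : (1 : ℝ) ≤ K := by exact_mod_cast hK
  have hQ1 : 1 ≤ Q := le_trans (by norm_num) (hQ 0 hK)
  have hX : 0 ≤ Q * L * η := by positivity
  have hsmall' : Q * L * η ≤ ρ / (96 * K) := by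
    rw [le_div_iff₀ (by positivity)]
    linarith
  -- The domain of the change of variables is kept `ρ / (8 K)` inside the ball of the Hamiltonians,
  -- a margin that also bounds the displacement in one step. The factor `5 ^ i` is chosen because `4
  -- · 5 ^ i + 1 ≤ 5 ^ (i + 1)`.
  have key : ∀ i ≤ K, NormalFormAt ω R₀ (W K) (W i) i (ρ * (1 - i / (4 * K))) (2 ^ i * η)
      (ρ * (1 - i / (4 * K)) - ρ / (8 * K)) (5 ^ i * (Q * L * η / ρ ^ 2)) := by
    intro i
    induction i with
    | zero =>
      intro _
      refine ⟨id, 0, R₀, ⟨⟨fun α β => by simp, fun a ha => absurd rfl ha, fun a ha => absurd rfl ha⟩,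
        fun a ha => absurd rfl ha, fun a ha => absurd rfl ha, ?_⟩, ⟨hR₀, by simpa using hR₀η⟩,
        fun u _ => ⟨analyticAt_id, fun ξ η => by simp, ?_, by simp [Ham.eval]⟩⟩
      · refine le_trans (fieldSup_le_of_le (G := R₀) fun a => by simp) (by simpa using hR₀η)
      · simp only [id_eq, sub_self, norm_zero]
        positivity
    | succ i ih =>
      intro hi
      have hiK : (i : ℝ) + 1 ≤ K := by exact_mod_cast hi
      set r := ρ * (1 - i / (4 * K)) with hr
      set r' := ρ * (1 - (i + 1 : ℕ) / (4 * K)) with hr'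
      have hrr' : r - r' = ρ / (4 * K) := by rw [hr, hr']; push_cast; field_simp; ring
      have h34 : 3 / 4 * ρ ≤ r' := by
        have : ((i + 1 : ℕ) : ℝ) / (4 * K) ≤ 1 / 4 := by
          rw [div_le_iff₀ (by positivity)]; push_cast; linarith
        rw [hr']; nlinarith
      have hr'ρ : r' ≤ ρ := by
        have : 0 ≤ ((i + 1 : ℕ) : ℝ) / (4 * K) := by positivity
        rw [hr']; nlinarith
      have h4 : 0 < ρ / (4 * K) := by positivity
      have h8 : ρ / (8 * K) = ρ / (4 * K) / 2 := by field_simp; norm_num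
      have h8' : ρ / (8 * K) ≤ ρ / 8 := by
        gcongr; linarith
      have h96 : ρ / (96 * K) ≤ ρ / (8 * K) := by gcongr; norm_num
      set s' := r' - ρ / (8 * K) with hs'
      have hs'0 : 0 < s' := by linarith
      have hs'ρ : s' ≤ ρ := by linarith
      have hκs : Q * L * η / ρ ^ 2 * s' ^ 2 ≤ ρ / (8 * K) := by
        rw [div_mul_eq_mul_div, div_le_iff₀ (by positivity)]
        calc Q * L * η * s' ^ 2 ≤ ρ / (8 * K) * ρ ^ 2 := by gcongr; linarith
          _ = _ := rfl
      have hq0 := hQ i (by omega)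
      have hLB : 0 ≤ L * (2 ^ i * η) := by positivity
      have hn1 : (1 : ℝ) ≤ (i + 2 : ℕ) := by push_cast; linarith [(Nat.cast_nonneg i : (0 : ℝ) ≤ i)]
      have hn3 : (1 : ℝ) ≤ (3 * ((i + 2 : ℕ) : ℝ)) ^ (i + 2) := one_le_pow₀ (by linarith)
      have hB2 : (2 : ℝ) ^ i * (L * η) ≤ Q * (L * η) := by
        gcongr
        refine le_trans ?_ hq0
        exact le_mul_of_one_le_left (by positivity) (one_le_mul_of_one_le_of_one_le hn3 hn1)
      have hstep := (ih (by omega)).step (w' := W (i + 1)) (r' := r') (s' := s')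
        (κ := Q * L * η / ρ ^ 2) hwf hω (hW i (by omega)) (fieldSupAntitone_chain hW hi) hL
        (hdiv i (by omega)) (by linarith) (by linarith) (by positivity) (by
          rw [hrr', div_le_iff₀ h4, show 1 / 4 * (ρ / (4 * K)) = 6 * (ρ / (96 * K)) by
            field_simp; norm_num]
          linarith) hs'0
        ((flow_smallness i (by positivity) hρ (by linarith) hs'0.le hs'ρ hLB).trans (by
          rw [div_le_iff₀ (by positivity)]
          calc _ = (3 * ((i + 2 : ℕ) : ℝ)) ^ (i + 2) * (i + 2 : ℕ) * 2 ^ i * (L * η) := by ring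
            _ ≤ Q * (L * η) := by gcongr
            _ ≤ ρ / (8 * K) := by linarith
            _ ≤ _ := by linarith))
        ((flow_displacement i (by positivity) hρ (by linarith) hs'0.le hs'ρ hLB).trans (by
          refine div_le_div_of_nonneg_right ?_ (by positivity)
          calc _ = (3 * ((i + 2 : ℕ) : ℝ)) ^ (i + 2) * 1 * 2 ^ i * (L * η) := by ring
            _ ≤ (3 * ((i + 2 : ℕ) : ℝ)) ^ (i + 2) * (i + 2 : ℕ) * 2 ^ i * (L * η) := by gcongr
            _ ≤ Q * (L * η) := by gcongr
            _ = _ := by ring))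
        (by positivity) (by linarith) (by linarith) (by
          rw [div_mul_eq_mul_div, div_le_iff₀ (by positivity)]
          calc Q * L * η * s' ≤ ρ * ρ := by
                gcongr
                linarith
            _ = _ := by ring)
      obtain ⟨Ψ, Z, R, hZ, hR, hΨ⟩ := hstep
      refine ⟨Ψ, Z, R, ?_, ?_, fun u hu => ⟨(hΨ u hu).1, (hΨ u hu).2.1,
        (hΨ u hu).2.2.1.trans ?_, (hΨ u hu).2.2.2⟩⟩
      · rwa [pow_succ', mul_assoc]
      · rwa [pow_succ', mul_assoc]
      · have h5 : (1 : ℝ) ≤ 5 ^ i := one_le_pow₀ (by norm_num)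
        have h6 : 0 ≤ Q * L * η / ρ ^ 2 := by positivity
        refine mul_le_mul_of_nonneg_right ?_ (by positivity)
        rw [pow_succ (5 : ℝ)]
        nlinarith
  obtain ⟨Ψ, Z, R, hZ, hR, hΨ⟩ := key K le_rfl
  have e : ρ * (1 - K / (4 * K)) = 3 / 4 * ρ := by field_simp; norm_num
  rw [e] at hZ hR hΨ
  refine ⟨Ψ, Z, R, hZ, hR, fun u hu => hΨ u (hu.trans_le ?_)⟩
  have : ρ / (8 * K) ≤ ρ / 8 := by gcongr; linarith
  linarith

end Iteration

/-! ### From the iteration to the normal form -/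

/-- Summing `α_j + α_{-j} = β_j + β_{-j}` over all `j` gives `2 |α| = 2 |β|`. -/
theorem IsResonantIndex.even_totalDegree {a : MultiIndex × MultiIndex} (h : IsResonantIndex a) :
    Even (totalDegree a) := by
  have hs : ∀ κ : MultiIndex, HasSum (fun j => κ j) (κ.sum fun _ n => n) := fun κ =>
    hasSum_sum_of_ne_finset_zero fun j hj => Finsupp.notMem_support_iff.mp hj
  have hs' : ∀ κ : MultiIndex, HasSum (fun j => κ (-j)) (κ.sum fun _ n => n) := fun κ =>
    (Equiv.neg ℤ).hasSum_iff.mpr (hs κ)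
  have h1 := (hs a.1).add (hs' a.1)
  have h2 := (hs a.2).add (hs' a.2)
  rw [show (fun j => a.1 j + a.1 (-j)) = fun j => a.2 j + a.2 (-j) from funext h.2] at h1
  have h3 := h1.unique h2
  exact ⟨a.2.sum fun _ n => n, by unfold totalDegree; omega⟩

/-- Parity excludes resonant monomials of degree three. This is why `Z` is of order `r₀ ^ 2` and not
`r₀`. -/
theorem IsResonant.isFormalHam_two {Z : Ham} (hZ : IsResonant Z) (h : IsFormalHam 1 Z) :
    IsFormalHam 2 Z := by
  refine ⟨h.reality, h.momentum_eq, fun a ha => ?_⟩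
  have h1 := h.degree a ha
  obtain ⟨k, hk⟩ := (hZ a ha).even_totalDegree
  omega

theorem isRegular_of_fieldSup_le {w : Weight} (hw : ∀ j, 1 ≤ w.toFun j) {d : ℕ} {F : Ham}
    (hF : IsFormalHam d F) {r r' B : ℝ} (hr' : 0 < r') (hr : r' ≤ r)
    (hB : fieldSup r w F ≤ ENNReal.ofReal B) :
    IsRegular r' w F ∧
      hamNorm r' w F ≤ ENNReal.ofReal ((r' / r) ^ (d + 1) * B / r') := by
  have hr0 : 0 < r := hr'.trans_le hr
  have h1 : fieldSup r' w F ≤ ENNReal.ofReal ((r' / r) ^ (d + 1) * B) := by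
    have h2 := fieldSup_scale_le hF.degree (θ := r' / r) (by positivity)
      ((div_le_one hr0).mpr hr) r w
    rw [div_mul_cancel₀ _ hr0.ne'] at h2
    refine h2.trans ?_
    rw [ENNReal.ofReal_mul (by positivity), ENNReal.ofReal_pow (by positivity)]
    gcongr
  have h3 : hamNorm r' w F ≤ ENNReal.ofReal ((r' / r) ^ (d + 1) * B / r') := by
    rw [hamNorm_eq hw hr'.le, ENNReal.ofReal_div_of_pos hr']
    gcongr
  refine ⟨⟨⟨fun a ha => le_trans (by omega) (hF.degree a ha), hF.reality, hF.momentum_eq,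
    fun u hu => ?_⟩, h3.trans_lt ENNReal.ofReal_lt_top⟩, h3⟩
  simp_rw [← norm_mul]
  exact (hF.summable_eval hw hr'.le (ne_top_of_le_ne_top ENNReal.ofReal_ne_top h1) hu).norm

/-- The change of variables and the estimates of the normal form, given the control of the small
divisors along a chain of weights. -/
theorem exists_normal_form {ω : ℤ → ℝ} {W : ℕ → Weight} {K : ℕ} (hK : 1 ≤ K)
    (hw₀ : ∀ j, 1 ≤ (W 0).toFun j)
    (hwf : ∀ j, 1 ≤ (W K).toFun j) {c : ℝ} (hω : ∀ j, |ω j| ≤ c * (W K).toFun j ^ 2)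
    (hW : ∀ i < K, FieldSupAntitone (W i) (W (i + 1))) {L : ℝ} (hL : 0 ≤ L)
    (hdiv : ∀ i < K, SmallDivisorBound ω (W i) (W (i + 1)) (i + 3) L) {Q J : ℝ}
    (hQ : ∀ i < K, (3 * ((i + 2 : ℕ) : ℝ)) ^ (i + 2) * (i + 2 : ℕ) * 2 ^ i ≤ Q)
    (hJ : 96 * K * Q * L ≤ J) (hJ5 : 5 ^ K * Q * L ≤ J) (hJ1 : 1 ≤ J)
    {rbar : ℝ} (hrbar : 0 < rbar) {R₀ : Ham} (hR₀ : IsRegular rbar (W 0) R₀)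
    (hdeg : ScalingDegreeGE 1 R₀) {ρ : ℝ} (hρ : ρ = (hamNorm rbar (W 0) R₀).toReal) (hρ1 : ρ ≤ 1)
    {r₀ : ℝ} (hr₀ : 0 < r₀) (hr₀' : r₀ ≤ rStar rbar ρ J K) :
    ∃ Φ : HSpace (W K) → HSpace (W K),
      IsSymplecticOn Φ (Metric.closedBall 0 (r₀ / 2)) ∧
      Set.MapsTo Φ (Metric.closedBall 0 (r₀ / 2)) (Metric.closedBall 0 r₀) ∧
      (∀ u ∈ Metric.closedBall (0 : HSpace (W K)) (r₀ / 2),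
        ‖Φ u - u‖ ≤ constOne rbar ρ J * r₀ ^ 2) ∧
      constOne rbar ρ J * r₀ ^ 2 ≤ r₀ / 8 ∧
      ∃ Z R : Ham,
        (IsRegular (r₀ / 2) (W K) Z ∧ IsResonant Z ∧ ScalingDegreeLE K Z) ∧
        (IsRegular (r₀ / 2) (W K) R ∧ ScalingDegreeGE (K + 1) R) ∧
        (∀ u ∈ Metric.closedBall (0 : HSpace (W K)) (r₀ / 2),
          (quadraticHam ω (Φ u) : ℂ) + R₀.eval (Φ u)
            = (quadraticHam ω u : ℂ) + Z.eval u + R.eval u) ∧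
        hamNorm (r₀ / 2) (W K) Z ≤ ENNReal.ofReal (constTwo rbar ρ J K * r₀ ^ 2) ∧
        hamNorm (r₀ / 2) (W K) R ≤ ENNReal.ofReal (constThree rbar ρ J K * r₀ ^ (K + 1)) := by
  have hρ0 : 0 ≤ ρ := hρ ▸ ENNReal.toReal_nonneg
  have hK1 : (1 : ℝ) ≤ K := by exact_mod_cast hK
  have he1 : (1 : ℝ) ≤ Real.exp 1 := Real.one_le_exp zero_le_one
  have h4K : (1 : ℝ) ≤ 4 ^ (K + 3) := one_le_pow₀ (by norm_num)
  -- The iteration runs on the ball of radius `rs = rbar / P`, independent of `r₀`. There the field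
  -- of `R₀` is at most `η = ρ rs ^ 2 / rbar`, and smallness follows from `96 K Q L ρ ≤ ρ J ≤ P`.
  -- The maximum with one keeps `rs ≤ rbar`; as `J ≥ 1` and `ρ ≤ 1`, one still has `P ≤ J`.
  set P := max 1 (ρ * J) with hP
  have hP1 : 1 ≤ P := le_max_left _ _
  have hP0 : 0 < P := by linarith
  have hPJ : ρ * J ≤ P := le_max_right _ _
  have hPJ' : P ≤ J := max_le hJ1 (mul_le_of_le_one_left (by linarith) hρ1)
  set rs := rbar / P with hrs
  have hrs0 : 0 < rs := by positivity
  -- Only these two consequences of the threshold are used.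
  have hr₀b : r₀ ≤ rbar ∧ ρ / rbar * J * r₀ ≤ 1 / 8 := by
    rw [rStar] at hr₀'
    split_ifs at hr₀' with h0
    · exact ⟨hr₀', by rw [h0]; norm_num⟩
    · have hρpos : 0 < ρ := lt_of_le_of_ne hρ0 (Ne.symm h0)
      refine ⟨hr₀'.trans (min_le_left _ _), ?_⟩
      have h1 := hr₀'.trans (min_le_right _ _)
      rw [le_inv_comm₀ hr₀ (by positivity)] at h1
      have h2 : ρ / rbar * J * 32 ≤ r₀⁻¹ := by
        refine le_trans ?_ h1
        calc ρ / rbar * J * 32 = 1 * ρ / rbar * J * (32 * 1 * 1) := by ring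
          _ ≤ _ := by gcongr
      have h3 := mul_le_mul_of_nonneg_right h2 hr₀.le
      rw [inv_mul_cancel₀ hr₀.ne'] at h3
      linarith
  have hC1 : constOne rbar ρ J * r₀ ^ 2 ≤ r₀ / 8 := by
    rw [constOne]
    nlinarith [hr₀b.2]
  have hr₀s : r₀ ≤ rs := by
    rw [hrs, le_div_iff₀ hP0, hP, mul_max_of_nonneg _ _ hr₀.le]
    refine max_le (by linarith [hr₀b.1]) ?_
    have h2 : ρ / rbar * J * r₀ ≤ 1 := by linarith [hr₀b.2]
    rw [div_mul_eq_mul_div, div_mul_eq_mul_div, div_le_iff₀ hrbar] at h2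
    linarith
  have hfR : fieldSup rbar (W 0) R₀ = ENNReal.ofReal (ρ * rbar) := by
    have h1 : hamNorm rbar (W 0) R₀ = ENNReal.ofReal ρ := by
      rw [hρ, ENNReal.ofReal_toReal hR₀.2.ne]
    rw [hamNorm_eq hw₀ hrbar.le] at h1
    rw [ENNReal.ofReal_mul hρ0, ← h1, ENNReal.div_mul_cancel (by simpa using hrbar)
      ENNReal.ofReal_ne_top]
  have hR₀F : IsFormalHam 1 R₀ := ⟨hR₀.1.reality, hR₀.1.momentum_eq, hdeg⟩
  set η := ρ * rs ^ 2 / rbar with hη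
  have hη0 : 0 ≤ η := by positivity
  have hR₀η : fieldSup rs (W 0) R₀ ≤ ENNReal.ofReal η := by
    have h1 := fieldSup_scale_le hdeg (θ := P⁻¹) (by positivity) (inv_le_one_of_one_le₀ hP1) rbar
      (W 0)
    rw [inv_mul_eq_div, hfR, ← ENNReal.ofReal_pow (by positivity),
      ← ENNReal.ofReal_mul (by positivity)] at h1
    refine h1.trans_eq ?_
    congr 1
    rw [hη, hrs, inv_pow]
    field_simp
    ring
  have hQ0 : 0 ≤ Q := le_trans (by positivity) (hQ 0 hK)
  have hsmall : 96 * K * Q * L * η ≤ rs := by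
    calc 96 * K * Q * L * η = (96 * K * Q * L * ρ) * (rs ^ 2 / rbar) := by rw [hη]; ring
      _ ≤ P * (rs ^ 2 / rbar) := by
          refine mul_le_mul_of_nonneg_right (le_trans ?_ hPJ) (by positivity)
          rw [mul_comm ρ]
          gcongr
      _ = rs := by rw [hrs]; field_simp
  obtain ⟨Φ, Z, R, ⟨hZ, hZres, hZdeg, hZB⟩, ⟨hR, hRB⟩, hΦ⟩ :=
    normalFormAt_of_smallness hK hwf hω hW hL hdiv hR₀F hrs0 hη0 hR₀η hQ hsmall
  have hu : ∀ u ∈ Metric.closedBall (0 : HSpace (W K)) (r₀ / 2), ‖u‖ ≤ r₀ / 2 := fun u hu => by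
    simpa using hu
  have hu' : ∀ u ∈ Metric.closedBall (0 : HSpace (W K)) (r₀ / 2), ‖u‖ < 5 / 8 * rs := fun u h => by
    linarith [hu u h]
  have hdist : ∀ u ∈ Metric.closedBall (0 : HSpace (W K)) (r₀ / 2),
      ‖Φ u - u‖ ≤ constOne rbar ρ J * r₀ ^ 2 := by
    intro u h
    refine (hΦ u (hu' u h)).2.2.1.trans ?_
    have e : 5 ^ K * (Q * L * η / rs ^ 2) = 5 ^ K * Q * L * (ρ / rbar) := by
      rw [hη]; field_simp
    rw [e, constOne, mul_comm (ρ / rbar) J]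
    have h1 : ‖u‖ ≤ r₀ := by linarith [hu u h]
    gcongr
  -- Restriction from radius `3 rs / 4` to `r₀ / 2` gains the power `3` of the ratio for `Z`, of
  -- scaling degree at least two, and the power `K + 2` for `R`. Division by the radius leaves `r₀ ^
  -- 2` and `r₀ ^ (K + 1)`.
  have hr34 : r₀ / 2 ≤ 3 / 4 * rs := by linarith
  obtain ⟨hZreg, hZn⟩ := isRegular_of_fieldSup_le hwf (hZres.isFormalHam_two hZ)
    (by positivity) hr34 hZB
  obtain ⟨hRreg, hRn⟩ := isRegular_of_fieldSup_le hwf hR (by positivity) hr34 hRB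
  have hratio : r₀ / 2 / (3 / 4 * rs) ≤ r₀ / rs := by
    rw [div_le_div_iff₀ (by positivity) hrs0]
    nlinarith [mul_pos hr₀ hrs0]
  refine ⟨Φ, ⟨fun u h => (hΦ u (hu' u h)).1, fun u h => (hΦ u (hu' u h)).2.1⟩, fun u h => ?_,
    hdist, hC1, Z, R, ⟨hZreg, hZres, hZdeg⟩, ⟨hRreg, hR.degree⟩,
    fun u h => (hΦ u (hu' u h)).2.2.2, hZn.trans (ENNReal.ofReal_le_ofReal ?_),
    hRn.trans (ENNReal.ofReal_le_ofReal ?_)⟩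
  · have h1 : ‖Φ u‖ ≤ ‖u‖ + ‖Φ u - u‖ := by simpa using norm_add_le u (Φ u - u)
    rw [mem_closedBall_zero_iff]
    linarith [hdist u h, hu u h]
  · calc (r₀ / 2 / (3 / 4 * rs)) ^ (2 + 1) * (2 ^ K * η) / (r₀ / 2)
        ≤ (r₀ / rs) ^ (2 + 1) * (2 ^ K * η) / (r₀ / 2) := by gcongr
      _ = 2 * 2 ^ K * ρ * P / rbar ^ 2 * r₀ ^ 2 := by
          rw [hη, hrs, div_pow, div_pow]
          field_simp
          ring
      _ ≤ 16 * 4 ^ (K + 1) * ρ * J / rbar ^ 2 * r₀ ^ 2 := by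
          gcongr
          · norm_num
          · exact (pow_le_pow_left₀ (by norm_num) (by norm_num) K).trans
              (pow_le_pow_right₀ (by norm_num) (by omega))
      _ = 16 * 1 * 1 * ρ * 4 ^ (K + 1) / rbar ^ 2 * J * r₀ ^ 2 := by ring
      _ ≤ constTwo rbar ρ J K * r₀ ^ 2 := by
          rw [constTwo]
          gcongr
  · calc (r₀ / 2 / (3 / 4 * rs)) ^ (K + 1 + 1) * (2 ^ K * η) / (r₀ / 2)
        ≤ (r₀ / rs) ^ (K + 1 + 1) * (2 ^ K * η) / (r₀ / 2) := by gcongr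
      _ = ρ * (2 * 2 ^ K) / rbar ^ (K + 1) * P ^ K * r₀ ^ (K + 1) := by
          rw [hη, hrs, div_pow, div_pow, pow_succ P (K + 1), pow_succ P K, pow_succ rbar (K + 1),
            pow_succ rbar K, pow_succ r₀ (K + 1)]
          field_simp
      _ ≤ ρ * (16 * 1 * 1 * 4 ^ (K + 2)) ^ K / rbar ^ (K + 1) * J ^ K * r₀ ^ (K + 1) := by
          gcongr
          have h5 : (2 : ℝ) ≤ 2 ^ K := le_self_pow₀ (by norm_num) (by omega)
          calc (2 : ℝ) * 2 ^ K ≤ 2 ^ K * 2 ^ K := by gcongr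
            _ = (4 * 1) ^ K := by rw [← mul_pow]; norm_num
            _ ≤ _ := by
              gcongr
              · norm_num
              · exact one_le_pow₀ (by norm_num)
      _ ≤ constThree rbar ρ J K * r₀ ^ (K + 1) := by
          rw [constThree]
          gcongr

/-! ### Weighted lengths of multi-indices -/

theorem MultiIndex.induction_single {P : MultiIndex → Prop} (h0 : P 0)
    (hs : ∀ κ i, P κ → P (κ + Finsupp.single i 1)) (κ : MultiIndex) : P κ := by
  induction hn : κ.degree generalizing κ with
  | zero =>
    rw [Finsupp.degree_eq_zero_iff] at hn
    exact hn ▸ h0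
  | succ n ih =>
    obtain ⟨i, hi⟩ : ∃ i, κ i ≠ 0 := by
      by_contra! hc
      rw [show κ = 0 from Finsupp.ext hc] at hn
      simp at hn
    have h1 := sub_single_add_single hi
    rw [← h1]
    refine hs _ i (ih _ ?_)
    have h2 := congrArg Finsupp.degree h1
    rw [map_add, Finsupp.degree_single, hn] at h2
    omega

theorem windex_zero (f : ℤ → ℝ) : windex f 0 = 0 := Finsupp.sum_zero_index

theorem windex_mono {f g : ℤ → ℝ} {κ : MultiIndex} (h : ∀ i, κ i ≠ 0 → f i ≤ g i) :
    windex f κ ≤ windex g κ :=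
  Finset.sum_le_sum fun i hi => mul_le_mul_of_nonneg_right (h i (Finsupp.mem_support_iff.mp hi))
    (Nat.cast_nonneg _)

theorem windex_nonneg {f : ℤ → ℝ} (h : ∀ i, 0 ≤ f i) (κ : MultiIndex) : 0 ≤ windex f κ :=
  Finset.sum_nonneg fun i _ => mul_nonneg (h i) (Nat.cast_nonneg _)

theorem abs_windex_le (f : ℤ → ℝ) (κ : MultiIndex) : |windex f κ| ≤ windex (fun i => |f i|) κ := by
  refine (Finset.abs_sum_le_sum_abs _ _).trans_eq (Finset.sum_congr rfl fun i _ => ?_)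
  rw [abs_mul, Nat.abs_cast]

theorem windex_mul_left (c : ℝ) (f : ℤ → ℝ) (κ : MultiIndex) :
    windex (fun i => c * f i) κ = c * windex f κ := by
  simp only [windex, Finsupp.sum, Finset.mul_sum, mul_assoc]

theorem windex_add_left (f g : ℤ → ℝ) (κ : MultiIndex) :
    windex (fun i => f i + g i) κ = windex f κ + windex g κ := by
  simp only [windex, Finsupp.sum, ← Finset.sum_add_distrib, add_mul]

theorem mpow_exp (g : ℤ → ℝ) (κ : MultiIndex) :
    mpow (fun i => Real.exp (g i)) κ = Real.exp (windex g κ) := by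
  simp only [mpow, windex, Finsupp.prod, Finsupp.sum, Real.exp_sum]
  refine Finset.prod_congr rfl fun i _ => ?_
  rw [mul_comm, Real.exp_nat_mul]

/-- A sum of numbers at least `2` is at most their product, because `x + y ≤ x y` for `x, y ≥ 2`. -/
theorem windex_le_mpow {f : ℤ → ℝ} (hf : ∀ i, 2 ≤ f i) {κ : MultiIndex} (hκ : κ ≠ 0) :
    windex f κ ≤ mpow f κ ∧ 2 ≤ windex f κ := by
  have key : κ = 0 ∨ (windex f κ ≤ mpow f κ ∧ 2 ≤ windex f κ) := by
    induction κ using MultiIndex.induction_single with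
    | h0 => exact Or.inl rfl
    | hs κ i ih =>
      right
      by_cases h0 : κ = 0
      · rw [h0, zero_add, windex_single, mpow_single]
        simpa using hf i
      · obtain ⟨h1, h2⟩ := (ih h0).resolve_left h0
        have hi := hf i
        rw [windex_add, mpow_add, windex_single, mpow_single, pow_one, Nat.cast_one, mul_one]
        constructor
        · nlinarith
        · linarith
  exact key.resolve_left hκ

theorem two_le_bracketTwo (j : ℤ) : 2 ≤ bracketTwo j := le_max_left _ _

theorem abs_le_bracketTwo (j : ℤ) : |(j : ℝ)| ≤ bracketTwo j := le_max_right _ _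

theorem bracketTwo_pos (j : ℤ) : 0 < bracketTwo j := two_pos.trans_le (two_le_bracketTwo j)

/-- `∑ κ_i ln ⌊i⌋`. -/
def logSize (κ : MultiIndex) : ℝ := windex (fun i => Real.log (bracketTwo i)) κ

theorem exp_logSize (κ : MultiIndex) : Real.exp (logSize κ) = mpow bracketTwo κ := by
  rw [logSize, ← mpow_exp]
  congr 1
  funext i
  exact Real.exp_log (bracketTwo_pos i)

theorem logSize_add (κ κ' : MultiIndex) : logSize (κ + κ') = logSize κ + logSize κ' :=
  windex_add _ _ _

theorem logSize_single (i : ℤ) : logSize (Finsupp.single i 1) = Real.log (bracketTwo i) := by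
  rw [logSize, windex_single, Nat.cast_one, mul_one]

theorem log_bracketTwo_nonneg (i : ℤ) : 0 ≤ Real.log (bracketTwo i) :=
  Real.log_nonneg (by linarith [two_le_bracketTwo i])

theorem logSize_nonneg (κ : MultiIndex) : 0 ≤ logSize κ :=
  windex_nonneg log_bracketTwo_nonneg κ

theorem two_le_exp_logSize {κ : MultiIndex} (hκ : κ ≠ 0) : 2 ≤ Real.exp (logSize κ) := by
  obtain ⟨h1, h2⟩ := windex_le_mpow two_le_bracketTwo hκ
  rw [exp_logSize]
  linarith

theorem log_bracketTwo_le_logSize {j : ℤ} {κ : MultiIndex} (hκ : κ ≠ 0)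
    (hj : |(j : ℝ)| ≤ windex (fun i => |(i : ℝ)|) κ) : Real.log (bracketTwo j) ≤ logSize κ := by
  obtain ⟨h1, h2⟩ := windex_le_mpow two_le_bracketTwo hκ
  rw [Real.log_le_iff_le_exp (bracketTwo_pos j), exp_logSize]
  refine max_le (by linarith) (hj.trans (le_trans ?_ h1))
  exact windex_mono fun i _ => abs_le_bracketTwo i

/-- The monomials of a Hamiltonian vector field: the index `j` of a component, the largest index
`k` of the remaining ones, and the exponents `α`, `β` of the others. -/
structure IndexSplit (a : MultiIndex × MultiIndex) (j k : ℤ) (α β : MultiIndex) : Prop where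
  rest : restIndex a j = α + β + Finsupp.single k 1
  le : ∀ i, (α + β) i ≠ 0 → |(i : ℝ)| ≤ |(k : ℝ)|
  ne_zero : α + β ≠ 0
  cases : (a.1 = α + Finsupp.single k 1 ∧ a.2 = β + Finsupp.single j 1) ∨
    (a.1 = α ∧ a.2 = β + Finsupp.single k 1 + Finsupp.single j 1)

/-- `k` is an index of largest modulus in `restIndex a j`. It is carried either by `u` or by `ū`;
accordingly `ω_k` and `ω_j` enter the divisor with opposite or equal signs. Degree at least three
leaves a nonzero exponent besides `j` and `k`. -/
theorem exists_indexSplit {a : MultiIndex × MultiIndex} {j : ℤ} (hj : a.2 j ≠ 0)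
    (hd : 3 ≤ totalDegree a) : ∃ k α β, IndexSplit a j k α β := by
  have h2 := sub_single_add_single hj
  set b := a.2 - Finsupp.single j 1 with hb
  have hdeg : totalDegree a = a.1.degree + a.2.degree := rfl
  have hdeg2 : a.2.degree = b.degree + 1 := by rw [← h2, map_add, Finsupp.degree_single]
  have hrest : restIndex a j = a.1 + b := rfl
  have hne : (a.1 + b).support.Nonempty := by
    rw [Finsupp.support_nonempty_iff]
    intro h0
    have := congrArg Finsupp.degree h0
    rw [map_add, map_zero] at this
    omega
  obtain ⟨k, hk, hmax⟩ := Finset.exists_max_image _ (fun i : ℤ => |(i : ℝ)|) hne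
  have hk0 : a.1 k + b k ≠ 0 := Finsupp.mem_support_iff.mp hk
  have aux : ∀ α β : MultiIndex, a.1 + b = α + β + Finsupp.single k 1 →
      (∀ i, (α + β) i ≠ 0 → |(i : ℝ)| ≤ |(k : ℝ)|) ∧ α + β ≠ 0 := by
    intro α β h
    refine ⟨fun i hi => hmax i ?_, fun h0 => ?_⟩
    · rw [Finsupp.mem_support_iff, h, Finsupp.add_apply]
      omega
    · have := congrArg Finsupp.degree h
      rw [h0, zero_add, Finsupp.degree_single, map_add] at this
      omega
  by_cases h1 : a.1 k ≠ 0
  · have h3 := sub_single_add_single h1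
    have h4 : a.1 + b = a.1 - Finsupp.single k 1 + b + Finsupp.single k 1 := by
      rw [add_right_comm, h3]
    obtain ⟨h5, h6⟩ := aux _ _ h4
    exact ⟨k, a.1 - Finsupp.single k 1, b, hrest.trans h4, h5, h6, Or.inl ⟨h3.symm, h2.symm⟩⟩
  · have h3 := sub_single_add_single (κ := b) (j := k) (by omega)
    have h4 : a.1 + b = a.1 + (b - Finsupp.single k 1) + Finsupp.single k 1 := by
      rw [add_assoc, h3]
    obtain ⟨h5, h6⟩ := aux _ _ h4
    refine ⟨k, a.1, b - Finsupp.single k 1, hrest.trans h4, h5, h6, Or.inr ⟨rfl, ?_⟩⟩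
    rw [h3, h2]

/-- Momentum conservation expresses `j` as a signed sum of the other indices. -/
theorem abs_le_windex_restIndex {a : MultiIndex × MultiIndex} {j : ℤ} (hj : a.2 j ≠ 0)
    (hm : momentum a = 0) : |(j : ℝ)| ≤ windex (fun i => |(i : ℝ)|) (restIndex a j) := by
  have h1 := momentum_eq_windex a
  have h2 := congrArg (windex fun i => (i : ℝ)) (sub_single_add_single hj)
  rw [windex_add, windex_single] at h2
  rw [hm] at h1
  push_cast at h1 h2
  have h3 := abs_windex_le (fun i => (i : ℝ)) a.1
  have h4 := abs_windex_le (fun i => (i : ℝ)) (a.2 - Finsupp.single j 1)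
  rw [restIndex, windex_add]
  have h5 : (j : ℝ) = windex (fun i => (i : ℝ)) a.1
    - windex (fun i => (i : ℝ)) (a.2 - Finsupp.single j 1) := by linarith
  rw [h5]
  exact (abs_sub _ _).trans (add_le_add h3 h4)

/-! ### Small divisors -/

theorem beamFrequency_bounds {m : ℝ} (hm : m ∈ Set.Icc (1 : ℝ) 2) (j : ℤ) :
    (j : ℝ) ^ 2 ≤ beamFrequency m j ∧ beamFrequency m j ≤ (j : ℝ) ^ 2 + 3 / 2 ∧
      beamFrequency m j ≤ 2 * bracketTwo j ^ 2 := by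
  have e : |(j : ℝ)| ^ 4 = ((j : ℝ) ^ 2) ^ 2 := by
    rw [← abs_pow, abs_of_nonneg (by positivity)]; ring
  have h1 := hm.1
  have h2 := hm.2
  have hj : (j : ℝ) ^ 2 + 3 / 2 ≤ 2 * bracketTwo j ^ 2 := by
    have h3 := two_le_bracketTwo j
    have h4 : (j : ℝ) ^ 2 ≤ bracketTwo j ^ 2 := by
      rw [← sq_abs]; exact pow_le_pow_left₀ (abs_nonneg _) (abs_le_bracketTwo j) 2
    nlinarith
  have h5 : beamFrequency m j ≤ (j : ℝ) ^ 2 + 3 / 2 := by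
    rw [beamFrequency, e]
    apply Real.sqrt_le_iff.mpr
    constructor
    · positivity
    · nlinarith [sq_nonneg (j : ℝ)]
  refine ⟨?_, h5, h5.trans hj⟩
  rw [beamFrequency, e]
  apply Real.le_sqrt_of_sq_le
  linarith

/-- Factor `j ^ 2 - k ^ 2` through moduli: the factor `|j| - |k|` is a nonzero integer. -/
theorem abs_add_abs_le_of_sq_ne {j k : ℤ} (h : |j| ≠ |k|) :
    |(j : ℝ)| + |(k : ℝ)| ≤ |(j : ℝ) ^ 2 - (k : ℝ) ^ 2| := by
  have h1 : (1 : ℤ) ≤ |(|j| - |k|)| := Int.one_le_abs (sub_ne_zero.mpr h)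
  have h2 : (|j| + |k|) * 1 ≤ (|j| + |k|) * |(|j| - |k|)| := by gcongr
  have h3 : (|j| + |k|) * |(|j| - |k|)| = |j ^ 2 - k ^ 2| := by
    conv_lhs => rw [← abs_of_nonneg (by positivity : 0 ≤ |j| + |k|), ← abs_mul]
    congr 1
    rw [← sq_abs j, ← sq_abs k]
    ring
  rw [mul_one, h3] at h2
  exact_mod_cast h2

theorem abs_le_sq_int (j : ℤ) : |(j : ℝ)| ≤ (j : ℝ) ^ 2 := by
  have : |j| ≤ j ^ 2 := by
    rcases eq_or_ne j 0 with rfl | h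
    · simp
    · rw [← sq_abs]
      exact le_self_pow₀ (Int.one_le_abs h) two_ne_zero
  exact_mod_cast this

theorem windex_beamFrequency_le {m : ℝ} (hm : m ∈ Set.Icc (1 : ℝ) 2) {κ : MultiIndex} (hκ : κ ≠ 0) :
    windex (beamFrequency m) κ ≤ 2 * Real.exp (logSize κ) ^ 2 := by
  have h1 : windex (beamFrequency m) κ ≤ windex (fun i => 2 * (bracketTwo i * bracketTwo i)) κ :=
    windex_mono fun i _ => (beamFrequency_bounds hm i).2.2.trans_eq (by ring)
  have h2 := (windex_le_mpow (f := fun i => bracketTwo i * bracketTwo i)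
    (fun i => by nlinarith [two_le_bracketTwo i]) hκ).1
  rw [windex_mul_left] at h1
  rw [mpow_mul, ← exp_logSize] at h2
  linarith

theorem log_bracketTwo_le {j : ℤ} {E : ℝ} (hE : 2 ≤ Real.exp E)
    (h : |(j : ℝ)| ≤ 5 * Real.exp E ^ 2) : Real.log (bracketTwo j) ≤ Real.log 5 + 2 * E := by
  rw [Real.log_le_iff_le_exp (bracketTwo_pos j), Real.exp_add, Real.exp_log (by norm_num), two_mul,
    Real.exp_add, ← sq]
  exact max_le (by nlinarith) h

/-- If the divisor of a monomial is less than one, its two largest indices either cancel, or are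
bounded by the others. -/
theorem IndexSplit.cancel_or_bounded {m : ℝ} (hm : m ∈ Set.Icc (1 : ℝ) 2)
    {a : MultiIndex × MultiIndex} {j k : ℤ} {α β : MultiIndex} (h : IndexSplit a j k α β)
    (hmom : momentum a = 0) (hlt : |monoFreq (beamFrequency m) a| < 1) :
    (a.1 = α + Finsupp.single j 1 ∧ a.2 = β + Finsupp.single j 1) ∨
      (Real.log (bracketTwo j) ≤ Real.log 5 + 2 * logSize (α + β) ∧
        Real.log (bracketTwo k) ≤ Real.log 5 + 2 * logSize (α + β)) := by
  set ω := beamFrequency m with hωd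
  set E := Real.exp (logSize (α + β)) with hE
  have hE2 : 2 ≤ E := two_le_exp_logSize h.ne_zero
  have htot : windex ω (α + β) ≤ 2 * E ^ 2 := windex_beamFrequency_le hm h.ne_zero
  have hω0 : ∀ i, 0 ≤ ω i := fun i => Real.sqrt_nonneg _
  have hα := windex_nonneg hω0 α
  have hβ := windex_nonneg hω0 β
  rw [windex_add] at htot
  obtain ⟨j1, j2, -⟩ := beamFrequency_bounds hm j
  obtain ⟨k1, k2, -⟩ := beamFrequency_bounds hm k
  have hj := abs_le_sq_int j
  have hk := abs_le_sq_int k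
  rw [abs_lt, monoFreq] at hlt
  suffices hs : (a.1 = α + Finsupp.single j 1 ∧ a.2 = β + Finsupp.single j 1) ∨
      (|(j : ℝ)| ≤ 5 * E ^ 2 ∧ |(k : ℝ)| ≤ 5 * E ^ 2) from
    hs.imp_right fun h' => ⟨log_bracketTwo_le hE2 h'.1, log_bracketTwo_le hE2 h'.2⟩
  rcases h.cases with ⟨h1, h2⟩ | ⟨h1, h2⟩
  · by_cases hjk : j = k
    · subst hjk
      exact Or.inl ⟨h1, h2⟩
    right
    rw [h1, h2, windex_add, windex_add, windex_single, windex_single] at hlt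
    simp only [Nat.cast_one, mul_one] at hlt
    -- If `k = -j` the two frequencies cancel, but the momenta add up to `2 |j|` in modulus and are
    -- compensated by the other indices. If `|j| ≠ |k|`, then `ω_j - ω_k` is within a constant of `j
    -- ^ 2 - k ^ 2`, whose modulus is at least `|j| + |k|`.
    by_cases hjk' : |j| = |k|
    · have hkj : k = -j := by
        rcases abs_eq_abs.mp hjk' with h' | h'
        · exact absurd h' hjk
        · omega
      have h3 := momentum_eq_windex a
      rw [hmom, h1, h2, windex_add, windex_add, windex_single, windex_single, hkj] at h3
      push_cast at h3
      have h4 := abs_windex_le (fun i => (i : ℝ)) α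
      have h5 := abs_windex_le (fun i => (i : ℝ)) β
      have h6 : windex (fun i => |(i : ℝ)|) (α + β) ≤ E := by
        have := (windex_le_mpow two_le_bracketTwo h.ne_zero).1
        rw [← exp_logSize] at this
        exact (windex_mono fun i _ => abs_le_bracketTwo i).trans this
      rw [windex_add] at h6
      have h7 : 2 * (j : ℝ) = windex (fun i => (i : ℝ)) α - windex (fun i => (i : ℝ)) β := by
        linarith
      have h8 : 2 * |(j : ℝ)| ≤ E := by
        have h9 : |2 * (j : ℝ)| = 2 * |(j : ℝ)| := by
          rw [abs_mul, abs_of_pos (two_pos (α := ℝ))]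
        rw [← h9, h7]
        exact (abs_sub _ _).trans (by linarith)
      have h10 : |(k : ℝ)| = |(j : ℝ)| := by rw [hkj]; push_cast; exact abs_neg _
      rw [h10]
      exact ⟨by nlinarith [abs_nonneg (j : ℝ)], by nlinarith [abs_nonneg (j : ℝ)]⟩
    · have h3 := abs_add_abs_le_of_sq_ne hjk'
      have h4 : |(j : ℝ) ^ 2 - (k : ℝ) ^ 2| ≤ 2 * E ^ 2 + 5 / 2 := by
        rw [abs_le]
        constructor <;> linarith
      exact ⟨by nlinarith [abs_nonneg (k : ℝ)], by nlinarith [abs_nonneg (j : ℝ)]⟩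
  -- Here both frequencies have the same sign, so `j ^ 2 + k ^ 2` itself is bounded by the rest.
  · right
    rw [h1, h2, windex_add, windex_add, windex_single, windex_single] at hlt
    simp only [Nat.cast_one, mul_one] at hlt
    exact ⟨by nlinarith [sq_nonneg (k : ℝ)], by nlinarith [sq_nonneg (j : ℝ)]⟩

/-- From `c ≤ 2 ^ (c - 1) ≤ x ^ (c - 1)` one gets `c x ≤ x ^ c`; then `1 + y ^ 2 ≤ y ^ 4` for `y = x
^ c ≥ 2`. -/
theorem one_add_sq_mul_sq_le {x : ℝ} (hx : 2 ≤ x) {c : ℕ} (hc : c ≠ 0) :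
    1 + (c : ℝ) ^ 2 * x ^ 2 ≤ x ^ (4 * c) := by
  obtain ⟨n, rfl⟩ := Nat.exists_eq_succ_of_ne_zero hc
  have h1 : ((n.succ : ℕ) : ℝ) ≤ 2 ^ n := by exact_mod_cast Nat.lt_two_pow_self
  have h2 : ((n.succ : ℕ) : ℝ) ≤ x ^ n := h1.trans (by gcongr)
  have hn : (1 : ℝ) ≤ x ^ n := one_le_pow₀ (by linarith)
  have h3 : ((n.succ : ℕ) : ℝ) ^ 2 * x ^ 2 ≤ (x ^ n) ^ 2 * x ^ 2 := by gcongr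
  have h4 : x ^ (4 * n.succ) = (x ^ n) ^ 2 * x ^ 2 * ((x ^ n) ^ 2 * x ^ 2) := by
    rw [Nat.succ_eq_add_one]; ring
  have h5 : 4 ≤ (x ^ n) ^ 2 * x ^ 2 := by nlinarith [one_le_pow₀ hn (n := 2)]
  rw [h4]
  nlinarith

theorem prod_le_exp_logSize {ℓ : ℤ →₀ ℤ} {κ : MultiIndex} (h : ∀ n, |ℓ n| ≤ κ n) :
    ∏ n ∈ ℓ.support, (1 + (ℓ n : ℝ) ^ 2 * bracketOne n ^ 2) ≤ Real.exp (4 * logSize κ) := by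
  have hsub : ℓ.support ⊆ κ.support := fun n hn => by
    rw [Finsupp.mem_support_iff] at hn ⊢
    intro h0
    have := h n
    rw [h0] at this
    exact hn (abs_nonpos_iff.mp (by simpa using this))
  have e : Real.exp (4 * logSize κ) = ∏ n ∈ κ.support, bracketTwo n ^ (4 * κ n) := by
    rw [show 4 * logSize κ = ((4 : ℕ) : ℝ) * logSize κ by norm_num, Real.exp_nat_mul, exp_logSize,
      mpow, Finsupp.prod, ← Finset.prod_pow]
    exact Finset.prod_congr rfl fun n _ => by rw [← pow_mul, mul_comm]
  rw [e]
  calc ∏ n ∈ ℓ.support, (1 + (ℓ n : ℝ) ^ 2 * bracketOne n ^ 2)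
      ≤ ∏ n ∈ ℓ.support, bracketTwo n ^ (4 * κ n) := by
        refine Finset.prod_le_prod (fun n _ => by positivity) fun n hn => ?_
        refine le_trans ?_ (one_add_sq_mul_sq_le (two_le_bracketTwo n)
          (Finsupp.mem_support_iff.mp (hsub hn)))
        have h1 : (ℓ n : ℝ) ^ 2 ≤ (κ n : ℝ) ^ 2 := by
          rw [← sq_abs]
          have : |(ℓ n : ℝ)| ≤ κ n := by exact_mod_cast h n
          gcongr
        have h2 : bracketOne n ≤ bracketTwo n := max_le_max one_le_two le_rfl
        have h3 : 0 ≤ bracketOne n := zero_le_one.trans (le_max_left _ _)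
        gcongr
    _ ≤ _ := by
        have h1 : ∀ n, 1 ≤ bracketTwo n ^ (4 * κ n) := fun n =>
          one_le_pow₀ (by linarith [two_le_bracketTwo n])
        rw [← Finset.prod_sdiff hsub]
        refine le_mul_of_one_le_left (Finset.prod_nonneg fun n _ => by linarith [h1 n]) ?_
        have h2 := Finset.prod_le_prod (s := κ.support \ ℓ.support) (fun _ _ => zero_le_one)
          fun n _ => h1 n
        rwa [Finset.prod_const_one] at h2

/-- The divisor depends on `α - β` only, so `b` may omit indices that cancel in `a`. The factor `4`
comes from bounding each `1 + ℓ_n ^ 2 ⟨n⟩ ^ 2` by `⌊n⌋` to the power `4 (b.1 + b.2) n`. -/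
theorem exp_le_abs_monoFreq {γ : ℝ} (hγ : 0 < γ) (hγ1 : γ < 1) {ω : ℤ → ℝ} (hω : ω ∈ diophantine γ)
    {a b : MultiIndex × MultiIndex} (hmom : momentum a = 0) (hres : ¬ IsResonantIndex a)
    (hb : ∀ n, (a.1 n : ℤ) - a.2 n = (b.1 n : ℤ) - b.2 n) {D : ℕ} (hD : totalDegree a = D) :
    γ ^ D * Real.exp (-(4 * (D * (D + 2)) * logSize (b.1 + b.2))) ≤ |monoFreq ω a| := by
  let c : MultiIndex → (ℤ →₀ ℤ) := fun κ => κ.mapRange (fun n : ℕ => (n : ℤ)) rfl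
  set ℓ : ℤ →₀ ℤ := c a.1 - c a.2 with hℓ
  have hℓn : ∀ n, ℓ n = (a.1 n : ℤ) - a.2 n := fun n => rfl
  have h1 := hω ℓ ⟨a, hmom, hres, hℓn⟩
  have hsum : (ℓ.sum fun n k => ω n * (k : ℝ)) = monoFreq ω a := by
    rw [hℓ, Finsupp.sum_sub_index fun n x y => by push_cast; ring]
    have : ∀ κ : MultiIndex, ((c κ).sum fun n k => ω n * (k : ℝ)) = windex ω κ := fun κ => by
      rw [Finsupp.sum_mapRange_index fun n => by simp]
      simp [windex]
    rw [this, this, monoFreq]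
  rw [hsum] at h1
  refine le_trans ?_ h1
  set d := ℓ.support.card with hd
  have hcard : ∀ κ : MultiIndex, κ.support.card ≤ κ.degree := fun κ => by
    rw [Finset.card_eq_sum_ones]
    exact Finset.sum_le_sum fun n hn =>
      Nat.one_le_iff_ne_zero.mpr (Finsupp.mem_support_iff.mp hn)
  have hdD : d ≤ D := by
    have hs : ℓ.support ⊆ a.1.support ∪ a.2.support := fun n hn => by
      rw [Finset.mem_union, Finsupp.mem_support_iff, Finsupp.mem_support_iff]
      rw [Finsupp.mem_support_iff, hℓn] at hn
      omega
    calc d ≤ a.1.support.card + a.2.support.card :=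
          (Finset.card_le_card hs).trans (Finset.card_union_le _ _)
      _ ≤ a.1.degree + a.2.degree := add_le_add (hcard _) (hcard _)
      _ = D := hD
  have hP := prod_le_exp_logSize (ℓ := ℓ) (κ := b.1 + b.2) fun n => by
    rw [hℓn, hb, Finsupp.add_apply, abs_le]
    push_cast
    constructor <;> omega
  have hS := logSize_nonneg (b.1 + b.2)
  have hpos : 0 < ∏ n ∈ ℓ.support, (1 + (ℓ n : ℝ) ^ 2 * bracketOne n ^ 2) :=
    Finset.prod_pos fun n _ => by positivity
  rw [Finset.prod_inv_distrib, Finset.prod_pow, Real.exp_neg]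
  refine mul_le_mul (pow_le_pow_of_le_one hγ.le hγ1.le hdD) ?_ (by positivity) (by positivity)
  refine inv_anti₀ (by positivity) ?_
  calc _ ≤ Real.exp (4 * logSize (b.1 + b.2)) ^ (d * (d + 2)) := by gcongr
    _ = Real.exp ((d * (d + 2) : ℕ) * (4 * logSize (b.1 + b.2))) := (Real.exp_nat_mul _ _).symm
    _ ≤ _ := by
        apply Real.exp_le_exp.mpr
        push_cast
        have : (d : ℝ) ≤ D := by exact_mod_cast hdD
        calc (d : ℝ) * (d + 2) * (4 * logSize (b.1 + b.2))
            ≤ D * (D + 2) * (4 * logSize (b.1 + b.2)) := by gcongr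
          _ = _ := by ring

/-- The lower bound of the small divisors in terms of the indices other than the two largest. -/
theorem IndexSplit.exp_le_abs_monoFreq {m γ : ℝ} (hm : m ∈ Set.Icc (1 : ℝ) 2) (hγ : 0 < γ)
    (hγ1 : γ < 1) (hω : beamFrequency m ∈ diophantine γ) {a : MultiIndex × MultiIndex} {j k : ℤ}
    {α β : MultiIndex} (h : IndexSplit a j k α β) (hmom : momentum a = 0)
    (hres : ¬ IsResonantIndex a) {D : ℕ} (hD : totalDegree a = D) :
    γ ^ D * Real.exp (-(40 * (D * (D + 2)) * logSize (α + β)))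
      ≤ |monoFreq (beamFrequency m) a| := by
  have hS := logSize_nonneg (α + β)
  rcases le_or_gt 1 |monoFreq (beamFrequency m) a| with h1 | h1
  · refine le_trans (mul_le_one₀ (pow_le_one₀ hγ.le hγ1.le) (Real.exp_nonneg _) ?_) h1
    rw [Real.exp_le_one_iff, neg_nonpos]
    positivity
  · rcases h.cancel_or_bounded hm hmom h1 with ⟨h2, h3⟩ | ⟨h2, h3⟩
    · refine le_trans ?_ (BeamBNF.exp_le_abs_monoFreq hγ hγ1 hω hmom hres (b := (α, β))
        (fun n => ?_) hD)
      · gcongr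
        norm_num
      · rw [h2, h3, Finsupp.add_apply, Finsupp.add_apply]
        push_cast
        ring
    · refine le_trans ?_ (BeamBNF.exp_le_abs_monoFreq hγ hγ1 hω hmom hres (b := a)
        (fun n => rfl) hD)
      -- Here `10 = 1 + 2 (5/2 + 2)`, using `log 5 ≤ 5/2 log 2` and `log 2 ≤ logSize (α + β)`. This
      -- is what turns `4` into `40`.
      have h4 : logSize (a.1 + a.2) ≤ 10 * logSize (α + β) := by
        have h5 : a.1 + a.2 = α + β + Finsupp.single k 1 + Finsupp.single j 1 := by
          rcases h.cases with ⟨h6, h7⟩ | ⟨h6, h7⟩ <;> rw [h6, h7] <;> abel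
        have h8 : Real.log 2 ≤ logSize (α + β) :=
          (Real.log_le_iff_le_exp two_pos).mpr (two_le_exp_logSize h.ne_zero)
        have h9 : Real.log 5 ≤ 5 / 2 * Real.log 2 := by
          have : 2 * Real.log 5 ≤ 5 * Real.log 2 := by
            rw [← Real.log_rpow (by norm_num), ← Real.log_rpow (by norm_num)]
            apply Real.log_le_log (by norm_num)
            norm_num
          linarith
        rw [h5, logSize_add, logSize_add, logSize_single, logSize_single]
        linarith
      gcongr ?_ * Real.exp (-?_)
      calc 4 * ((D : ℝ) * (D + 2)) * logSize (a.1 + a.2)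
          ≤ 4 * ((D : ℝ) * (D + 2)) * (10 * logSize (α + β)) := by gcongr
        _ = _ := by ring

/-! ### Subadditivity of the exponents of the weights -/

/-- From `log z ≤ z - 1` at `z = e ^ (5/3) / y` and `e ^ (5/3) ≤ 16/3`. Read as `1 - 2 / y ≤ 3/8 log
y`, it is sharp enough for the constant `9/10` in the next inequality. -/
theorem eight_thirds_mul_le_log {y : ℝ} (hy : 0 < y) : 8 / 3 * (1 - 2 / y) ≤ Real.log y := by
  have h1 := Real.log_le_sub_one_of_pos (x := Real.exp (5 / 3) / y) (by positivity)
  rw [Real.log_div (Real.exp_ne_zero _) hy.ne', Real.log_exp] at h1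
  have h2 : Real.exp (5 / 3) ≤ 16 / 3 := by
    refine le_of_pow_le_pow_left₀ (n := 3) (by norm_num) (by norm_num) ?_
    rw [← Real.exp_nat_mul]
    have h3 : Real.exp ((3 : ℕ) * (5 / 3)) = Real.exp 1 ^ 5 := by
      rw [← Real.exp_nat_mul]; norm_num
    rw [h3]
    calc Real.exp 1 ^ 5 ≤ 2.7182818286 ^ 5 := by gcongr; exact Real.exp_one_lt_d9.le
      _ ≤ _ := by norm_num
  have h4 : Real.exp (5 / 3) / y ≤ 16 / 3 / y := by gcongr
  have h5 : 8 / 3 * (1 - 2 / y) = 8 / 3 - 16 / 3 / y := by ring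
  linarith

/-- Put `x = 2 + a`, `y = 2 + b`, `t = b / y`. Expanding `(log x + b / x) ^ 2`, and using that `log
/ id` decreases beyond `e`, the excess over `log x ^ 2` is at most `2 t log y + t ^ 2`. Since `t ≤
3/8 log y`, this is at most `57/64 log y ^ 2`. A constant below one is essential: the remaining
tenth pays for the small divisors. -/
theorem sq_log_add_le {a b : ℝ} (hb : 1 ≤ b) (hab : b ≤ a) :
    Real.log (2 + (a + b)) ^ 2 ≤ Real.log (2 + a) ^ 2 + 9 / 10 * Real.log (2 + b) ^ 2 := by
  set x := 2 + a with hx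
  set y := 2 + b with hy
  have hy3 : 3 ≤ y := by linarith
  have hyx : y ≤ x := by linarith
  have hx0 : 0 < x := by linarith
  have hy0 : 0 < y := by linarith
  have he : Real.exp 1 ≤ y := (Real.exp_one_lt_d9.le.trans (by norm_num)).trans hy3
  have hanti := Real.log_div_self_antitoneOn (a := y) (b := x) he (he.trans hyx) hyx
  have hB := eight_thirds_mul_le_log hy0
  have hA0 : 0 ≤ Real.log x := Real.log_nonneg (by linarith)
  have h1 : Real.log (2 + (a + b)) ≤ Real.log x + b / x := by
    rw [show 2 + (a + b) = x * (1 + b / x) by field_simp; linarith,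
      Real.log_mul hx0.ne' (by positivity)]
    have := Real.log_le_sub_one_of_pos (x := 1 + b / x) (by positivity)
    linarith
  have h0 : 0 ≤ Real.log (2 + (a + b)) := Real.log_nonneg (by linarith)
  set B := Real.log y with hBd
  set t := 1 - 2 / y with ht
  have ht0 : 0 ≤ t := by
    rw [ht, sub_nonneg, div_le_one hy0]; linarith
  have hbt : b / y = t := by rw [ht, eq_sub_iff_add_eq, ← add_div, div_eq_one_iff_eq hy0.ne']; linarith
  have h2 : b / x ≤ t := by rw [← hbt]; gcongr
  have h3 : Real.log x * (b / x) ≤ B * t := by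
    calc Real.log x * (b / x) = b * (Real.log x / x) := by ring
      _ ≤ b * (B / y) := by gcongr
      _ = B * t := by rw [← hbt]; ring
  have h4 : 0 ≤ b / x := by positivity
  have h5 : (b / x) ^ 2 ≤ t ^ 2 := by gcongr
  calc Real.log (2 + (a + b)) ^ 2 ≤ (Real.log x + b / x) ^ 2 := by gcongr
    _ = Real.log x ^ 2 + 2 * (Real.log x * (b / x)) + (b / x) ^ 2 := by ring
    _ ≤ Real.log x ^ 2 + 2 * (B * t) + t ^ 2 := by gcongr
    _ ≤ Real.log x ^ 2 + 9 / 10 * B ^ 2 := by nlinarith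

/-- The case `q = 2` is raised to the power `q / 2 ≤ 1`. Bernoulli's inequality linearizes the
power, and `(B / A) ^ 2 ≤ (B / A) ^ q` because `B ≤ A`. -/
theorem rpow_log_add_le {q a b : ℝ} (hq : 1 < q) (hq2 : q ≤ 2) (hb : 1 ≤ b) (hab : b ≤ a) :
    Real.log (2 + (a + b)) ^ q ≤ Real.log (2 + a) ^ q + 9 / 10 * Real.log (2 + b) ^ q := by
  have h := sq_log_add_le hb hab
  have hA : 0 < Real.log (2 + a) := Real.log_pos (by linarith)
  have hB : 0 < Real.log (2 + b) := Real.log_pos (by linarith)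
  have hX : 0 ≤ Real.log (2 + (a + b)) := Real.log_nonneg (by linarith)
  have hBA : Real.log (2 + b) ≤ Real.log (2 + a) := Real.log_le_log (by linarith) (by linarith)
  set A := Real.log (2 + a)
  set B := Real.log (2 + b)
  set X := Real.log (2 + (a + b))
  have ht0 : 0 < B / A := by positivity
  have ht1 : B / A ≤ 1 := (div_le_one hA).mpr hBA
  have e : ∀ z : ℝ, 0 ≤ z → (z ^ 2) ^ (q / 2) = z ^ q := fun z hz => by
    rw [← Real.rpow_natCast, ← Real.rpow_mul hz]
    congr 1
    push_cast
    ring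
  calc X ^ q = (X ^ 2) ^ (q / 2) := (e X hX).symm
    _ ≤ (A ^ 2 + 9 / 10 * B ^ 2) ^ (q / 2) := by gcongr
    _ = (A ^ 2) ^ (q / 2) * (1 + 9 / 10 * (B / A) ^ 2) ^ (q / 2) := by
        rw [← Real.mul_rpow (by positivity) (by positivity)]
        congr 1
        field_simp
    _ ≤ (A ^ 2) ^ (q / 2) * (1 + q / 2 * (9 / 10 * (B / A) ^ 2)) := by
        gcongr
        exact rpow_one_add_le_one_add_mul_self (by linarith [sq_nonneg (B / A)]) (by linarith)
          (by linarith)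
    _ ≤ (A ^ 2) ^ (q / 2) * (1 + 9 / 10 * (B / A) ^ q) := by
        have h1 : (B / A) ^ 2 ≤ (B / A) ^ q := by
          rw [← Real.rpow_natCast]
          exact Real.rpow_le_rpow_of_exponent_ge ht0 ht1 (by exact_mod_cast hq2)
        have h2 : q / 2 * (9 / 10 * (B / A) ^ 2) ≤ 9 / 10 * (B / A) ^ q := by
          nlinarith [sq_nonneg (B / A)]
        gcongr
    _ = A ^ q + 9 / 10 * B ^ q := by
        rw [e A hA.le, Real.div_rpow hB.le hA.le]
        have : 0 < A ^ q := Real.rpow_pos_of_pos hA q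
        field_simp

theorem one_le_bracketOne (j : ℤ) : 1 ≤ bracketOne j := le_max_left _ _

theorem abs_le_bracketOne (j : ℤ) : |(j : ℝ)| ≤ bracketOne j := le_max_right _ _

theorem lam_nonneg (q : ℝ) (j : ℤ) : 0 ≤ lam q j :=
  Real.rpow_nonneg (Real.log_nonneg (by linarith [one_le_bracketOne j])) q

/-- The indices of `κ` are added to `k` one at a time. As `k` dominates them all, each is at most
the sum already accumulated, and each costs only nine tenths of its `λ`. -/
theorem lam_le_of_abs_le {q : ℝ} (hq : 1 < q) (hq2 : q ≤ 2) {j k : ℤ} {κ : MultiIndex}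
    (hκ : ∀ i, κ i ≠ 0 → |(i : ℝ)| ≤ |(k : ℝ)|)
    (hj : |(j : ℝ)| ≤ |(k : ℝ)| + windex (fun i => |(i : ℝ)|) κ) :
    lam q j ≤ lam q k + 9 / 10 * windex (lam q) κ := by
  have hb : ∀ i, 0 ≤ bracketOne i := fun i => zero_le_one.trans (one_le_bracketOne i)
  have key : (∀ i, κ i ≠ 0 → bracketOne i ≤ bracketOne k) →
      Real.log (2 + (bracketOne k + windex bracketOne κ)) ^ q
        ≤ lam q k + 9 / 10 * windex (lam q) κ := by
    clear hj hκ
    induction κ using MultiIndex.induction_single with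
    | h0 => intro _; rw [windex_zero, windex_zero, add_zero, mul_zero, add_zero]; rfl
    | hs κ i ih =>
      intro h
      have h1 := ih fun l hl => h l (by rw [Finsupp.add_apply]; omega)
      have hi : bracketOne i ≤ bracketOne k + windex bracketOne κ := by
        have := h i (by rw [Finsupp.add_apply, Finsupp.single_eq_same]; omega)
        linarith [windex_nonneg hb κ]
      have h2 := rpow_log_add_le hq hq2 (one_le_bracketOne i) hi
      rw [windex_add, windex_add, windex_single, windex_single, Nat.cast_one, mul_one, mul_one,
        ← add_assoc (bracketOne k)]
      refine h2.trans ?_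
      change _ + 9 / 10 * lam q i ≤ _
      linarith
  refine le_trans ?_ (key fun i hi => max_le_max le_rfl (hκ i hi))
  have h1 : windex (fun i => |(i : ℝ)|) κ ≤ windex bracketOne κ :=
    windex_mono fun i _ => abs_le_bracketOne i
  have h2 : bracketOne j ≤ bracketOne k + windex bracketOne κ :=
    max_le (by linarith [one_le_bracketOne k, windex_nonneg hb κ])
      (by linarith [abs_le_bracketOne k])
  have h3 := one_le_bracketOne j
  exact Real.rpow_le_rpow (Real.log_nonneg (by linarith))
    (Real.log_le_log (by linarith) (by linarith)) (by linarith)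

/-! ### Comparison of weights -/

theorem weight_toFun_eq (q s p : ℝ) (j : ℤ) :
    (weight q s p).toFun j = Real.exp (p * Real.log (bracketTwo j) + s * lam q j) := by
  change bracketTwo j ^ p * Real.exp (s * lam q j) = _
  rw [Real.rpow_def_of_pos (bracketTwo_pos j), ← Real.exp_add, mul_comm p]

theorem weight_div (q s s' p p' : ℝ) (j : ℤ) :
    (weight q s' p').toFun j / (weight q s p).toFun j
      = Real.exp ((p' - p) * Real.log (bracketTwo j) + (s' - s) * lam q j) := by
  rw [weight_toFun_eq, weight_toFun_eq, ← Real.exp_sub]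
  congr 1
  ring

theorem mpow_weight_div (q s s' p p' : ℝ) (κ : MultiIndex) :
    mpow (fun i => (weight q s' p').toFun i / (weight q s p).toFun i) κ
      = Real.exp ((p' - p) * logSize κ + (s' - s) * windex (lam q) κ) := by
  simp_rw [weight_div]
  rw [mpow_exp, windex_add_left, windex_mul_left, windex_mul_left, logSize]

theorem one_le_weight {q s p : ℝ} (hs : 0 ≤ s) (hp : 0 ≤ p) (j : ℤ) :
    1 ≤ (weight q s p).toFun j := by
  rw [weight_toFun_eq]
  apply Real.one_le_exp
  have h1 := log_bracketTwo_nonneg j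
  have h2 := lam_nonneg q j
  positivity

section Split

variable {a : MultiIndex × MultiIndex} {j k : ℤ} {α β : MultiIndex}

/-- Raising `s` by `δ` thus gains a factor `exp (-δ / 10 · ∑ λ)`, the sum extending over the indices
other than `j` and `k`. -/
theorem IndexSplit.lam_le (h : IndexSplit a j k α β) {q : ℝ} (hq : 1 < q) (hq2 : q ≤ 2)
    (hj : a.2 j ≠ 0) (hm : momentum a = 0) :
    lam q j + 1 / 10 * windex (lam q) (α + β) ≤ windex (lam q) (restIndex a j) := by
  have h1 := abs_le_windex_restIndex hj hm
  rw [h.rest, windex_add _ (α + β), windex_single, Nat.cast_one, mul_one] at h1 ⊢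
  have h2 := lam_le_of_abs_le hq hq2 h.le (j := j) (by linarith)
  linarith

theorem IndexSplit.log_le (h : IndexSplit a j k α β) (hj : a.2 j ≠ 0) (hm : momentum a = 0) :
    Real.log (bracketTwo j) ≤ logSize (restIndex a j) := by
  refine log_bracketTwo_le_logSize (fun h0 => ?_) (abs_le_windex_restIndex hj hm)
  rw [h.rest] at h0
  have := congrArg Finsupp.degree h0
  rw [map_add, Finsupp.degree_single, map_zero] at this
  omega

theorem IndexSplit.totalDegree_eq (h : IndexSplit a j k α β) :
    totalDegree a = (α + β).degree + 2 := by
  change a.1.degree + a.2.degree = _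
  rcases h.cases with ⟨h1, h2⟩ | ⟨h1, h2⟩
  · rw [h1, h2, map_add, map_add, map_add, Finsupp.degree_single, Finsupp.degree_single]
    omega
  · rw [h1, h2, map_add, map_add, map_add, Finsupp.degree_single, Finsupp.degree_single]
    omega

theorem windex_const (c : ℝ) (κ : MultiIndex) : windex (fun _ => c) κ = c * κ.degree := by
  rw [Finsupp.degree_apply]
  simp [windex, Finsupp.sum, Finset.mul_sum]

/-- No remaining index exceeds `|k|`, so `⌊j⌋ ≤ D ⌊k⌋`, and `⌊k⌋` also occurs in `restIndex a j`.
Raising `p` therefore gains a power of the indices other than `j` and `k`, at the price of a power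
of `D`. -/
theorem IndexSplit.log_le_add (h : IndexSplit a j k α β) (hj : a.2 j ≠ 0) (hm : momentum a = 0)
    {D : ℕ} (hD : totalDegree a = D) :
    Real.log (bracketTwo j) - logSize (restIndex a j) ≤ Real.log D - logSize (α + β) := by
  have hD2 : (α + β).degree + 2 = D := by rw [← hD, h.totalDegree_eq]
  have hDr : (((α + β).degree : ℕ) : ℝ) + 2 = D := by exact_mod_cast hD2
  have h0 : (0 : ℝ) ≤ ((α + β).degree : ℕ) := Nat.cast_nonneg _
  have h1 := abs_le_windex_restIndex hj hm
  have hk := abs_le_bracketTwo k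
  have hk2 := two_le_bracketTwo k
  have h2 : windex (fun i => |(i : ℝ)|) (α + β) ≤ |(k : ℝ)| * (α + β).degree := by
    rw [← windex_const]
    exact windex_mono h.le
  have h3 : bracketTwo j ≤ D * bracketTwo k := by
    rw [h.rest, windex_add _ (α + β), windex_single, Nat.cast_one, mul_one] at h1
    have h4 : |(k : ℝ)| * (α + β).degree ≤ bracketTwo k * (α + β).degree := by gcongr
    rw [← hDr]
    exact max_le (by nlinarith) (by nlinarith)
  have h5 := Real.log_le_log (bracketTwo_pos j) h3
  rw [Real.log_mul (by linarith) (bracketTwo_pos k).ne'] at h5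
  rw [h.rest, logSize_add, logSize_single]
  linarith

end Split

/-- By momentum conservation the ratio of weights at `j` is at most the product of the ratios at the
other indices. -/
theorem fieldSupAntitone_weight {q s s' p p' : ℝ} (hq : 1 < q) (hq2 : q ≤ 2) (hs : s ≤ s')
    (hp : p ≤ p') : FieldSupAntitone (weight q s p) (weight q s' p') := by
  intro F hF r
  have h := fieldSup_change_weight (w := weight q s p) (w' := weight q s' p') (F := F) (G := F)
    zero_le_one (fun a j haj => ?_) r
  · simpa using h
  rw [one_mul, mpow_weight_div, weight_div]
  by_cases h0 : F a = 0
  · simp [h0]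
  have hm := hF.momentum_eq a h0
  obtain ⟨k, α, β, hsp⟩ := exists_indexSplit haj (hF.degree a h0)
  have h1 := hsp.lam_le hq hq2 haj hm
  have h2 := hsp.log_le haj hm
  have h3 := windex_nonneg (lam_nonneg q) (α + β)
  have hs' : 0 ≤ s' - s := by linarith
  have hp' : 0 ≤ p' - p := by linarith
  gcongr
  linarith

/-- In `hM` the first term is the loss from the divisor, and the other two are the effects of
raising `p` and `s`. Both functional settings reduce to bounding this exponent uniformly in the
remaining indices. -/
theorem smallDivisorBound_weight {m γ : ℝ} (hm : m ∈ Set.Icc (1 : ℝ) 2) (hγ : 0 < γ)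
    (hγ1 : γ < 1) (hω : beamFrequency m ∈ diophantine γ) {q s s' p p' : ℝ} (hq : 1 < q)
    (hq2 : q ≤ 2) (hs : s ≤ s') (hp : p ≤ p') {D E : ℕ} (hD : 3 ≤ D) (hDE : D ≤ E) {M : ℝ}
    (hM : ∀ κ : MultiIndex, κ.degree + 2 = D → 40 * (D * (D + 2)) * logSize κ
      + (p' - p) * (Real.log D - logSize κ) - (s' - s) * (1 / 10 * windex (lam q) κ) ≤ M) :
    SmallDivisorBound (beamFrequency m) (weight q s p) (weight q s' p') D
      ((γ ^ E)⁻¹ * Real.exp M) := by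
  intro a hmom hres hdeg
  have hb : ∀ {j}, a.2 j ≠ 0 → ∃ k α β, IndexSplit a j k α β := fun {j} hj =>
    exists_indexSplit hj (by omega)
  constructor
  · intro h0
    have h1 := exp_le_abs_monoFreq hγ hγ1 hω hmom hres (b := a) (fun _ => rfl) hdeg
    rw [h0, abs_zero] at h1
    have : 0 < γ ^ D * Real.exp (-(4 * (D * (D + 2)) * logSize (a.1 + a.2))) := by positivity
    linarith
  · intro j hj
    obtain ⟨k, α, β, hsp⟩ := hb hj
    have h1 := hsp.exp_le_abs_monoFreq hm hγ hγ1 hω hmom hres hdeg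
    have h2 := hsp.lam_le hq hq2 hj hmom
    have h3 := hsp.log_le_add hj hmom hdeg
    have h4 := hM (α + β) (by rw [← hdeg, hsp.totalDegree_eq])
    have hs' : 0 ≤ s' - s := by linarith
    have hp' : 0 ≤ p' - p := by linarith
    have h5 : |monoFreq (beamFrequency m) a|⁻¹
        ≤ (γ ^ E)⁻¹ * Real.exp (40 * (D * (D + 2)) * logSize (α + β)) := by
      calc _ ≤ (γ ^ D * Real.exp (-(40 * (D * (D + 2)) * logSize (α + β))))⁻¹ :=
            inv_anti₀ (by positivity) h1
        _ = (γ ^ D)⁻¹ * Real.exp (40 * (D * (D + 2)) * logSize (α + β)) := by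
            rw [mul_inv, ← Real.exp_neg, neg_neg]
        _ ≤ _ := by
            gcongr ?_ * _
            exact inv_anti₀ (by positivity) (pow_le_pow_of_le_one hγ.le hγ1.le hDE)
    rw [mpow_weight_div, weight_div]
    calc _ ≤ (γ ^ E)⁻¹ * Real.exp (40 * (D * (D + 2)) * logSize (α + β)) *
          Real.exp ((p' - p) * Real.log (bracketTwo j) + (s' - s) * lam q j) := by gcongr
      _ = (γ ^ E)⁻¹ * Real.exp (40 * (D * (D + 2)) * logSize (α + β) +
          ((p' - p) * Real.log (bracketTwo j) + (s' - s) * lam q j)) := by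
          rw [mul_assoc, ← Real.exp_add]
      _ ≤ (γ ^ E)⁻¹ * Real.exp (M + ((p' - p) * logSize (restIndex a j)
          + (s' - s) * windex (lam q) (restIndex a j))) := by
          gcongr ?_ * Real.exp ?_
          have h6 := mul_le_mul_of_nonneg_left h3 hp'
          have h7 := mul_le_mul_of_nonneg_left h2 hs'
          linarith
      _ = _ := by rw [Real.exp_add]; ring

/-! ### Constants -/

/-- A bound of the combinatorial constants in the first `K` steps of the normal form. -/
def combinatorialBound (K : ℕ) : ℝ := (3 * ((K + 1 : ℕ) : ℝ)) ^ (K + 1) * (K + 1 : ℕ) * 2 ^ K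

theorem le_combinatorialBound {K i : ℕ} (hi : i < K) :
    (3 * ((i + 2 : ℕ) : ℝ)) ^ (i + 2) * (i + 2 : ℕ) * 2 ^ i ≤ combinatorialBound K := by
  have h1 : ((i + 2 : ℕ) : ℝ) ≤ (K + 1 : ℕ) := by exact_mod_cast (by omega : i + 2 ≤ K + 1)
  have h2 : (1 : ℝ) ≤ 3 * ((K + 1 : ℕ) : ℝ) := by
    have : (1 : ℝ) ≤ (K + 1 : ℕ) := by exact_mod_cast Nat.succ_pos K
    linarith
  rw [combinatorialBound]
  have h3 : (3 * ((i + 2 : ℕ) : ℝ)) ^ (i + 2) ≤ (3 * ((K + 1 : ℕ) : ℝ)) ^ (K + 1) :=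
    (pow_le_pow_left₀ (by positivity) (by linarith) _).trans
      (pow_le_pow_right₀ h2 (by omega))
  have h4 : (2 : ℝ) ^ i ≤ 2 ^ K := pow_le_pow_right₀ one_le_two hi.le
  gcongr

theorem le_exp_self (x : ℝ) : x ≤ Real.exp x := by linarith [Real.add_one_le_exp x]

theorem combinatorialBound_le {K : ℕ} (hK : 1 ≤ K) :
    96 * K * combinatorialBound K ≤ Real.exp (22 * K ^ 2) ∧
      5 ^ K * combinatorialBound K ≤ Real.exp (22 * K ^ 2) := by
  have hK1 : (1 : ℝ) ≤ K := by exact_mod_cast hK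
  have he : (2 : ℝ) ≤ Real.exp 1 := by linarith [Real.add_one_le_exp 1]
  have h2 : (2 : ℝ) ^ K ≤ Real.exp K := by
    rw [← Real.exp_one_pow]
    gcongr
  have hQ : combinatorialBound K ≤ Real.exp (14 * K ^ 2) := by
    have h3 : 3 * ((K + 1 : ℕ) : ℝ) ≤ Real.exp (6 * K) := by
      refine le_trans ?_ (le_exp_self _)
      push_cast
      linarith
    have h4 : ((K + 1 : ℕ) : ℝ) ≤ Real.exp K := by
      push_cast
      exact Real.add_one_le_exp _
    calc combinatorialBound K ≤ Real.exp (6 * K) ^ (K + 1) * Real.exp K * Real.exp K := by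
          rw [combinatorialBound]
          gcongr
      _ = Real.exp (((K + 1 : ℕ) : ℝ) * (6 * K) + K + K) := by
          rw [Real.exp_add, Real.exp_add, Real.exp_nat_mul]
      _ ≤ _ := by
          apply Real.exp_le_exp.mpr
          push_cast
          nlinarith
  have hQ0 : 0 ≤ combinatorialBound K := by rw [combinatorialBound]; positivity
  constructor
  · have h5 : (96 : ℝ) ≤ Real.exp 7 := by
      calc (96 : ℝ) ≤ 2 ^ 7 := by norm_num
        _ ≤ Real.exp 1 ^ 7 := by gcongr
        _ = Real.exp 7 := by rw [Real.exp_one_pow]; norm_num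
    calc 96 * K * combinatorialBound K ≤ Real.exp 7 * Real.exp K * Real.exp (14 * K ^ 2) := by
          gcongr
          exact le_exp_self _
      _ = Real.exp (7 + K + 14 * K ^ 2) := by rw [Real.exp_add, Real.exp_add]
      _ ≤ _ := by
          apply Real.exp_le_exp.mpr
          nlinarith
  · have h5 : (5 : ℝ) ^ K ≤ Real.exp (K * 4) := by
      rw [Real.exp_nat_mul]
      gcongr
      linarith [Real.add_one_le_exp 4]
    calc 5 ^ K * combinatorialBound K ≤ Real.exp (K * 4) * Real.exp (14 * K ^ 2) := by gcongr
      _ = Real.exp (K * 4 + 14 * K ^ 2) := by rw [Real.exp_add]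
      _ ≤ _ := by
          apply Real.exp_le_exp.mpr
          nlinarith

/-- `(γ ^ E)⁻¹ * exp M` is the constant of the small divisors; the combinatorial factors are
absorbed into `exp (22 K ^ 2)`. -/
theorem constants_le {γ : ℝ} (hγ : 0 < γ) (hγ1 : γ < 1) {K : ℕ} (hK : 1 ≤ K) {E : ℕ} {M N : ℝ}
    (hM : 0 ≤ M) (hN : 22 * K ^ 2 + M ≤ N) :
    96 * K * combinatorialBound K * ((γ ^ E)⁻¹ * Real.exp M) ≤ (γ ^ E)⁻¹ * Real.exp N ∧
      5 ^ K * combinatorialBound K * ((γ ^ E)⁻¹ * Real.exp M) ≤ (γ ^ E)⁻¹ * Real.exp N ∧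
        1 ≤ (γ ^ E)⁻¹ * Real.exp N := by
  obtain ⟨h1, h2⟩ := combinatorialBound_le hK
  have hγE : 1 ≤ (γ ^ E)⁻¹ := (one_le_inv₀ (by positivity)).mpr (pow_le_one₀ hγ.le hγ1.le)
  have h3 : Real.exp (22 * K ^ 2) * ((γ ^ E)⁻¹ * Real.exp M) ≤ (γ ^ E)⁻¹ * Real.exp N := by
    calc _ = (γ ^ E)⁻¹ * Real.exp (22 * K ^ 2 + M) := by rw [Real.exp_add]; ring
      _ ≤ _ := by gcongr
  refine ⟨le_trans (by gcongr) h3, le_trans (by gcongr) h3,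
    one_le_mul_of_one_le_of_one_le hγE (Real.one_le_exp ?_)⟩
  have : (0 : ℝ) ≤ 22 * K ^ 2 := by positivity
  linarith

/-- Young's inequality in the form needed for the sub-exponential weights. -/
theorem mul_sub_rpow_le {q A c x : ℝ} (hq : 1 < q) (hA : 0 ≤ A) (hc : 0 < c) (hx : 0 ≤ x) :
    A * x - c * x ^ q ≤ A * (A / c) ^ (1 / (q - 1)) := by
  have hq0 : 0 < q - 1 := by linarith
  -- The threshold is the positive solution of `A x = c x ^ q` if `A > 0`; beyond it the left side
  -- is nonpositive.
  rcases le_or_gt x ((A / c) ^ (1 / (q - 1))) with h | h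
  · have h1 : 0 ≤ c * x ^ q := mul_nonneg hc.le (Real.rpow_nonneg hx q)
    have h2 : A * x ≤ A * (A / c) ^ (1 / (q - 1)) := by gcongr
    linarith
  · have hx0 : 0 < x := lt_of_le_of_lt (Real.rpow_nonneg (by positivity) _) h
    have h1 : A / c ≤ x ^ (q - 1) := by
      have h2 := Real.rpow_le_rpow (Real.rpow_nonneg (by positivity) _) h.le hq0.le
      rwa [← Real.rpow_mul (by positivity), one_div, inv_mul_cancel₀ hq0.ne', Real.rpow_one] at h2
    have h3 : x ^ q = x ^ (q - 1) * x := by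
      rw [← Real.rpow_add_one hx0.ne']
      congr 1
      ring
    rw [div_le_iff₀ hc] at h1
    have h4 : A * x ≤ c * x ^ q := by
      rw [h3]
      nlinarith
    have h5 : 0 ≤ A * (A / c) ^ (1 / (q - 1)) :=
      mul_nonneg hA (Real.rpow_nonneg (by positivity) _)
    linarith

theorem log_bracketTwo_rpow_le_lam {q : ℝ} (hq : 1 < q) (j : ℤ) :
    Real.log (bracketTwo j) ^ q ≤ lam q j := by
  refine Real.rpow_le_rpow (log_bracketTwo_nonneg j) ?_ (by linarith)
  refine Real.log_le_log (bracketTwo_pos j) (max_le ?_ ?_)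
  · linarith [one_le_bracketOne j]
  · linarith [abs_le_bracketOne j]

theorem mul_log_sub_lam_le {q A c : ℝ} (hq : 1 < q) (hA : 0 ≤ A) (hc : 0 < c) (j : ℤ) :
    A * Real.log (bracketTwo j) - c * lam q j ≤ A * (A / c) ^ (1 / (q - 1)) := by
  have h1 := mul_sub_rpow_le hq hA hc (log_bracketTwo_nonneg j)
  have h2 := mul_le_mul_of_nonneg_left (log_bracketTwo_rpow_le_lam hq j) hc.le
  linarith

/-- Since `λ(j) ≥ (ln ⌊j⌋) ^ q`, Young's inequality applies to each index separately; counted with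
multiplicity there are `κ.degree` of them. -/
theorem mul_logSize_sub_lam_le {q A c : ℝ} (hq : 1 < q) (hA : 0 ≤ A) (hc : 0 < c)
    (κ : MultiIndex) :
    A * logSize κ - c * windex (lam q) κ ≤ κ.degree * (A * (A / c) ^ (1 / (q - 1))) := by
  have h1 := windex_mono (κ := κ) fun i _ => mul_log_sub_lam_le hq hA hc i
  rw [windex_const] at h1
  have h2 : windex (fun i => A * Real.log (bracketTwo i) - c * lam q i) κ
      = A * logSize κ - c * windex (lam q) κ := by
    have e : (fun i => A * Real.log (bracketTwo i) - c * lam q i)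
        = fun i => A * Real.log (bracketTwo i) + (-c) * lam q i := by
      funext i
      ring
    rw [e, windex_add_left, windex_mul_left, windex_mul_left, logSize]
    ring
  rw [h2] at h1
  linarith

/-- The exponent lost to the small divisors with sub-exponential weights is absorbed by `J`. -/
theorem subexponential_exponent_le {q s : ℝ} (hq : 1 < q) (hq2 : q ≤ 2) (hs : 0 < s)
    (hs1 : s ≤ 1) {K : ℕ} (hK : 1 ≤ K) :
    22 * K ^ 2 + K * (600 * K ^ 2 * (12000 * K ^ 3 / s) ^ (1 / (q - 1)))
      ≤ Real.exp ((K ^ 2 * 12000 / s) ^ (1 / (q - 1))) := by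
  have hK1 : (1 : ℝ) ≤ K := by exact_mod_cast hK
  set e := 1 / (q - 1) with he
  have he1 : 1 ≤ e := by
    rw [he, le_div_iff₀ (by linarith)]
    linarith
  set z : ℝ := K ^ 2 * 12000 / s with hz
  have hzK : 12000 * (K : ℝ) ^ 2 ≤ z := by
    rw [hz, le_div_iff₀ hs]
    nlinarith [sq_nonneg (K : ℝ)]
  have hKK : (K : ℝ) ≤ K ^ 2 := by nlinarith
  have hz1 : 12000 ≤ z := by nlinarith
  have hKz : (K : ℝ) ≤ z := by linarith
  set y := z ^ e with hy
  have hzy : z ≤ y := Real.self_le_rpow_of_one_le (by linarith) he1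
  -- Since `12000 K ^ 3 / s = z K` and `K ≤ z`, everything is polynomial in `y = z ^ e`. The
  -- exponent is at most `2 y ^ 4 ≤ y ^ 5 / 120 ≤ exp y`, as `y ≥ 12000`; this gives the double
  -- exponential in `J`.
  have h1 : (12000 * (K : ℝ) ^ 3 / s) ^ e ≤ y ^ 2 := by
    rw [show 12000 * (K : ℝ) ^ 3 / s = z * K by rw [hz]; ring,
      Real.mul_rpow (by linarith) (by linarith), sq]
    gcongr
    exact Real.rpow_le_rpow (by linarith) hKz (by linarith)
  have h2 : (K : ℝ) * (600 * K ^ 2) ≤ y ^ 2 := by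
    calc (K : ℝ) * (600 * K ^ 2) ≤ (12000 * K ^ 2) * (12000 * K ^ 2) := by nlinarith [sq_nonneg (K : ℝ)]
      _ ≤ z * z := by gcongr
      _ ≤ y * y := by gcongr
      _ = y ^ 2 := (sq y).symm
  have h3 : (K : ℝ) * (600 * K ^ 2 * (12000 * K ^ 3 / s) ^ e) ≤ y ^ 4 := by
    calc _ = (K : ℝ) * (600 * K ^ 2) * (12000 * K ^ 3 / s) ^ e := by ring
      _ ≤ y ^ 2 * y ^ 2 := by gcongr
      _ = y ^ 4 := by ring
  have hy1 : 12000 ≤ y := hz1.trans hzy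
  have h4 : 22 * (K : ℝ) ^ 2 ≤ y ^ 4 := by
    have : y ≤ y ^ 4 := le_self_pow₀ (by linarith) (by norm_num)
    linarith
  have h5 := Real.pow_div_factorial_le_exp y (by linarith) 5
  have h6 : 2 * y ^ 4 ≤ y ^ 5 / (5 : ℕ).factorial := by
    rw [le_div_iff₀ (by positivity)]
    have : ((5 : ℕ).factorial : ℝ) = 120 := by norm_num [Nat.factorial]
    rw [this, pow_succ y 4]
    have : 0 ≤ y ^ 4 := by positivity
    nlinarith
  linarith

/-! ### The two chains of weights -/

/-- As `ω_j ≤ 2 ⌊j⌋ ^ 2`, the weight only has to dominate `⌊j⌋` up to a constant factor. -/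
theorem abs_beamFrequency_le {m : ℝ} (hm : m ∈ Set.Icc (1 : ℝ) 2) {w : Weight} {c : ℝ}
    (hw : ∀ j, 2 * Real.log (bracketTwo j) - c ≤ 2 * Real.log (w.toFun j)) (j : ℤ) :
    |beamFrequency m j| ≤ 2 * Real.exp c * w.toFun j ^ 2 := by
  have h0 : 0 ≤ beamFrequency m j := Real.sqrt_nonneg _
  rw [abs_of_nonneg h0]
  refine (beamFrequency_bounds hm j).2.2.trans ?_
  have e : ∀ x : ℝ, 0 < x → x ^ 2 = Real.exp (2 * Real.log x) := fun x hx => by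
    rw [show 2 * Real.log x = Real.log x + Real.log x by ring, Real.exp_add, Real.exp_log hx, sq]
  rw [e _ (bracketTwo_pos j), e _ (w.pos j), mul_assoc, ← Real.exp_add]
  gcongr
  linarith [hw j]

/-- With `D = i + 3` one has `40 D (D + 2) ≤ 600 (i + 1) ^ 2 ≤ 36 ^ 2 (i + 1) ^ 2`, so the gain in
the weight cancels the loss for all indices. Only `D ^ (p' - p)` is left; `log D ≤ 2 K` gives `2592
= 2 · 36 ^ 2`. -/
theorem sobolev_smallDivisorBound {m γ : ℝ} (hm : m ∈ Set.Icc (1 : ℝ) 2) (hγ : 0 < γ)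
    (hγ1 : γ < 1) (hω : beamFrequency m ∈ diophantine γ) {q p p' : ℝ} (hq : 1 < q) (hq2 : q ≤ 2)
    {K i : ℕ} (hi : i < K) (hp : p' - p = 36 ^ 2 * ((i + 1 : ℕ) : ℝ) ^ 2) :
    SmallDivisorBound (beamFrequency m) (weight q 0 p) (weight q 0 p') (i + 3)
      ((γ ^ (4 * K))⁻¹ * Real.exp (2592 * K ^ 3)) := by
  have hp0 : p ≤ p' := by
    have : 0 ≤ p' - p := by rw [hp]; positivity
    linarith
  refine smallDivisorBound_weight hm hγ hγ1 hω hq hq2 le_rfl hp0 (by omega) (by omega)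
    fun κ _ => ?_
  have hP := logSize_nonneg κ
  have hI : ((i + 1 : ℕ) : ℝ) ≤ K := by exact_mod_cast hi
  have hI1 : (1 : ℝ) ≤ (i + 1 : ℕ) := by exact_mod_cast Nat.succ_pos i
  have hD : ((i + 3 : ℕ) : ℝ) = (i + 1 : ℕ) + 2 := by push_cast; ring
  have hlog : Real.log ((i + 3 : ℕ) : ℝ) ≤ 2 * K := by
    have := Real.log_le_sub_one_of_pos (x := ((i + 3 : ℕ) : ℝ)) (by positivity)
    rw [hD] at this ⊢
    linarith
  rw [hp, sub_self, zero_mul, sub_zero]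
  have h1 : 40 * (((i + 3 : ℕ) : ℝ) * ((i + 3 : ℕ) + 2)) ≤ 36 ^ 2 * ((i + 1 : ℕ) : ℝ) ^ 2 := by
    rw [hD]
    nlinarith
  have h2 := mul_le_mul_of_nonneg_right h1 hP
  have h3 : 36 ^ 2 * ((i + 1 : ℕ) : ℝ) ^ 2 * Real.log ((i + 3 : ℕ) : ℝ)
      ≤ 36 ^ 2 * (K : ℝ) ^ 2 * (2 * K) := by
    gcongr
  have h4 : 36 ^ 2 * (K : ℝ) ^ 2 * (2 * K) = 2592 * K ^ 3 := by ring
  linarith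

/-- The loss is at most `600 K ^ 2` times the sum of the logarithms, and the gain at least `t / (20
K)` times the sum of the `λ`. Young's inequality is applied at each of at most `K` remaining
indices, with `600 K ^ 2 · 20 K = 12000 K ^ 3`. -/
theorem subexponential_smallDivisorBound {m γ : ℝ} (hm : m ∈ Set.Icc (1 : ℝ) 2) (hγ : 0 < γ)
    (hγ1 : γ < 1) (hω : beamFrequency m ∈ diophantine γ) {q p s s' t : ℝ} (hq : 1 < q)
    (hq2 : q ≤ 2) (ht : 0 < t) {K i : ℕ} (hi : i < K) (hs : t / (2 * K) ≤ s' - s) :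
    SmallDivisorBound (beamFrequency m) (weight q s p) (weight q s' p) (i + 3)
      ((γ ^ (4 * K))⁻¹ *
        Real.exp (K * (600 * K ^ 2 * (12000 * K ^ 3 / t) ^ (1 / (q - 1))))) := by
  have hK1 : (1 : ℝ) ≤ K := by exact_mod_cast (by omega : 1 ≤ K)
  have hσ : 0 < t / (2 * K) := by positivity
  refine smallDivisorBound_weight hm hγ hγ1 hω hq hq2 (by linarith) le_rfl (by omega) (by omega)
    fun κ hκ => ?_
  have hP := logSize_nonneg κ
  have hlam := windex_nonneg (lam_nonneg q) κ
  have hI : ((i + 1 : ℕ) : ℝ) ≤ K := by exact_mod_cast hi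
  have hI1 : (1 : ℝ) ≤ (i + 1 : ℕ) := by exact_mod_cast Nat.succ_pos i
  have hD : ((i + 3 : ℕ) : ℝ) = (i + 1 : ℕ) + 2 := by push_cast; ring
  have hdeg : ((κ.degree : ℕ) : ℝ) ≤ K := by exact_mod_cast (by omega : κ.degree ≤ K)
  have h1 : 40 * (((i + 3 : ℕ) : ℝ) * ((i + 3 : ℕ) + 2)) ≤ 600 * (K : ℝ) ^ 2 := by
    rw [hD]
    nlinarith
  have h2 := mul_logSize_sub_lam_le (q := q) (A := 600 * (K : ℝ) ^ 2) (c := t / (20 * K)) hq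
    (by positivity) (by positivity) κ
  rw [show 600 * (K : ℝ) ^ 2 / (t / (20 * K)) = 12000 * K ^ 3 / t by field_simp; ring] at h2
  have h3 : t / (20 * K) * windex (lam q) κ ≤ (s' - s) * (1 / 10 * windex (lam q) κ) := by
    calc t / (20 * K) * windex (lam q) κ = t / (2 * K) * (1 / 10 * windex (lam q) κ) := by
          field_simp
          ring
      _ ≤ _ := by gcongr
  have h4 := mul_le_mul_of_nonneg_right h1 hP
  have h5 : (κ.degree : ℝ) * (600 * (K : ℝ) ^ 2 * (12000 * K ^ 3 / t) ^ (1 / (q - 1)))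
      ≤ K * (600 * (K : ℝ) ^ 2 * (12000 * K ^ 3 / t) ^ (1 / (q - 1))) := by
    have : 0 ≤ (12000 * (K : ℝ) ^ 3 / t) ^ (1 / (q - 1)) := Real.rpow_nonneg (by positivity) _
    gcongr
  rw [sub_self, zero_mul, add_zero]
  linarith

end BeamBNF

end

/-! ### Proof of the normal form theorem in the two settings -/

theorem theorem6p1 :
    ∃ C : ℝ, 0 < C ∧
      ∀ (q : ℝ), 1 < q → q ≤ 2 →
      ∀ (m : ℝ), m ∈ Set.Icc (1 : ℝ) 2 →
      ∀ (γ : ℝ), 0 < γ → γ < 1 → BeamBNF.beamFrequency m ∈ BeamBNF.diophantine γ →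
      ∀ (p : ℝ), 0 < p →
      ∀ (K : ℕ), 1 ≤ K →
      ∀ (star : BeamBNF.Setting) (w₀ wf : BeamBNF.Weight) (J : ℝ),
        w₀ = star.initialWeight q p → wf = star.finalWeight q p K → J = star.J C q γ K →
      ∀ (rbar : ℝ), 0 < rbar →
      ∀ (R₀ : BeamBNF.Ham), BeamBNF.IsRegular rbar w₀ R₀ → BeamBNF.ScalingDegreeGE 1 R₀ →
      ∀ (ρ : ℝ), ρ = (BeamBNF.hamNorm rbar w₀ R₀).toReal → ρ ≤ 1 →
      ∀ (r₀ : ℝ), 0 < r₀ → r₀ ≤ BeamBNF.rStar rbar ρ J K →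
      ∃ Φ : BeamBNF.HSpace wf → BeamBNF.HSpace wf,
        BeamBNF.IsSymplecticOn Φ (Metric.closedBall 0 (r₀ / 2)) ∧
        Set.MapsTo Φ (Metric.closedBall 0 (r₀ / 2)) (Metric.closedBall 0 r₀) ∧
        (∀ u ∈ Metric.closedBall (0 : BeamBNF.HSpace wf) (r₀ / 2),
          ‖Φ u - u‖ ≤ BeamBNF.constOne rbar ρ J * r₀ ^ 2) ∧
        BeamBNF.constOne rbar ρ J * r₀ ^ 2 ≤ r₀ / 8 ∧
        ∃ Z R : BeamBNF.Ham,
          (BeamBNF.IsRegular (r₀ / 2) wf Z ∧ BeamBNF.IsResonant Z ∧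
            BeamBNF.ScalingDegreeLE K Z) ∧
          (BeamBNF.IsRegular (r₀ / 2) wf R ∧ BeamBNF.ScalingDegreeGE (K + 1) R) ∧
          (∀ u ∈ Metric.closedBall (0 : BeamBNF.HSpace wf) (r₀ / 2),
            (BeamBNF.quadraticHam (BeamBNF.beamFrequency m) (Φ u) : ℂ) + R₀.eval (Φ u)
              = (BeamBNF.quadraticHam (BeamBNF.beamFrequency m) u : ℂ) + Z.eval u + R.eval u) ∧
          BeamBNF.hamNorm (r₀ / 2) wf Z
            ≤ ENNReal.ofReal (BeamBNF.constTwo rbar ρ J K * r₀ ^ 2) ∧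
          BeamBNF.hamNorm (r₀ / 2) wf R
            ≤ ENNReal.ofReal (BeamBNF.constThree rbar ρ J K * r₀ ^ (K + 1)) := by
  -- The constant is dictated by the sub-exponential setting, as `600 · 20`; for the Sobolev weights
  -- it is far larger than needed.
  refine ⟨12000, by norm_num, ?_⟩
  intro q hq hq2 m hm γ hγ hγ1 hω p hp K hK star w₀ wf J hw₀ hwf hJ rbar hrbar R₀ hR₀ hdeg ρ hρ
    hρ1 r₀ hr₀ hr₀'
  have hK1 : (1 : ℝ) ≤ K := by exact_mod_cast hK
  cases star with
  | subexponential s₀ hs₀ =>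
    -- `K` equal increments of `s` lead from `s₀` to `3 s₀ / 2`, while `p` stays fixed.
    obtain ⟨W, hWd⟩ : ∃ W : ℕ → BeamBNF.Weight,
      W = fun i : ℕ => BeamBNF.weight q (s₀ + i * (s₀ / (2 * K))) p := ⟨_, rfl⟩
    have hW0 : w₀ = W 0 := by
      rw [hw₀, hWd]
      simp [BeamBNF.Setting.initialWeight]
    have hWK : wf = W K := by
      rw [hwf, hWd]
      simp only [BeamBNF.Setting.finalWeight]
      congr 1
      field_simp
      norm_num
    have hstep : ∀ i : ℕ, s₀ + (i + 1 : ℕ) * (s₀ / (2 * K)) - (s₀ + i * (s₀ / (2 * K)))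
        = s₀ / (2 * K) := fun i => by push_cast; ring
    have hσ : 0 < s₀ / (2 * K) := by positivity
    have ht : 0 < min s₀ 1 := lt_min hs₀ one_pos
    subst hW0 hWK
    obtain ⟨h1, h2, h3⟩ := BeamBNF.constants_le hγ hγ1 hK (E := 4 * K)
      (M := K * (600 * K ^ 2 * (12000 * K ^ 3 / min s₀ 1) ^ (1 / (q - 1)))) (by positivity)
      (BeamBNF.subexponential_exponent_le hq hq2 ht (min_le_right _ _) hK)
    have hJ' : J = (γ ^ (4 * K))⁻¹
        * Real.exp (Real.exp ((K ^ 2 * 12000 / min s₀ 1) ^ (1 / (q - 1)))) := hJ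
    rw [← hJ'] at h1 h2 h3
    have hone : ∀ i j, 1 ≤ (W i).toFun j := fun i j => by
      rw [hWd]
      exact BeamBNF.one_le_weight (by positivity) hp.le j
    refine BeamBNF.exists_normal_form hK (hone 0) (hone K)
      (BeamBNF.abs_beamFrequency_le hm (c := 2 * (2 / (3 * s₀)) ^ (1 / (q - 1))) fun j => ?_)
      (fun i hi => ?_) (by positivity) (fun i hi => ?_)
      (fun i hi => BeamBNF.le_combinatorialBound hi) h1 h2 h3 hrbar hR₀ hdeg hρ hρ1 hr₀ hr₀'
    · have hj := BeamBNF.mul_log_sub_lam_le hq (A := 2) (c := 3 * s₀) (by norm_num)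
        (by positivity) j
      have hlog := BeamBNF.log_bracketTwo_nonneg j
      have e : s₀ + K * (s₀ / (2 * K)) = 3 / 2 * s₀ := by
        field_simp
        norm_num
      rw [hWd]
      simp only
      rw [BeamBNF.weight_toFun_eq, Real.log_exp, e]
      have : 0 ≤ p * Real.log (BeamBNF.bracketTwo j) := by positivity
      linarith
    · rw [hWd]
      exact BeamBNF.fieldSupAntitone_weight hq hq2 (by linarith [hstep i]) le_rfl
    · rw [hWd]
      refine BeamBNF.subexponential_smallDivisorBound hm hγ hγ1 hω hq hq2 ht hi ?_
      rw [hstep]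
      gcongr
      exact min_le_left _ _
  | sobolev =>
    -- The weights follow the partial sums of `ζ`: step `i` raises `p` by `36 ^ 2 (i + 1) ^ 2`, in
    -- line with the growth of the divisor exponent with the degree.
    obtain ⟨W, hWd⟩ : ∃ W : ℕ → BeamBNF.Weight, W = fun i : ℕ =>
      BeamBNF.weight q 0 (p + 36 ^ 2 * ∑ l ∈ Finset.Icc 1 i, (l : ℝ) ^ 2) := ⟨_, rfl⟩
    have hW0 : w₀ = W 0 := by
      rw [hw₀, hWd]
      simp [BeamBNF.Setting.initialWeight]
    have hWK : wf = W K := by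
      rw [hwf, hWd]
      rfl
    have hsum : ∀ i : ℕ, ∑ l ∈ Finset.Icc 1 (i + 1), (l : ℝ) ^ 2
        = ∑ l ∈ Finset.Icc 1 i, (l : ℝ) ^ 2 + ((i + 1 : ℕ) : ℝ) ^ 2 := fun i =>
      Finset.sum_Icc_succ_top (by omega) _
    subst hW0 hWK
    obtain ⟨h1, h2, h3⟩ := BeamBNF.constants_le hγ hγ1 hK (E := 4 * K) (M := 2592 * (K : ℝ) ^ 3)
      (N := 12000 * 2 ^ 12 * (K : ℝ) ^ 3) (by positivity) (by
        have : (K : ℝ) ^ 2 ≤ K ^ 3 := pow_le_pow_right₀ hK1 (by norm_num)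
        have : (0 : ℝ) ≤ K ^ 3 := by positivity
        linarith)
    have hJ' : J = (γ ^ (4 * K))⁻¹ * Real.exp (12000 * 2 ^ 12 * (K : ℝ) ^ 3) := hJ
    rw [← hJ'] at h1 h2 h3
    have hone : ∀ i j, 1 ≤ (W i).toFun j := fun i j => by
      rw [hWd]
      exact BeamBNF.one_le_weight le_rfl (by positivity) j
    refine BeamBNF.exists_normal_form hK (hone 0) (hone K)
      (BeamBNF.abs_beamFrequency_le hm (c := 0) fun j => ?_)
      (fun i hi => ?_) (by positivity) (fun i hi => ?_)
      (fun i hi => BeamBNF.le_combinatorialBound hi) h1 h2 h3 hrbar hR₀ hdeg hρ hρ1 hr₀ hr₀'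
    · have hlog := BeamBNF.log_bracketTwo_nonneg j
      -- The first term alone gives `ζ ≥ 36 ^ 2`, so the final weight dominates `⌊j⌋` even for small
      -- `p`.
      have hle : (1 : ℝ) ≤ ∑ l ∈ Finset.Icc 1 K, (l : ℝ) ^ 2 := by
        have := Finset.single_le_sum (f := fun l : ℕ => (l : ℝ) ^ 2) (fun l _ => by positivity)
          (Finset.mem_Icc.mpr ⟨le_rfl, hK⟩)
        simpa using this
      rw [hWd]
      simp only
      rw [BeamBNF.weight_toFun_eq, Real.log_exp]
      nlinarith
    · rw [hWd]
      refine BeamBNF.fieldSupAntitone_weight hq hq2 le_rfl ?_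
      rw [hsum]
      nlinarith [sq_nonneg ((i + 1 : ℕ) : ℝ)]
    · rw [hWd]
      refine BeamBNF.sobolev_smallDivisorBound hm hγ hγ1 hω hq hq2 hi ?_
      rw [hsum]
      ring
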